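/- Let $n\ge 2$ be an integer and let $m$ be a positive integer or half-integer (a half-integer is an odd integer divided by $2$). Let $$\mathcal A=\{(x_1,\dots,x_n)\in\mathbb R^n : x_1>x_2>\dots>x_n>0 \text{ and } x_1+x_2<2m\}$$ be the (scaled) alcove of type $\tilde B_n$, let $\eta=(\eta_1,\dots,\eta_n)$ be a vector of integers in $\mathcal A$, and put $|\eta|=\eta_1+\dots+\eta_n$. Let $N_k$ be the number of walks which start at $\eta$, consist of exactly $k$ steps, each of the form $\pm e_j$ with $e_j$ a standard unit vector, and stay in $\mathcal A$ (the end point is arbitrary). Write $P_\eta$ for $$\prod_{1\le h<t\le n}\Big(\sin\tfrac{\pi(\eta_h-\eta_t)}{2m}\,\sin\tfrac{\pi(t-h)}{2m}\,\sin\tfrac{\pi(\eta_h+\eta_t)}{2m}\,\sin\tfrac{\pi(t+h)}{2m}\Big)\prod_{h=1}^n\Big(\sin\tfrac{\pi\eta_h}{2m}\,\sin\tfrac{\pi h}{2m}\Big),$$ and for real $c$ put $$R(c)=\prod_{h=1}^{2n}\frac{\sin\frac{\pi(c-n+h)}{4m}}{\sin\frac{\pi h}{4m}},\qquad Q(c)=\prod_{h=1}^{n-1}\prod_{t=1}^{n}\frac{\sin\frac{\pi(c+t-h)}{2m}}{\sin\frac{\pi(n+t-h)}{2m}},\qquad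 D_h=\cos\tfrac{\pi(2h-1)}{4m}\,\sin\tfrac{\pi h}{2m}.$$ Then, as $k\to\infty$ through all positive integers, the following holds, where $f(k)\sim g(k)$ means that $f(k)-g(k)=o(g(k))$. (In the degenerate case $m=n$ both sides are $0$ for every $k\ge1$.) 1. If $m$ is an integer with parity equal to that of $n$, then $$N_k\sim\frac{4^{n^2}}{2(2m)^n}\Big(\frac{\sin\frac{n\pi}{m}}{\sin\frac{\pi}{2m}}\Big)^kP_\eta\Big(R(m)Q(m)+R(m-1)Q(m-1)$$ $$+(-1)^{|\eta|+k+\binom{n+1}2}\,Q(m)\prod_{h=1}^n\frac{\cos\frac{\pi(m-n+2h-1)}{4m}\,\sin\frac{\pi(m-n+2h)}{4m}}{D_h}$$ $$+(-1)^{|\eta|+k+\binom n2}\,Q(m-1)\prod_{h=1}^n\frac{\sin\frac{\pi(m-n+2h-2)}{4m}\,\cos\frac{\pi(m-n+2h-1)}{4m}}{D_h}\Big).$$ 2. If $m$ is an integer with parity different from that of $n$, then $$N_k\sim\frac{4^{n^2}}{2(2m)^n}\Big(\frac{\sin\frac{n\pi}{m}}{\sin\frac{\pi}{2m}}\Big)^kP_\eta\Big(R(m)Q(m)+R(m-1)Q(m-1)$$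 $$+(-1)^{|\eta|+k+\binom n2}\,Q(m)\prod_{h=1}^n\frac{\sin\frac{\pi(m-n+2h-1)}{4m}\,\cos\frac{\pi(m-n+2h)}{4m}}{D_h}$$ $$+(-1)^{|\eta|+k+\binom{n+1}2}\,Q(m-1)\prod_{h=1}^n\frac{\cos\frac{\pi(m-n+2h-2)}{4m}\,\sin\frac{\pi(m-n+2h-1)}{4m}}{D_h}\Big).$$ 3. If $m$ is a half-integer, then $$N_k\sim\frac{4^{n^2}}{(2m)^n}\Big(\frac{\sin\frac{n\pi}{m}}{\sin\frac{\pi}{2m}}\Big)^kP_\eta\,R(\lfloor m\rfloor)\,Q(\lfloor m\rfloor).$$ -/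

import Mathlib

/-- The (scaled) alcove of type `B̃_n`: the points `(x_1, …, x_n)` of `ℝⁿ` with
`x_1 > x_2 > ⋯ > x_n > 0` and `x_1 + x_2 < 2m`. Coordinates are indexed from `0`, so that `x_1`
and `x_2` are `x 0` and `x 1`. Since the definition refers to `x_2`, it is meant for `n ≥ 2`. -/
def alcoveB (n : ℕ) (m : ℝ) : Set (Fin n → ℝ) :=
  {x | (∀ i j : Fin n, i < j → x j < x i) ∧ (∀ i : Fin n, 0 < x i) ∧
    ∀ i j : Fin n, (i : ℕ) = 0 → (j : ℕ) = 1 → x i + x j < 2 * m}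

/-- A half-integer is an odd number divided by `2`. -/
def IsHalfInteger (m : ℝ) : Prop := ∃ a : ℤ, Odd a ∧ m = (a : ℝ) / 2

/-- The standard step `± e_j`. The `2n` pairs `(j, ±1)` give the `2n` different standard steps. -/
def standardStep {n : ℕ} (s : Fin n × ℤˣ) : Fin n → ℤ := Pi.single s.1 (s.2 : ℤ)

/-- The position, after `i` steps, of the walk that starts at `η` and makes the standard steps
`s 0, s 1, …, s (k - 1)`. -/
def walkPosition {n k : ℕ} (η : Fin n → ℤ) (s : Fin k → Fin n × ℤˣ) (i : ℕ) : Fin n → ℤ :=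
  η + ∑ j ∈ Finset.univ.filter (fun j : Fin k => (j : ℕ) < i), standardStep (s j)

/-- The number of walks that start at `η`, proceed for exactly `k` standard steps, and stay in the
alcove of type `B̃_n` at all times (a walk is given by its starting point and its steps). -/
noncomputable def numWalksB (n : ℕ) (m : ℝ) (η : Fin n → ℤ) (k : ℕ) : ℕ :=
  Nat.card {s : Fin k → Fin n × ℤˣ //
    ∀ i ≤ k, (fun j => (walkPosition η s i j : ℝ)) ∈ alcoveB n m}

/-- The product
`∏_{1≤h<t≤n} (sin (π(η_h-η_t)/2m) sin (π(t-h)/2m) sin (π(η_h+η_t)/2m) sin (π(t+h)/2m))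
  ∏_{1≤h≤n} (sin (πη_h/2m) sin (πh/2m))`.
The index `h` of the mathematics is `h + 1` here. -/
noncomputable def startProd (n : ℕ) (m : ℝ) (η : Fin n → ℤ) : ℝ :=
  (∏ h : Fin n, ∏ t ∈ Finset.Ioi h,
      (Real.sin (Real.pi * ((η h : ℝ) - (η t : ℝ)) / (2 * m)) *
        Real.sin (Real.pi * (((t : ℕ) + 1 : ℝ) - ((h : ℕ) + 1 : ℝ)) / (2 * m)) *
        Real.sin (Real.pi * ((η h : ℝ) + (η t : ℝ)) / (2 * m)) *
        Real.sin (Real.pi * (((t : ℕ) + 1 : ℝ) + ((h : ℕ) + 1 : ℝ)) / (2 * m)))) *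
    ∏ h : Fin n,
      (Real.sin (Real.pi * (η h : ℝ) / (2 * m)) *
        Real.sin (Real.pi * ((h : ℕ) + 1 : ℝ) / (2 * m)))

/-- The product `∏_{h=1}^{2n} sin (π(c-n+h)/4m) / sin (πh/4m)`. -/
noncomputable def rowProd (n : ℕ) (m c : ℝ) : ℝ :=
  ∏ h ∈ Finset.Icc 1 (2 * n),
    Real.sin (Real.pi * (c - n + h) / (4 * m)) / Real.sin (Real.pi * h / (4 * m))

/-- The product `∏_{h=1}^{n-1} ∏_{t=1}^{n} sin (π(c+t-h)/2m) / sin (π(n+t-h)/2m)`. -/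
noncomputable def rectProd (n : ℕ) (m c : ℝ) : ℝ :=
  ∏ h ∈ Finset.Icc 1 (n - 1), ∏ t ∈ Finset.Icc 1 n,
    Real.sin (Real.pi * (c + t - h) / (2 * m)) / Real.sin (Real.pi * (n + t - h) / (2 * m))

/-- The growth rate `sin (nπ/m) / sin (π/2m)`. -/
noncomputable def growthRate (n : ℕ) (m : ℝ) : ℝ :=
  Real.sin (n * Real.pi / m) / Real.sin (Real.pi / (2 * m))

/-- The denominator `cos (π(2h-1)/4m) sin (πh/2m)`. -/
noncomputable def signedDenom (m : ℝ) (h : ℕ) : ℝ :=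
  Real.cos (Real.pi * (2 * h - 1) / (4 * m)) * Real.sin (Real.pi * h / (2 * m))

/-! Put T = 2m and θ = π/T. The integer points of the alcove, joined when they differ by a standard
step, form a finite connected graph, bipartite by the parity of the coordinate sum, and N_k is a row
sum of the k-th power of its adjacency matrix. The function v(x) = det(sin((2i+1)θ x_j)), i = 0, …,
n-1 (`oddSinDet`), satisfies the eigenvalue equation on all of ℤⁿ with g = Σ 2cos((2i+1)θ) =
sin(2nθ)/sin θ, vanishes where a step leaves the alcove, and is positive inside. So v is the Perron
eigenvector. With ε the parity sign and g > 0, only the multiples of v and εv are eigenvectors for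
eigenvalues of modulus g, whence N_k ~ g^k v(η) / Σv² · (Σv + (-1)^k ε(η) Σεv).

Three sums over the alcove remain. Since v is invariant under x_1 ↦ T - x_1, the alcove folds into
the strictly monotone tuples in [1, K₁] and in [1, K₂], with K₁ + K₂ + 1 = T and K₁ - K₂ ∈ {0, 1}.
By Cauchy–Binet, Σv² becomes a sum of two Gram determinants (`sum_oddSinDet_sq`).

The sum Σv becomes a sum of all maximal minors of a sine matrix. Such sums obey the row expansion of
a Pfaffian whose entries are the two-row sums (`minorSum_even`, `minorSum_odd`). Here, up to row
scaling, the entries are of Cauchy type, (u_i w_j - u_j w_i)(u'_i w'_j - u'_j w'_i)/(x_j - x_i), and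
the Pfaffian of such entries is a product of two alternants over a Vandermonde determinant.
Pfaffians are never defined: Lagrange interpolation gives the alternant side the same recursion
(`pairAlternant_mul_recursion`). At the angles (2i+1)θ/2 the alternants factor, which produces R and
Q (`sum_oddSinDet`).

Finally ε(x) v(x) is v with θ replaced by θ + π (`paritySign_mul_oddSinDet`), so Σεv is the same
evaluation at θ + π. There, sines of odd multiples of θ/2 become cosines, which explains the mixed
products in the signed terms. -/

/-! ### Sums of maximal minors and their Pfaffian-type row expansions -/

section MinorSummation

/-- The sign of `w - z`, as a real number. -/
noncomputable def ordSign (z w : ℤ) : ℝ := if z < w then 1 else if w < z then -1 else 0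

theorem ordSign_self (z : ℤ) : ordSign z z = 0 := by simp [ordSign]

theorem ordSign_of_lt {z w : ℤ} (h : z < w) : ordSign z w = 1 := by simp [ordSign, h]

theorem ordSign_of_gt {z w : ℤ} (h : w < z) : ordSign z w = -1 := by
  simp [ordSign, h, h.le]

open Finset

open Classical in
/-- The strictly increasing maps `Fin n → ℤ` with values in `s`. -/
noncomputable def monoTuples (n : ℕ) (s : Finset ℤ) : Finset (Fin n → ℤ) :=
  (Fintype.piFinset fun _ => s).filter StrictMono

theorem mem_monoTuples {n : ℕ} {s : Finset ℤ} {y : Fin n → ℤ} :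
    y ∈ monoTuples n s ↔ (∀ i, y i ∈ s) ∧ StrictMono y := by
  simp [monoTuples, Fintype.mem_piFinset]

/-- The sum of the maximal minors, with columns in `s`, of the matrix with rows `f i`. -/
noncomputable def minorSum {n : ℕ} (s : Finset ℤ) (f : Fin n → ℤ → ℝ) : ℝ :=
  ∑ y ∈ monoTuples n s, (Matrix.of fun i j => f i (y j)).det

theorem exists_insertion_index {m : ℕ} {Z : Fin m → ℤ} (hZ : StrictMono Z) (z : ℤ) :
    ∃ p : Fin (m + 1), ∀ q, Z q < z ↔ q.castSucc < p := by
  by_cases h : ∀ q, Z q < z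
  · exact ⟨Fin.last m, fun q => by simp [h q, Fin.castSucc_lt_last]⟩
  · push Not at h
    have hne : (univ.filter fun q => z ≤ Z q).Nonempty := by
      obtain ⟨q, hq⟩ := h
      exact ⟨q, by simpa using hq⟩
    refine ⟨((univ.filter fun q => z ≤ Z q).min' hne).castSucc, fun q => ?_⟩
    rw [Fin.castSucc_lt_castSucc_iff, Finset.lt_min'_iff]
    constructor
    · intro hq r hr
      simp only [mem_filter, mem_univ, true_and] at hr
      exact hZ.lt_iff_lt.1 (hq.trans_le hr)
    · intro hq
      by_contra hcon
      exact lt_irrefl _ (hq q (by simpa using hcon))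

theorem strictMono_insertNth_of_index {m : ℕ} {Z : Fin m → ℤ} (hZ : StrictMono Z) {z : ℤ}
    (hz : ∀ q, Z q ≠ z) {p : Fin (m + 1)} (hp : ∀ q, Z q < z ↔ q.castSucc < p) :
    StrictMono (p.insertNth (α := fun _ => ℤ) z Z) := by
  intro a b hab
  induction a using Fin.succAboveCases p with
  | x =>
    induction b using Fin.succAboveCases p with
    | x => exact absurd hab (lt_irrefl _)
    | p q =>
      rw [Fin.insertNth_apply_same, Fin.insertNth_apply_succAbove]
      rw [Fin.lt_succAbove_iff_le_castSucc] at hab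
      have := (hp q).not.2 (not_lt.2 hab)
      exact lt_of_le_of_ne (not_lt.1 this) (hz q).symm
  | p r =>
    induction b using Fin.succAboveCases p with
    | x =>
      rw [Fin.insertNth_apply_same, Fin.insertNth_apply_succAbove]
      rw [Fin.succAbove_lt_iff_castSucc_lt] at hab
      exact (hp r).2 hab
    | p q =>
      rw [Fin.insertNth_apply_succAbove, Fin.insertNth_apply_succAbove]
      exact hZ ((Fin.strictMono_succAbove p).lt_iff_lt.1 hab)

theorem prod_ordSign_succAbove {m : ℕ} {Y : Fin (m + 1) → ℤ} (hY : StrictMono Y)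
    (p : Fin (m + 1)) : ∏ q, ordSign (Y p) (Y (p.succAbove q)) = (-1) ^ (p : ℕ) := by
  have : ∀ q : Fin m, ordSign (Y p) (Y (p.succAbove q)) = if (q : ℕ) < p then -1 else 1 := by
    intro q
    split_ifs with h
    · exact ordSign_of_gt (hY ((Fin.succAbove_lt_iff_castSucc_lt p q).2 h))
    · exact ordSign_of_lt (hY ((Fin.lt_succAbove_iff_le_castSucc p q).2 (not_lt.1 h)))
  simp_rw [this]
  rw [Finset.prod_ite, Finset.prod_const_one, mul_one, Finset.prod_const]
  congr 1
  rw [Fin.card_filter_val_lt]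
  omega

/-- Taking the p-th entry out of Y is a bijection onto the pairs (z, Z) with z not in Z; its inverse
inserts z at its place. The sign (-1)^p counts the entries of Z below z, and the product of order
signs vanishes on the pairs that are not reached. -/
theorem sum_monoTuples_succ {m : ℕ} (s : Finset ℤ) (G : ℤ → (Fin m → ℤ) → ℝ) :
    ∑ Y ∈ monoTuples (m + 1) s, ∑ p : Fin (m + 1),
        (-1) ^ (p : ℕ) * G (Y p) (fun q => Y (p.succAbove q)) =
      ∑ z ∈ s, ∑ Z ∈ monoTuples m s, (∏ q, ordSign z (Z q)) * G z Z := by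
  rw [← Finset.sum_product', ← Finset.sum_product']
  refine Finset.sum_of_injOn (fun a => (a.1 a.2, fun q => a.1 (a.2.succAbove q))) ?_ ?_ ?_ ?_
  · rintro ⟨Y, p⟩ hY ⟨Y', p'⟩ hY' h
    simp only [coe_product, Set.mem_prod, mem_coe, mem_monoTuples, Prod.mk.injEq] at hY hY' h
    obtain ⟨h1, h2⟩ := h
    have hpp : p = p' := by
      have key : ∀ q : Fin m, q.castSucc < p ↔ q.castSucc < p' := by
        intro q
        rw [← Fin.succAbove_lt_iff_castSucc_lt, ← Fin.succAbove_lt_iff_castSucc_lt,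
          ← hY.1.2.lt_iff_lt, ← hY'.1.2.lt_iff_lt, h1, congrFun h2 q]
      rcases lt_trichotomy p p' with hlt | heq | hlt
      -- If p < p', the index p itself lies below p' but not below p, against `key`.
      · exact absurd ((key ⟨p, by omega⟩).2 hlt) (lt_irrefl (p : ℕ))
      · exact heq
      · exact absurd ((key ⟨p', by omega⟩).1 hlt) (lt_irrefl (p' : ℕ))
    subst hpp
    refine Prod.ext ?_ rfl
    funext j
    induction j using Fin.succAboveCases p with
    | x => exact h1
    | p q => exact congrFun h2 q
  · rintro ⟨Y, p⟩ hY
    simp only [coe_product, Set.mem_prod, mem_coe, mem_monoTuples] at hY ⊢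
    exact ⟨hY.1.1 _, fun i => hY.1.1 _, hY.1.2.comp (Fin.strictMono_succAbove p)⟩
  · rintro ⟨z, Z⟩ hz hnot
    simp only [mem_product, mem_monoTuples] at hz
    by_cases hzZ : ∃ q, Z q = z
    · obtain ⟨q, hq⟩ := hzZ
      rw [Finset.prod_eq_zero (mem_univ q) (by simp only [hq, ordSign_self]),
        zero_mul]
    · push Not at hzZ
      refine absurd ?_ hnot
      obtain ⟨p, hp⟩ := exists_insertion_index hz.2.2 z
      refine ⟨(p.insertNth (α := fun _ => ℤ) z Z, p), ?_, ?_⟩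
      · simp only [coe_product, Set.mem_prod, mem_coe, mem_monoTuples, mem_univ, and_true]
        refine ⟨fun i => ?_, strictMono_insertNth_of_index hz.2.2 hzZ hp⟩
        induction i using Fin.succAboveCases p with
        | x => simpa using hz.1
        | p q => simpa using hz.2.1 q
      · simp
  · rintro ⟨Y, p⟩ hY
    simp only [mem_product, mem_monoTuples] at hY
    rw [prod_ordSign_succAbove hY.1.2]

/-- For m odd this turns a product of order signs into an alternating sum of single ones, which is
what makes a second expansion possible in `minorSum_even`. It follows by induction, splitting off
the largest entry. -/
theorem sum_alternating_ordSign {m : ℕ} {Z : Fin m → ℤ} (hZ : StrictMono Z) (z : ℤ) :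
    ∑ p : Fin m, (-1) ^ (p : ℕ) * ordSign z (Z p) =
      ∏ p, ordSign z (Z p) - if Even m then 1 else 0 := by
  induction m with
  | zero => simp
  | succ m ih =>
    rw [Fin.sum_univ_castSucc, Fin.prod_univ_castSucc]
    have hm : StrictMono fun i : Fin m => Z i.castSucc := hZ.comp Fin.strictMono_castSucc
    have := ih hm
    simp only [Fin.val_castSucc, Fin.val_last]
    rw [this]
    rcases lt_or_ge z (Z (Fin.last m)) with h | h
    · rw [ordSign_of_lt h]
      rcases Nat.even_or_odd m with he | ho
      · simp [he, Nat.even_add_one, he.neg_one_pow]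
      · simp [Nat.not_even_iff_odd.2 ho, Nat.even_add_one, ho.neg_one_pow]
        ring
    · have hall : ∀ i : Fin m, ordSign z (Z i.castSucc) = -1 := fun i =>
        ordSign_of_gt ((hZ (Fin.castSucc_lt_last i)).trans_le h)
      simp_rw [hall, Finset.prod_const, Finset.card_univ, Fintype.card_fin]
      rcases h.lt_or_eq with h | h
      · rw [ordSign_of_gt h]
        rcases Nat.even_or_odd m with he | ho
        · simp [he, Nat.even_add_one, he.neg_one_pow]
        · simp [Nat.not_even_iff_odd.2 ho, Nat.even_add_one, ho.neg_one_pow]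
      · rw [h, ordSign_self]
        rcases Nat.even_or_odd m with he | ho
        · simp [he, Nat.even_add_one, he.neg_one_pow]
        · simp [Nat.not_even_iff_odd.2 ho, Nat.even_add_one, ho.neg_one_pow]

theorem sum_alternating_of_odd {m : ℕ} (hm : Odd m) :
    ∑ p : Fin m, (-1 : ℝ) ^ (p : ℕ) = 1 := by
  rw [Fin.sum_univ_eq_sum_range (fun p => (-1 : ℝ) ^ p), neg_one_geom_sum,
    if_neg (Nat.not_even_iff_odd.2 hm)]

/-- Summing a function of one column value against maximal minors: only the terms in which the
chosen column value does not repeat survive. -/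
theorem sum_monoTuples_mul_det {m : ℕ} (s : Finset ℤ) (φ : ℤ → ℝ) (f : Fin (m + 1) → ℤ → ℝ) :
    ∑ Y ∈ monoTuples (m + 1) s, (∑ p : Fin (m + 1), (-1) ^ (p : ℕ) * φ (Y p)) *
        (Matrix.of fun i j => f i (Y j)).det =
      ∑ k : Fin (m + 1), (-1) ^ (k : ℕ) * (∑ z ∈ s, φ z * f k z) *
        minorSum s (fun i => f (k.succAbove i)) := by
  -- Up to φ, this is the determinant with z put in front as an extra column, expanded along that
  -- column; hence it vanishes when z occurs in Z.
  set H : ℤ → (Fin m → ℤ) → ℝ := fun z Z =>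
    φ z * ∑ k : Fin (m + 1), (-1) ^ (k : ℕ) * f k z *
      (Matrix.of fun i j => f (k.succAbove i) (Z j)).det with hH
  have hHdet : ∀ z Z, H z Z =
      φ z * (Matrix.of fun i j => f i (Fin.cons (α := fun _ => ℤ) z Z j)).det := by
    intro z Z
    rw [hH, Matrix.det_succ_column_zero]
    rfl
  have hzero : ∀ z Z, (∃ q, Z q = z) → H z Z = 0 := by
    rintro z Z ⟨q, hq⟩
    rw [hHdet, Matrix.det_zero_of_column_eq (i := 0) (j := q.succ) (Fin.succ_ne_zero q).symm,
      mul_zero]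
    intro i
    simp [hq]
  have h1 : ∀ Y ∈ monoTuples (m + 1) s, (∑ p : Fin (m + 1), (-1) ^ (p : ℕ) * φ (Y p)) *
        (Matrix.of fun i j => f i (Y j)).det =
      ∑ p : Fin (m + 1), (-1) ^ (p : ℕ) *
        ((∏ q, ordSign (Y p) (Y (p.succAbove q))) * H (Y p) (fun q => Y (p.succAbove q))) := by
    intro Y hY
    rw [Finset.sum_mul]
    refine Finset.sum_congr rfl fun p _ => ?_
    rw [prod_ordSign_succAbove (mem_monoTuples.1 hY).2, Matrix.det_succ_column _ p, hH]
    simp only [Matrix.of_apply, mul_sum]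
    refine Finset.sum_congr rfl fun k _ => ?_
    rw [pow_add]
    have : (-1 : ℝ) ^ (p : ℕ) * (-1 : ℝ) ^ (p : ℕ) = 1 := by
      rw [← mul_pow]; simp
    have hsub : (Matrix.of fun i j => f i (Y j)).submatrix k.succAbove p.succAbove =
        Matrix.of fun i j => f (k.succAbove i) (Y (p.succAbove j)) := rfl
    rw [hsub]
    ring
  rw [Finset.sum_congr rfl h1,
    sum_monoTuples_succ s (fun z Z => (∏ q, ordSign z (Z q)) * H z Z)]
  -- One sign product comes from moving the column to the front, the other from removing an entry;
  -- they cancel when z is not in Z.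
  have h2 : ∀ z ∈ s, ∀ Z ∈ monoTuples m s,
      (∏ q, ordSign z (Z q)) * ((∏ q, ordSign z (Z q)) * H z Z) = H z Z := by
    intro z _ Z _
    by_cases h : ∃ q, Z q = z
    · rw [hzero z Z h]; simp
    · push Not at h
      rw [← mul_assoc, ← Finset.prod_mul_distrib, Finset.prod_eq_one, one_mul]
      intro q _
      rcases lt_or_gt_of_ne (h q) with hq | hq
      · rw [ordSign_of_gt hq]; norm_num
      · rw [ordSign_of_lt hq]; norm_num
  rw [Finset.sum_congr rfl fun z hz => Finset.sum_congr rfl (h2 z hz)]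
  simp only [hH, minorSum, mul_sum, sum_mul]
  rw [Finset.sum_congr rfl fun z _ => Finset.sum_comm, Finset.sum_comm]
  refine Finset.sum_congr rfl fun k _ => ?_
  rw [Finset.sum_comm]
  refine Finset.sum_congr rfl fun Z _ => Finset.sum_congr rfl fun z _ => ?_
  ring

/-- Expansion of the sum of maximal minors of a matrix with an odd number of rows. -/
theorem minorSum_odd {m : ℕ} (hm : Even m) (s : Finset ℤ) (f : Fin (m + 1) → ℤ → ℝ) :
    minorSum s f = ∑ k : Fin (m + 1), (-1) ^ (k : ℕ) * (∑ z ∈ s, f k z) *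
      minorSum s (fun i => f (k.succAbove i)) := by
  have := sum_monoTuples_mul_det s (fun _ => 1) f
  simp only [mul_one, one_mul, sum_alternating_of_odd hm.add_one] at this
  exact this

/-- The two-row sum of minors, as a skew-symmetric form. -/
noncomputable def minorForm (s : Finset ℤ) (f g : ℤ → ℝ) : ℝ :=
  ∑ z ∈ s, ∑ w ∈ s, ordSign z w * f z * g w

/-- Expansion of the sum of maximal minors of a matrix with an even number of rows. -/
theorem minorSum_even {m : ℕ} (hm : Even m) (s : Finset ℤ) (f : Fin (m + 2) → ℤ → ℝ) :
    minorSum s f = ∑ k : Fin (m + 1), (-1) ^ (k : ℕ) * minorForm s (f 0) (f k.succ) *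
      minorSum s (fun i => f (k.succAbove i).succ) := by
  have h1 : minorSum s f = ∑ Y ∈ monoTuples (m + 2) s, ∑ p : Fin (m + 2),
      (-1) ^ (p : ℕ) * (f 0 (Y p) *
        (Matrix.of fun (i j : Fin (m + 1)) => f i.succ (Y (p.succAbove j))).det) := by
    refine Finset.sum_congr rfl fun Y _ => ?_
    rw [Matrix.det_succ_row_zero]
    refine Finset.sum_congr rfl fun p _ => ?_
    rw [mul_assoc]
    rfl
  rw [h1, sum_monoTuples_succ s (fun z Z => f 0 z *
        (Matrix.of fun (i j : Fin (m + 1)) => f i.succ (Z j)).det)]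
  -- The tuples Z have odd length m + 1, so the product of order signs is an alternating sum, and
  -- `sum_monoTuples_mul_det` applies with `ordSign z` as weight.
  have h2 : ∀ z ∈ s, ∑ Z ∈ monoTuples (m + 1) s, (∏ q, ordSign z (Z q)) *
      (f 0 z * (Matrix.of fun (i j : Fin (m + 1)) => f i.succ (Z j)).det) =
      f 0 z * ∑ k : Fin (m + 1), (-1) ^ (k : ℕ) * (∑ w ∈ s, ordSign z w * f k.succ w) *
        minorSum s (fun i => f (k.succAbove i).succ) := by
    intro z _
    rw [← sum_monoTuples_mul_det s (ordSign z) (fun i => f i.succ), mul_sum]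
    refine Finset.sum_congr rfl fun Z hZ => ?_
    have := sum_alternating_ordSign (mem_monoTuples.1 hZ).2 z
    rw [if_neg (Nat.not_even_iff_odd.2 hm.add_one), sub_zero] at this
    rw [this]
    ring
  rw [Finset.sum_congr rfl h2]
  simp only [minorForm, mul_sum, sum_mul]
  rw [Finset.sum_comm]
  refine Finset.sum_congr rfl fun k _ => Finset.sum_congr rfl fun z _ =>
    Finset.sum_congr rfl fun w _ => ?_
  ring

end MinorSummation

/-! ### Alternants in pairs and a Cauchy-type Pfaffian evaluation -/

section PairAlternants

open Finset

theorem det_eq_of_unitriangular {n : ℕ} (A B : Matrix (Fin n) (Fin n) ℝ) (U : ℕ → ℕ → ℝ)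
    (hdiag : ∀ c, U c c = 1) (hlow : ∀ c c', c < c' → U c' c = 0)
    (h : ∀ i c, B i c = ∑ c' : Fin n, A i c' * U c' c) : B.det = A.det := by
  have hB : B = A * Matrix.of fun c' c : Fin n => U c' c := by
    ext i c
    rw [h, Matrix.mul_apply]
    rfl
  have hU : (Matrix.of fun c' c : Fin n => U c' c).det = 1 := by
    rw [Matrix.det_of_isUpperTriangular]
    · simp [hdiag]
    · intro i j hij
      exact hlow _ _ hij
  rw [hB, Matrix.det_mul, hU, mul_one]

/-- The sequence `u, w, x u, x w, x² u, x² w, …`. -/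
noncomputable def pairSeq (x u w : ℝ) (c : ℕ) : ℝ := x ^ (c / 2) * if Even c then u else w

theorem pairSeq_zero (x u w : ℝ) : pairSeq x u w 0 = u := by simp [pairSeq]

theorem pairSeq_one (x u w : ℝ) : pairSeq x u w 1 = w := by simp [pairSeq]

theorem pairSeq_add_two (x u w : ℝ) (c : ℕ) : pairSeq x u w (c + 2) = x * pairSeq x u w c := by
  have : (c + 2) / 2 = c / 2 + 1 := by omega
  simp only [pairSeq, this, pow_succ, Nat.even_add, even_two, iff_true]
  ring

/-- The alternant with rows `u i, w i, x i * u i, x i * w i, …`. -/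
noncomputable def pairAlternant {n : ℕ} (x u w : Fin n → ℝ) : ℝ :=
  (Matrix.of fun i c : Fin n => pairSeq (x i) (u i) (w i) c).det

/-- Subtracting t = x_0 times column c - 2 from each column c ≥ 2 leaves rows 0 and j + 1 supported
on the first two columns. Their 2 × 2 minor splits off, and each remaining row keeps a factor x_k -
t. These are the values needed at the interpolation nodes. -/
theorem pairAlternant_of_eq {n : ℕ} (x u w : Fin (n + 2) → ℝ) (j : Fin (n + 1))
    (h : x 0 = x j.succ) :
    pairAlternant x u w = (u 0 * w j.succ - u j.succ * w 0) * (-1) ^ (j : ℕ) *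
      (∏ k, (x (j.succAbove k).succ - x j.succ)) *
      pairAlternant (fun k => x (j.succAbove k).succ) (fun k => u (j.succAbove k).succ)
        (fun k => w (j.succAbove k).succ) := by
  set t := x j.succ with ht
  set M : Matrix (Fin (n + 2)) (Fin (n + 2)) ℝ := Matrix.of fun i c =>
    if (c : ℕ) < 2 then pairSeq (x i) (u i) (w i) c
    else (x i - t) * pairSeq (x i) (u i) (w i) (c - 2) with hM
  have hdet : pairAlternant x u w = M.det := by
    symm
    refine det_eq_of_unitriangular _ _
      (fun c' c => if c' = c then 1 else if c' + 2 = c then -t else 0) (by simp) ?_ ?_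
    · intro c c' hc
      rw [if_neg (by omega), if_neg (by omega)]
    · intro i c
      simp only [hM, Matrix.of_apply]
      have hsplit : ∀ c' : Fin (n + 2), pairSeq (x i) (u i) (w i) c' *
          (if (c' : ℕ) = c then 1 else if (c' : ℕ) + 2 = c then -t else 0) =
          (if c' = c then pairSeq (x i) (u i) (w i) c' else 0) +
          (if (c' : ℕ) + 2 = c then -t * pairSeq (x i) (u i) (w i) c' else 0) := by
        intro c'
        by_cases h1 : c' = c
        · subst h1; simp
        · have : (c' : ℕ) ≠ c := fun h => h1 (Fin.ext h)
          simp only [h1, this, if_false, zero_add]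
          split_ifs <;> ring
      rw [Finset.sum_congr rfl fun c' _ => hsplit c', Finset.sum_add_distrib,
        Finset.sum_ite_eq' univ c, if_pos (mem_univ c)]
      split_ifs with hc
      · rw [Finset.sum_eq_zero, add_zero]
        intro c' _
        rw [if_neg (by omega)]
      · rw [Finset.sum_eq_single ⟨(c : ℕ) - 2, by omega⟩]
        · have hc2 : (c : ℕ) - 2 + 2 = c := by omega
          simp only [hc2, if_true]
          conv_rhs => rw [← hc2, pairSeq_add_two]
          simp only [Nat.add_sub_cancel]
          ring
        · intro c' _ hne
          rw [if_neg]
          intro h'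
          exact hne (Fin.ext (by simp; omega))
        · simp
  have hrow : ∀ i, x i = t → ∀ c : Fin (n + 2), 2 ≤ (c : ℕ) → M i c = 0 := by
    intro i hi c hc
    simp only [hM, Matrix.of_apply, hi, sub_self, zero_mul]
    rw [if_neg (by omega)]
  have hblock : ∀ M' : Matrix (Fin n) (Fin n) ℝ,
      (∀ k c, M' k c = M (j.succAbove k).succ ⟨c + 2, by omega⟩) →
      M'.det = (∏ k, (x (j.succAbove k).succ - t)) *
      pairAlternant (fun k => x (j.succAbove k).succ) (fun k => u (j.succAbove k).succ)
        (fun k => w (j.succAbove k).succ) := by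
    intro M' hM'
    rw [pairAlternant, ← Matrix.det_mul_column]
    congr 1
    ext k c
    rw [hM']
    simp [hM]
  have hM00 : ∀ i, M i 0 = u i := fun i => by simp [hM, pairSeq_zero]
  have hM01 : ∀ i, M i 1 = w i := fun i => by simp [hM, pairSeq_one]
  -- The map e selects either column 0 or column 1, followed by all columns from 2 on: the two
  -- minors that survive the expansion along row 0.
  have hminor : ∀ e : Fin (n + 1) → Fin (n + 2), (∀ c : Fin n, (e c.succ : ℕ) = c + 2) →
      (M.submatrix Fin.succ e).det = (-1) ^ (j : ℕ) * M j.succ (e 0) *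
        ((∏ k, (x (j.succAbove k).succ - t)) *
      pairAlternant (fun k => x (j.succAbove k).succ) (fun k => u (j.succAbove k).succ)
        (fun k => w (j.succAbove k).succ)) := by
    intro e he
    rw [Matrix.det_succ_row _ j, Fin.sum_univ_succ, Finset.sum_eq_zero, add_zero]
    · rw [hblock]
      · simp
      · intro k c
        simp only [Matrix.submatrix_apply, Fin.succAbove_zero]
        congr 1
        exact Fin.ext (he c)
    · intro c _
      rw [Matrix.submatrix_apply, hrow _ ht.symm _ (by rw [he]; omega)]
      ring
  rw [hdet, Matrix.det_succ_row_zero, Fin.sum_univ_succ, Fin.sum_univ_succ, Finset.sum_eq_zero,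
    add_zero]
  · rw [hminor _ (by intro c; simp), hminor _ (by intro c; simp [Fin.succAbove])]
    have e1 : (Fin.succAbove (0 : Fin (n + 2)) 0) = 1 := by simp
    have e2 : (Fin.succAbove (Fin.succ 0 : Fin (n + 2)) 0) = 0 := by
      exact Fin.succ_succAbove_zero 0
    rw [e1, e2, hM00, hM00, hM01]
    have e3 : (Fin.succ 0 : Fin (n + 2)) = 1 := rfl
    rw [e3, hM01]
    simp only [Fin.val_zero, pow_zero, Fin.val_one, pow_one]
    ring
  · intro c _
    rw [hrow 0 h _ (by simp)]
    ring

theorem det_vandermonde_succ {n : ℕ} (x : Fin (n + 1) → ℝ) :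
    (Matrix.vandermonde x).det =
      (∏ j : Fin n, (x j.succ - x 0)) * (Matrix.vandermonde fun j : Fin n => x j.succ).det := by
  simp only [Matrix.det_vandermonde]
  rw [Fin.prod_univ_succ, Fin.prod_Ioi_zero]
  simp only [Fin.prod_Ioi_succ]

theorem det_vandermonde_succAbove {n : ℕ} (x : Fin (n + 1) → ℝ) (j : Fin (n + 1)) :
    (Matrix.vandermonde x).det = (-1) ^ (j : ℕ) * (∏ k, (x (j.succAbove k) - x j)) *
      (Matrix.vandermonde fun k => x (j.succAbove k)).det := by
  have h := Matrix.det_permute (j.cycleRange.symm) (Matrix.vandermonde x)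
  have h2 : (Matrix.vandermonde x).submatrix (j.cycleRange.symm) id =
      Matrix.vandermonde fun i => x (j.cycleRange.symm i) := rfl
  rw [h2, det_vandermonde_succ] at h
  simp only [Fin.cycleRange_symm_zero, Fin.cycleRange_symm_succ, Equiv.Perm.sign_symm,
    Fin.sign_cycleRange] at h
  rw [mul_assoc, h, ← mul_assoc]
  have : (-1 : ℝ) ^ (j : ℕ) * (((-1 : ℤˣ) ^ (j : ℕ) : ℤˣ) : ℤ) = 1 := by
    push_cast
    rw [← mul_pow]
    simp
  rw [this, one_mul]

open Polynomial in
/-- The alternant as a polynomial in the first entry of `x`. -/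
theorem exists_polynomial_pairAlternant {n : ℕ} (x u w : Fin (n + 1) → ℝ) :
    ∃ P : ℝ[X], P.natDegree ≤ n / 2 ∧
      ∀ t, P.eval t = pairAlternant (Fin.cons t fun j => x j.succ) u w := by
  refine ⟨∑ c : Fin (n + 1), C ((-1) ^ (c : ℕ) * (if Even (c : ℕ) then u 0 else w 0) *
    ((Matrix.of fun i c : Fin (n + 1) => pairSeq (x i) (u i) (w i) c).submatrix Fin.succ
      c.succAbove).det) * X ^ ((c : ℕ) / 2), ?_, ?_⟩
  · refine Polynomial.natDegree_sum_le_of_forall_le _ _ fun c _ => ?_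
    refine (Polynomial.natDegree_C_mul_X_pow_le _ _).trans ?_
    omega
  · intro t
    rw [pairAlternant, Matrix.det_succ_row_zero, Polynomial.eval_finsetSum]
    refine Finset.sum_congr rfl fun c _ => ?_
    simp only [eval_mul, eval_C, eval_pow, eval_X, Matrix.of_apply, Fin.cons_zero, pairSeq]
    have : ((Matrix.of fun i c : Fin (n + 1) =>
        ((Fin.cons t fun j => x j.succ : Fin (n + 1) → ℝ) i) ^ ((c : ℕ) / 2) *
          if Even (c : ℕ) then u i else w i).submatrix Fin.succ c.succAbove) =
        ((Matrix.of fun i c : Fin (n + 1) => (x i) ^ ((c : ℕ) / 2) *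
          if Even (c : ℕ) then u i else w i).submatrix Fin.succ c.succAbove) := by
      ext a b
      simp
    rw [this]
    ring

/-- With u and w held fixed, the product is a polynomial in x_0, of degree small enough to be
recovered from its values at the other n + 1 nodes. At such a node two entries of x coincide, so
`pairAlternant_of_eq` evaluates both factors. -/
theorem pairAlternant_mul_interpolation {n : ℕ} (hn : Even n) (x u w u' w' : Fin (n + 2) → ℝ)
    (hx : Function.Injective x) :
    pairAlternant x u w * pairAlternant x u' w' = ∑ j : Fin (n + 1),
      (pairAlternant (Fin.cons (x j.succ) fun i => x i.succ) u w *
        pairAlternant (Fin.cons (x j.succ) fun i => x i.succ) u' w') *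
      ∏ k : Fin n, (x (j.succAbove k).succ - x 0) / (x (j.succAbove k).succ - x j.succ) := by
  obtain ⟨P, hP, hPe⟩ := exists_polynomial_pairAlternant x u w
  obtain ⟨P', hP', hPe'⟩ := exists_polynomial_pairAlternant x u' w'
  have hinj : Set.InjOn (fun j : Fin (n + 1) => x j.succ) (univ : Finset (Fin (n + 1))) :=
    fun a _ b _ h => Fin.succ_injective _ (hx h)
  -- Evenness of n matters here: each factor has degree at most (n + 1) / 2 = n / 2, so the product
  -- has degree at most n.
  have hdeg : (P * P').degree < (univ : Finset (Fin (n + 1))).card := by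
    refine Polynomial.degree_le_natDegree.trans_lt ?_
    rw [Finset.card_univ, Fintype.card_fin]
    have := Polynomial.natDegree_mul_le (p := P) (q := P')
    obtain ⟨r, hr⟩ := hn
    have h3 : (P * P').natDegree < n + 1 := by omega
    exact_mod_cast h3
  have hcons : x = Fin.cons (x 0) fun i => x i.succ := by
    ext i; refine Fin.cases ?_ (fun i => ?_) i <;> simp
  have hL := congrArg (Polynomial.eval (x 0)) (Lagrange.eq_interpolate hinj hdeg)
  rw [Lagrange.interpolate_apply, Polynomial.eval_finsetSum] at hL
  simp only [Polynomial.eval_mul, Polynomial.eval_C, hPe, hPe', ← hcons] at hL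
  rw [hL]
  refine Finset.sum_congr rfl fun j _ => ?_
  congr 1
  rw [Lagrange.basis, Polynomial.eval_prod]
  have : (univ : Finset (Fin (n + 1))).erase j = univ.image j.succAbove := by
    ext a
    simp
  rw [this, Finset.prod_image fun a _ b _ h => Fin.succAbove_right_injective h]
  refine Finset.prod_congr rfl fun k _ => ?_
  have hne : x (j.succAbove k).succ ≠ x j.succ := fun h =>
    Fin.succAbove_ne j k (Fin.succ_injective _ (hx h))
  simp only [Lagrange.basisDivisor, Polynomial.eval_mul, Polynomial.eval_C, Polynomial.eval_sub,
    Polynomial.eval_X]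
  have h1 : x (j.succAbove k).succ - x j.succ ≠ 0 := sub_ne_zero.2 hne
  have h2 : x j.succ - x (j.succAbove k).succ ≠ 0 := sub_ne_zero.2 hne.symm
  field_simp
  ring

/-- The algebraic form of the expansion along the first row: products of two alternants satisfy
the same recursion as sums of maximal minors. -/
theorem pairAlternant_mul_recursion {n : ℕ} (hn : Even n) (x u w u' w' : Fin (n + 2) → ℝ)
    (hx : Function.Injective x) (q b : Fin (n + 1) → ℝ)
    (hq : ∀ j, q j * (x j.succ - x 0) =
      (u 0 * w j.succ - u j.succ * w 0) * (u' 0 * w' j.succ - u' j.succ * w' 0))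
    (hb : ∀ j, b j * (Matrix.vandermonde fun k => x (j.succAbove k).succ).det =
      pairAlternant (fun k => x (j.succAbove k).succ) (fun k => u (j.succAbove k).succ)
        (fun k => w (j.succAbove k).succ) *
      pairAlternant (fun k => x (j.succAbove k).succ) (fun k => u' (j.succAbove k).succ)
        (fun k => w' (j.succAbove k).succ)) :
    (∑ j : Fin (n + 1), (-1) ^ (j : ℕ) * q j * b j) * (Matrix.vandermonde x).det =
      pairAlternant x u w * pairAlternant x u' w' := by
  rw [pairAlternant_mul_interpolation hn x u w u' w' hx, Finset.sum_mul]
  refine Finset.sum_congr rfl fun j _ => ?_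
  rw [pairAlternant_of_eq _ u w j (by simp), pairAlternant_of_eq _ u' w' j (by simp)]
  simp only [Fin.cons_succ]
  rw [det_vandermonde_succ, det_vandermonde_succAbove (fun j : Fin (n + 1) => x j.succ) j,
    Fin.prod_univ_succAbove _ j, Finset.prod_div_distrib]
  have hP : ∏ k : Fin n, (x (j.succAbove k).succ - x j.succ) ≠ 0 := by
    refine Finset.prod_ne_zero_iff.2 fun k _ => sub_ne_zero.2 fun h => ?_
    exact Fin.succAbove_ne j k (Fin.succ_injective _ (hx h))
  have hs : (-1 : ℝ) ^ (j : ℕ) * (-1 : ℝ) ^ (j : ℕ) = 1 := by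
    rw [← mul_pow]; simp
  set P := ∏ k : Fin n, (x (j.succAbove k).succ - x j.succ)
  set A := ∏ k : Fin n, (x (j.succAbove k).succ - x 0)
  have h1 := hq j
  have h2 := hb j
  set s : ℝ := (-1) ^ (j : ℕ)
  set V := (Matrix.vandermonde fun k => x (j.succAbove k).succ).det
  calc s * q j * b j * ((x j.succ - x 0) * A * (s * P * V))
      = (s * s) * (q j * (x j.succ - x 0)) * (b j * V) * A * P := by ring
    _ = (s * s) * ((u 0 * w j.succ - u j.succ * w 0) * (u' 0 * w' j.succ - u' j.succ * w' 0)) *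
          (b j * V) * (P * P * (A / P)) := by
        rw [h1]; field_simp
    _ = _ := by
        rw [h2]; ring

/-- The sum of maximal minors of a family whose skew form is of Cauchy type, for an even number
of rows. -/
theorem minorSum_mul_vandermonde_of_even (s : Finset ℤ) : ∀ {n : ℕ}, Even n →
    ∀ (f : Fin n → ℤ → ℝ) (x u w u' w' : Fin n → ℝ), Function.Injective x →
    (∀ i j, minorForm s (f i) (f j) * (x j - x i) =
      (u i * w j - u j * w i) * (u' i * w' j - u' j * w' i)) →
    minorSum s f * (Matrix.vandermonde x).det = pairAlternant x u w * pairAlternant x u' w'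
  | 0, _, f, x, u, w, u', w', _, _ => by
    have : minorSum s f = 1 := by
      have h0 : monoTuples 0 s = univ := by
        ext y
        simp only [mem_monoTuples, mem_univ, iff_true]
        exact ⟨fun i => i.elim0, fun i => i.elim0⟩
      simp [minorSum, h0]
    simp [this, pairAlternant]
  | 1, h, _, _, _, _, _, _, _, _ => by simp at h
  | n + 2, hn, f, x, u, w, u', w', hx, hq => by
    have hn' : Even n := by simpa [Nat.even_add] using hn
    rw [minorSum_even hn']
    refine pairAlternant_mul_recursion hn' x u w u' w' hx _ _ (fun j => hq 0 j.succ) fun j => ?_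
    refine minorSum_mul_vandermonde_of_even s hn' _ _ _ _ _ _ ?_ fun i k => hq _ _
    exact hx.comp ((Fin.succ_injective _).comp Fin.succAbove_right_injective)

/-- The sum of maximal minors of a family whose skew form is of Cauchy type, for an odd number
of rows: the row sums play the role of the skew form with an additional row. -/
theorem minorSum_mul_vandermonde_of_odd (s : Finset ℤ) {n : ℕ} (hn : Even n)
    (f : Fin (n + 1) → ℤ → ℝ) (x u w u' w' : Fin (n + 2) → ℝ) (hx : Function.Injective x)
    (hg : ∀ j : Fin (n + 1), (∑ z ∈ s, f j z) * (x j.succ - x 0) =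
      (u 0 * w j.succ - u j.succ * w 0) * (u' 0 * w' j.succ - u' j.succ * w' 0))
    (hq : ∀ i j : Fin (n + 1), minorForm s (f i) (f j) * (x j.succ - x i.succ) =
      (u i.succ * w j.succ - u j.succ * w i.succ) *
        (u' i.succ * w' j.succ - u' j.succ * w' i.succ)) :
    minorSum s f * (Matrix.vandermonde x).det = pairAlternant x u w * pairAlternant x u' w' := by
  rw [minorSum_odd hn]
  refine pairAlternant_mul_recursion hn x u w u' w' hx _ _ hg fun j => ?_
  refine minorSum_mul_vandermonde_of_even s hn _ _ _ _ _ _ ?_ fun i k => hq _ _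
  exact hx.comp ((Fin.succ_injective _).comp Fin.succAbove_right_injective)

end PairAlternants

/-! ### Minor sums of sine matrices as products of two sine determinants -/

section TrigonometricMinorSums

open Finset Real

/-- The coefficients which express the sequence with `d (c + 4) = x * d (c + 2) - d c` through
`pairSeq`. -/
noncomputable def recCoeff : ℕ → ℕ → ℝ
  | 0, c' => if c' = 0 then 1 else 0
  | 1, c' => if c' = 1 then 1 else 0
  | 2, c' => if c' = 2 then 1 else if c' = 1 then -1 else 0
  | 3, c' => if c' = 3 then 1 else if c' = 0 then -1 else 0
  | c + 4, c' => (if 2 ≤ c' then recCoeff (c + 2) (c' - 2) else 0) - recCoeff c c'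

theorem recCoeff_of_lt : ∀ c c' : ℕ, c < c' → recCoeff c c' = 0
  | 0, c', h => by simp [recCoeff]; omega
  | 1, c', h => by simp [recCoeff]; omega
  | 2, c', h => by
    simp only [recCoeff]; rw [if_neg (by omega), if_neg (by omega)]
  | 3, c', h => by
    simp only [recCoeff]; rw [if_neg (by omega), if_neg (by omega)]
  | c + 4, c', h => by
    simp only [recCoeff]
    rw [if_pos (by omega), recCoeff_of_lt (c + 2) (c' - 2) (by omega),
      recCoeff_of_lt c c' (by omega), sub_zero]

theorem recCoeff_self : ∀ c : ℕ, recCoeff c c = 1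
  | 0 => by simp [recCoeff]
  | 1 => by simp [recCoeff]
  | 2 => by simp [recCoeff]
  | 3 => by simp [recCoeff]
  | c + 4 => by
    simp only [recCoeff]
    rw [if_pos (by omega), recCoeff_of_lt c (c + 4) (by omega), sub_zero]
    exact recCoeff_self (c + 2)

theorem sum_pairSeq_mul_recCoeff (x u w : ℝ) (d : ℕ → ℝ) (h0 : d 0 = u) (h1 : d 1 = w)
    (h2 : d 2 = x * u - w) (h3 : d 3 = x * w - u) (h4 : ∀ c, d (c + 4) = x * d (c + 2) - d c) :
    ∀ c K : ℕ, c < K → ∑ c' ∈ range K, pairSeq x u w c' * recCoeff c c' = d c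
  | 0, K, hK => by
    rw [Finset.sum_eq_single 0]
    · simp [recCoeff, pairSeq_zero, h0]
    · intro c' _ h; simp [recCoeff, h]
    · simp; omega
  | 1, K, hK => by
    rw [Finset.sum_eq_single 1]
    · simp [recCoeff, pairSeq_one, h1]
    · intro c' _ h; simp [recCoeff, h]
    · simp; omega
  | 2, K, hK => by
    obtain ⟨r, rfl⟩ : ∃ r, K = r + 3 := ⟨K - 3, by omega⟩
    rw [Finset.sum_range_succ', Finset.sum_range_succ', Finset.sum_range_succ',
      Finset.sum_eq_zero]
    · simp only [recCoeff, h2, show (0 + 1 + 1 : ℕ) = 0 + 2 from rfl, pairSeq_add_two, zero_add,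
        pairSeq_zero, pairSeq_one]
      norm_num
      ring
    · intro c' _
      simp [recCoeff]
  | 3, K, hK => by
    obtain ⟨r, rfl⟩ : ∃ r, K = r + 4 := ⟨K - 4, by omega⟩
    rw [Finset.sum_range_succ', Finset.sum_range_succ', Finset.sum_range_succ',
      Finset.sum_range_succ', Finset.sum_eq_zero]
    · simp only [recCoeff, h3, show (0 + 1 + 1 + 1 : ℕ) = 1 + 2 from rfl, pairSeq_add_two, zero_add,
        pairSeq_zero, pairSeq_one]
      norm_num
      ring
    · intro c' _
      simp [recCoeff]
  | c + 4, K, hK => by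
    have e1 := sum_pairSeq_mul_recCoeff x u w d h0 h1 h2 h3 h4 c K (by omega)
    obtain ⟨r, rfl⟩ : ∃ r, K = r + 2 := ⟨K - 2, by omega⟩
    have e2 := sum_pairSeq_mul_recCoeff x u w d h0 h1 h2 h3 h4 (c + 2) r (by omega)
    simp only [recCoeff, mul_sub, Finset.sum_sub_distrib]
    rw [e1, h4, ← e2, Finset.sum_range_succ', Finset.sum_range_succ']
    rw [Finset.mul_sum]
    have : ∀ k ∈ range r, pairSeq x u w (k + 1 + 1) *
        (if 2 ≤ k + 1 + 1 then recCoeff (c + 2) (k + 1 + 1 - 2) else 0) =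
        x * (pairSeq x u w k * recCoeff (c + 2) k) := by
      intro k _
      rw [if_pos (by omega), show k + 1 + 1 = k + 2 from rfl, pairSeq_add_two]
      simp only [Nat.add_sub_cancel]
      ring
    rw [Finset.sum_congr rfl this]
    simp

/-- The recursion expresses d through `pairSeq` by unitriangular coefficients that do not depend on
the row. With x = 2cos(2a) it is the recursion of sines in arithmetic progression, so alternants
become sine determinants. -/
theorem pairAlternant_eq_det {n : ℕ} (x u w : Fin n → ℝ) (d : Fin n → ℕ → ℝ)
    (h0 : ∀ i, d i 0 = u i) (h1 : ∀ i, d i 1 = w i) (h2 : ∀ i, d i 2 = x i * u i - w i)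
    (h3 : ∀ i, d i 3 = x i * w i - u i) (h4 : ∀ i c, d i (c + 4) = x i * d i (c + 2) - d i c) :
    pairAlternant x u w = (Matrix.of fun i c : Fin n => d i c).det := by
  symm
  refine det_eq_of_unitriangular _ _ (fun c' c => recCoeff c c') recCoeff_self
    (fun c c' h => recCoeff_of_lt c c' h) fun i c => ?_
  simp only [Matrix.of_apply]
  rw [Fin.sum_univ_eq_sum_range (fun c' => pairSeq (x i) (u i) (w i) c' * recCoeff c c') n]
  exact (sum_pairSeq_mul_recCoeff _ _ _ _ (h0 i) (h1 i) (h2 i) (h3 i) (h4 i) c n c.2).symm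

/-- The permutation of `0, …, n - 1` that starts in the middle and alternates between the upper
and the lower half. -/
noncomputable def interleave (n : ℕ) (hn : Even n) : Equiv.Perm (Fin n) :=
  Equiv.ofBijective
    (fun c => ⟨if Even (c : ℕ) then (n + c) / 2 else (n - 1 - c) / 2, by
      obtain ⟨r, rfl⟩ := hn
      have := c.2
      split_ifs with h
      · obtain ⟨q, hq⟩ := h; omega
      · omega⟩)
    (Finite.injective_iff_bijective.1 fun a b h => by
      obtain ⟨r, rfl⟩ := hn
      have ha := a.2
      have hb := b.2
      have h' := congrArg Fin.val h
      simp only at h'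
      rw [Fin.ext_iff]
      split_ifs at h' with h1 h2 h2
      · obtain ⟨q, hq⟩ := h1; obtain ⟨q', hq'⟩ := h2; omega
      · obtain ⟨q, hq⟩ := h1; obtain ⟨q', hq'⟩ := Nat.not_even_iff_odd.1 h2; omega
      · obtain ⟨q, hq⟩ := h2; obtain ⟨q', hq'⟩ := Nat.not_even_iff_odd.1 h1; omega
      · obtain ⟨q, hq⟩ := Nat.not_even_iff_odd.1 h1
        obtain ⟨q', hq'⟩ := Nat.not_even_iff_odd.1 h2
        omega)

theorem interleave_of_even {n : ℕ} (hn : Even n) (c : Fin n) (hc : Even (c : ℕ)) :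
    2 * (interleave n hn c : ℕ) = n + c := by
  simp only [interleave, Equiv.ofBijective_apply, hc, if_true]
  obtain ⟨r, hr⟩ := hn
  obtain ⟨q, hq⟩ := hc
  omega

theorem interleave_of_odd {n : ℕ} (hn : Even n) (c : Fin n) (hc : ¬ Even (c : ℕ)) :
    2 * (interleave n hn c : ℕ) + 1 + c = n := by
  simp only [interleave, Equiv.ofBijective_apply, hc, if_false]
  obtain ⟨r, hr⟩ := hn
  obtain ⟨q, hq⟩ := Nat.not_even_iff_odd.1 hc
  have := c.2
  omega

/-- The sequence `sin ((N + 2) a), sin (N a), sin ((N + 4) a), sin ((N - 2) a), …`. -/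
noncomputable def interleavedSin (N a : ℝ) (c : ℕ) : ℝ :=
  if Even c then sin ((N + 2 + c) * a) else sin ((N + 1 - c) * a)

theorem sin_add_two_eq (A a : ℝ) : sin (A + 2 * a) = 2 * cos (2 * a) * sin A - sin (A - 2 * a) := by
  rw [sin_add, sin_sub]; ring

theorem sin_sub_two_eq (A a : ℝ) : sin (A - 2 * a) = 2 * cos (2 * a) * sin A - sin (A + 2 * a) := by
  rw [sin_add, sin_sub]; ring

theorem interleavedSin_rec (N a : ℝ) (c : ℕ) : interleavedSin N a (c + 4) =
    2 * cos (2 * a) * interleavedSin N a (c + 2) - interleavedSin N a c := by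
  simp only [interleavedSin]
  by_cases hc : Even c
  · simp only [hc, Nat.even_add, even_two, (by decide : Even 4), if_true]
    push_cast
    rw [show (N + 2 + (c + 4)) * a = (N + 2 + (c + 2)) * a + 2 * a by ring, sin_add_two_eq]
    congr 2
    ring
  · simp only [hc, Nat.even_add, even_two, (by decide : Even 4), iff_true, if_false]
    push_cast
    rw [show (N + 1 - (c + 4)) * a = (N + 1 - (c + 2)) * a - 2 * a by ring, sin_sub_two_eq]
    congr 2
    ring

theorem interleavedSin_two (N a : ℝ) :
    interleavedSin N a 2 = 2 * cos (2 * a) * sin ((N + 2) * a) - sin (N * a) := by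
  simp only [interleavedSin, even_two, if_true]
  push_cast
  rw [show (N + 2 + 2) * a = (N + 2) * a + 2 * a by ring, sin_add_two_eq]
  congr 2
  ring

theorem interleavedSin_three (N a : ℝ) :
    interleavedSin N a 3 = 2 * cos (2 * a) * sin (N * a) - sin ((N + 2) * a) := by
  simp only [interleavedSin, (by decide : ¬ Even 3), if_false]
  push_cast
  rw [show (N + 1 - 3) * a = N * a - 2 * a by ring, sin_sub_two_eq]
  congr 2
  ring

/-- The determinant of the matrix with entries `sin ((M + 2 j) α i)`, `1 ≤ j ≤ n`. -/
noncomputable def sinAlternant {n : ℕ} (M : ℝ) (α : Fin n → ℝ) : ℝ :=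
  (Matrix.of fun i j : Fin n => sin ((M + 2 * ((j : ℕ) + 1)) * α i)).det

/-- The frequencies N + 2, N, N + 4, N - 2, … grow outwards from the middle of an arithmetic
progression with difference 2; `interleave` puts them into increasing order. -/
theorem pairAlternant_sin_of_even {n : ℕ} (hn : Even n) (N : ℝ) (α : Fin n → ℝ) :
    pairAlternant (fun i => 2 * cos (2 * α i)) (fun i => sin ((N + 2) * α i))
      (fun i => sin (N * α i)) =
    ((Equiv.Perm.sign (interleave n hn) : ℤ) : ℝ) * sinAlternant (N - n) α := by
  rw [pairAlternant_eq_det _ _ _ (fun i c => interleavedSin N (α i) c)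
    (fun i => by simp [interleavedSin]) (fun i => by simp [interleavedSin])
    (fun i => interleavedSin_two _ _) (fun i => interleavedSin_three _ _)
    (fun i c => interleavedSin_rec _ _ _), sinAlternant, ← Matrix.det_permute']
  congr 1
  ext i c
  simp only [Matrix.of_apply, Matrix.submatrix_apply, id, interleavedSin]
  split_ifs with hc
  · have := interleave_of_even hn c hc
    have h : (2 : ℝ) * (interleave n hn c : ℕ) = n + c := by exact_mod_cast this
    congr 1
    linear_combination (-α i) * h
  · have := interleave_of_odd hn c hc
    have h : (2 : ℝ) * (interleave n hn c : ℕ) + 1 + c = n := by exact_mod_cast this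
    congr 1
    linear_combination (-α i) * h

/-- The additional row has x = -2, the value of 2cos(2α) at α = π/2. Once the columns are in order,
this row alternates in sign, so adding neighbouring columns clears it except for one entry. In the
other rows sin(A + α) + sin(A - α) = 2 sin A cos α yields the factors 2cos α and moves the
frequencies by one. -/
theorem pairAlternant_sin_of_odd {m : ℕ} (hm : Even m) (hm2 : Even (m + 2)) (N : ℝ)
    (α : Fin (m + 1) → ℝ) :
    pairAlternant (n := m + 2) (Fin.cons (-2) fun i => 2 * cos (2 * α i))
      (Fin.cons 1 fun i => sin ((N + 2) * α i)) (Fin.cons (-1) fun i => sin (N * α i)) =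
    ((Equiv.Perm.sign (interleave (m + 2) hm2) : ℤ) : ℝ) * ((-1) ^ (m / 2 + 1) *
      ((∏ i, (2 * cos (α i))) * sinAlternant (N - (m + 1 : ℕ)) α)) := by
  rw [pairAlternant_eq_det _ _ _
    (fun i c => (Fin.cons ((-1) ^ ((c + 1) / 2)) fun k => interleavedSin N (α k) c :
      Fin (m + 2) → ℝ) i)]
  · set S : Matrix (Fin (m + 2)) (Fin (m + 2)) ℝ := Matrix.of fun i j =>
      (Fin.cons ((-1) ^ ((j : ℕ) + m / 2 + 1)) fun k =>
        sin ((N - (m + 2 : ℕ) + 2 * ((j : ℕ) + 1)) * α k) : Fin (m + 2) → ℝ) i with hS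
    have h1 : (Matrix.of fun i c : Fin (m + 2) => (Fin.cons ((-1) ^ (((c : ℕ) + 1) / 2))
        fun k => interleavedSin N (α k) c : Fin (m + 2) → ℝ) i) =
        S.submatrix id (interleave (m + 2) hm2) := by
      ext i c
      simp only [Matrix.of_apply, Matrix.submatrix_apply, id, hS]
      refine Fin.cases ?_ (fun k => ?_) i
      · simp only [Fin.cons_zero]
        rw [neg_one_pow_eq_pow_mod_two, neg_one_pow_eq_pow_mod_two (n := _ + _ + 1)]
        congr 1
        by_cases hc : Even (c : ℕ)
        · have := interleave_of_even hm2 c hc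
          obtain ⟨r, hr⟩ := hm
          obtain ⟨q, hq⟩ := hc
          omega
        · have := interleave_of_odd hm2 c hc
          obtain ⟨r, hr⟩ := hm
          obtain ⟨q, hq⟩ := Nat.not_even_iff_odd.1 hc
          omega
      · simp only [Fin.cons_succ, interleavedSin]
        split_ifs with hc
        · have := interleave_of_even hm2 c hc
          have h : (2 : ℝ) * (interleave (m + 2) hm2 c : ℕ) = (m + 2 : ℕ) + c := by
            exact_mod_cast this
          congr 1
          linear_combination (-α k) * h
        · have := interleave_of_odd hm2 c hc
          have h : (2 : ℝ) * (interleave (m + 2) hm2 c : ℕ) + 1 + c = (m + 2 : ℕ) := by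
            exact_mod_cast this
          congr 1
          linear_combination (-α k) * h
    rw [h1, Matrix.det_permute']
    congr 1
    set B : Matrix (Fin (m + 2)) (Fin (m + 2)) ℝ := Matrix.of fun i j =>
      Fin.cases (S i 0) (fun k => S i k.succ + S i k.castSucc) j with hB
    rw [Matrix.det_eq_of_forall_col_eq_smul_add_pred (B := B) (fun _ => -1)
      (fun i => by simp [hB]) (fun i j => by simp [hB]), Matrix.det_succ_row_zero,
      Fin.sum_univ_succ, Finset.sum_eq_zero, add_zero]
    · rw [sinAlternant, ← Matrix.det_mul_column]
      simp only [Fin.val_zero, pow_zero, one_mul]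
      have hB0 : B 0 0 = (-1) ^ (m / 2 + 1) := by simp [hB, hS]
      rw [hB0]
      congr 2
      ext i j
      simp only [hB, hS, Matrix.submatrix_apply, Matrix.of_apply, Fin.succAbove_zero,
        Fin.cases_succ, Fin.cons_succ, Fin.val_succ, Fin.val_castSucc]
      push_cast
      rw [show (N - (m + 2) + 2 * ((j : ℝ) + 1 + 1)) * α i =
          (N - (m + 1) + 2 * ((j : ℝ) + 1)) * α i + α i by ring,
        show (N - (m + 2) + 2 * ((j : ℝ) + 1)) * α i =
          (N - (m + 1) + 2 * ((j : ℝ) + 1)) * α i - α i by ring, sin_add, sin_sub]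
      ring
    · intro j _
      have : B 0 j.succ = 0 := by
        simp only [hB, hS, Matrix.of_apply, Fin.cases_succ, Fin.cons_zero, Fin.val_succ,
          Fin.val_castSucc]
        ring
      rw [this]
      ring
  · intro i; refine Fin.cases ?_ (fun k => ?_) i <;> simp [interleavedSin]
  · intro i; refine Fin.cases ?_ (fun k => ?_) i <;> simp [interleavedSin]
  · intro i; refine Fin.cases ?_ (fun k => ?_) i
    · norm_num
    · simp [interleavedSin_two]
  · intro i; refine Fin.cases ?_ (fun k => ?_) i
    · norm_num
    · simp [interleavedSin_three]
  · intro i c; refine Fin.cases ?_ (fun k => ?_) i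
    · simp only [Fin.cons_zero]
      rw [show (c + 4 + 1) / 2 = (c + 1) / 2 + 2 by omega,
        show (c + 2 + 1) / 2 = (c + 1) / 2 + 1 by omega]
      ring
    · simp [interleavedSin_rec]

theorem Icc_one_add_one (N : ℕ) :
    Finset.Icc (1 : ℤ) ((N + 1 : ℕ) : ℤ) = insert ((N : ℤ) + 1) (Finset.Icc (1 : ℤ) N) := by
  ext z
  simp only [Finset.mem_Icc, Finset.mem_insert]
  push_cast
  omega

theorem sum_sin_mul_sin (N : ℕ) (a : ℝ) :
    (∑ z ∈ Finset.Icc (1 : ℤ) N, sin (2 * a * z)) * sin a = sin (N * a) * sin ((N + 1) * a) := by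
  induction N with
  | zero => simp
  | succ N ih =>
    rw [Icc_one_add_one, Finset.sum_insert (by simp), add_mul, ih]
    push_cast
    have h1 : (2 * a * ((N : ℝ) + 1)) = (N + 1) * a + (N + 1) * a := by ring
    have h2 : ((N : ℝ) + 1 + 1) * a = (N + 1) * a + a := by ring
    have h3 : (N : ℝ) * a = (N + 1) * a - a := by ring
    rw [h1, h2, h3, sin_add, sin_add, sin_sub]
    ring

theorem minorForm_Icc_succ (N : ℕ) (f g : ℤ → ℝ) :
    minorForm (Finset.Icc (1 : ℤ) ((N + 1 : ℕ) : ℤ)) f g =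
      minorForm (Finset.Icc (1 : ℤ) N) f g +
        (∑ z ∈ Finset.Icc (1 : ℤ) N, f z) * g (N + 1) -
        f (N + 1) * ∑ z ∈ Finset.Icc (1 : ℤ) N, g z := by
  have hnot : ((N : ℤ) + 1) ∉ Finset.Icc (1 : ℤ) N := by simp
  rw [minorForm, Icc_one_add_one, Finset.sum_insert hnot]
  simp only [Finset.sum_insert hnot, ordSign_self, Finset.sum_add_distrib]
  have h1 : ∀ w ∈ Finset.Icc (1 : ℤ) N, ordSign (N + 1) w * f (N + 1) * g w =
      -(f (N + 1) * g w) := by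
    intro w hw
    rw [ordSign_of_gt (by have := (Finset.mem_Icc.1 hw).2; omega)]
    ring
  have h2 : ∀ z ∈ Finset.Icc (1 : ℤ) N, ordSign z (N + 1) * f z * g (N + 1) =
      f z * g (N + 1) := by
    intro z hz
    rw [ordSign_of_lt (by have := (Finset.mem_Icc.1 hz).2; omega)]
    ring
  rw [Finset.sum_congr rfl h1, Finset.sum_congr rfl h2, Finset.sum_neg_distrib, ← Finset.mul_sum,
    ← Finset.sum_mul, minorForm]
  ring

/-- Induction on N: the new point N + 1 contributes row sums, known from `sum_sin_mul_sin`, and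
addition formulas reduce the rest to a polynomial identity. The form is of Cauchy type, and its
second pair of sines is the first with N - 1 in place of N; hence the two determinants in
`minorSum_sin`. -/
theorem minorForm_sin (N : ℕ) (a b : ℝ) :
    minorForm (Finset.Icc (1 : ℤ) N) (fun z => sin (2 * a * z)) (fun z => sin (2 * b * z)) *
        (sin a * sin b) * (2 * cos (2 * b) - 2 * cos (2 * a)) =
      (sin ((N + 2) * a) * sin (N * b) - sin ((N + 2) * b) * sin (N * a)) *
        (sin ((N + 1) * a) * sin ((N - 1) * b) - sin ((N + 1) * b) * sin ((N - 1) * a)) := by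
  induction N with
  | zero => simp [minorForm]
  | succ N ih =>
    rw [minorForm_Icc_succ]
    have ga := sum_sin_mul_sin N a
    have gb := sum_sin_mul_sin N b
    have e : ∀ A B C : ℝ, (A + B - C) * (sin a * sin b) * (2 * cos (2 * b) - 2 * cos (2 * a)) =
      A * (sin a * sin b) * (2 * cos (2 * b) - 2 * cos (2 * a)) +
      (B * (sin a * sin b) - C * (sin a * sin b)) * (2 * cos (2 * b) - 2 * cos (2 * a)) := by
      intros; ring
    rw [e, ih]
    have e1 : (∑ z ∈ Finset.Icc (1 : ℤ) N, sin (2 * a * z)) * sin (2 * b * ((N : ℤ) + 1 : ℤ)) *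
        (sin a * sin b) = (sin (N * a) * sin ((N + 1) * a)) * sin b *
          sin (2 * b * ((N : ℝ) + 1)) := by
      rw [← ga]; push_cast; ring
    have e2 : sin (2 * a * ((N : ℤ) + 1 : ℤ)) * (∑ z ∈ Finset.Icc (1 : ℤ) N, sin (2 * b * z)) *
        (sin a * sin b) = (sin (N * b) * sin ((N + 1) * b)) * sin a *
          sin (2 * a * ((N : ℝ) + 1)) := by
      rw [← gb]; push_cast; ring
    rw [e1, e2]
    push_cast
    have k1 : ∀ t : ℝ, sin (((N : ℝ) + 2) * t) = sin (N * t) + 2 * cos ((N + 1) * t) * sin t := by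
      intro t
      rw [show ((N : ℝ) + 2) * t = (N + 1) * t + t by ring,
        show (N : ℝ) * t = (N + 1) * t - t by ring, sin_add, sin_sub]
      ring
    have k2 : ∀ t : ℝ, sin (((N : ℝ) + 1 + 2) * t) =
        2 * cos (2 * t) * sin ((N + 1) * t) - sin ((N - 1) * t) := by
      intro t
      rw [show ((N : ℝ) + 1 + 2) * t = (N + 1) * t + 2 * t by ring, sin_add_two_eq]
      congr 2
      ring
    have k3 : ∀ t : ℝ, sin (2 * t * ((N : ℝ) + 1)) =
        2 * sin ((N + 1) * t) * cos ((N + 1) * t) := by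
      intro t
      rw [← sin_two_mul]
      congr 1
      ring
    have k4 : ∀ t : ℝ, ((N : ℝ) + 1 + 1) * t = (N + 2) * t := fun t => by ring
    have k5 : ∀ t : ℝ, ((N : ℝ) + 1 - 1) * t = N * t := fun t => by ring
    rw [k4, k4, k5, k5, k2, k2, k1, k1, k3, k3]
    ring

theorem minorSum_smul {n : ℕ} (s : Finset ℤ) (c : Fin n → ℝ) (f : Fin n → ℤ → ℝ) :
    minorSum s (fun i z => c i * f i z) = (∏ i, c i) * minorSum s f := by
  rw [minorSum, minorSum, Finset.mul_sum]
  refine Finset.sum_congr rfl fun y _ => ?_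
  rw [← Matrix.det_mul_column]
  rfl

theorem minorForm_smul (s : Finset ℤ) (c c' : ℝ) (f g : ℤ → ℝ) :
    minorForm s (fun z => c * f z) (fun z => c' * g z) = minorForm s f g * (c * c') := by
  simp only [minorForm, Finset.sum_mul]
  refine Finset.sum_congr rfl fun z _ => Finset.sum_congr rfl fun w _ => ?_
  ring

/-- The sum of the maximal minors of the matrix `(sin (2 α i z))`, `1 ≤ z ≤ N`, is a product of two
determinants. -/
theorem minorSum_sin {n : ℕ} (N : ℕ) (α : Fin n → ℝ)
    (hα : Function.Injective fun i => cos (2 * α i)) (hcos : ∀ i, cos (α i) ≠ 0) :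
    minorSum (Finset.Icc (1 : ℤ) N) (fun i z => sin (2 * α i * z)) *
        ((∏ i, sin (α i)) * (Matrix.vandermonde fun i => 2 * cos (2 * α i)).det) =
      sinAlternant (N - n) α * sinAlternant (N - n - 1) α := by
  have hX : Function.Injective fun i => 2 * cos (2 * α i) := fun a b h =>
    hα (mul_left_cancel₀ two_ne_zero h)
  set f : Fin n → ℤ → ℝ := fun i z => sin (α i) * sin (2 * α i * z) with hf
  have hform : ∀ i j, minorForm (Finset.Icc (1 : ℤ) N) (f i) (f j) *
      (2 * cos (2 * α j) - 2 * cos (2 * α i)) =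
      (sin ((N + 2) * α i) * sin (N * α j) - sin ((N + 2) * α j) * sin (N * α i)) *
        (sin ((((N : ℝ) - 1) + 2) * α i) * sin (((N : ℝ) - 1) * α j) -
          sin ((((N : ℝ) - 1) + 2) * α j) * sin (((N : ℝ) - 1) * α i)) := by
    intro i j
    rw [hf, minorForm_smul, minorForm_sin, show (N : ℝ) - 1 + 2 = N + 1 by ring]
  have hsub : (N : ℝ) - n - 1 = N - 1 - n := by ring
  rw [← mul_assoc, mul_comm (minorSum _ _), ← minorSum_smul, hsub]
  have hsign : ∀ ε : ℤˣ, ((ε : ℤ) : ℝ) * ((ε : ℤ) : ℝ) = 1 := by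
    intro ε
    rcases Int.units_eq_one_or ε with h | h <;> simp [h]
  rcases Nat.even_or_odd n with hn | hn
  · rw [minorSum_mul_vandermonde_of_even _ hn f _ _ _ _ _ hX hform,
      pairAlternant_sin_of_even hn, pairAlternant_sin_of_even hn, mul_mul_mul_comm, hsign, one_mul]
  · obtain ⟨m, rfl⟩ : ∃ m, n = m + 1 := ⟨n - 1, by obtain ⟨r, hr⟩ := hn; omega⟩
    have hm : Even m := by simpa [Nat.odd_add_one] using hn
    have hm2 : Even (m + 2) := by simpa [Nat.even_add] using hm
    have hinj : Function.Injective
        (Fin.cons (-2) fun i => 2 * cos (2 * α i) : Fin (m + 2) → ℝ) := by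
      rw [Fin.cons_injective_iff]
      refine ⟨?_, hX⟩
      rintro ⟨i, hi⟩
      simp only [cos_two_mul] at hi
      exact hcos i (pow_eq_zero_iff two_ne_zero |>.1 (by linarith))
    -- With u = 1 and w = -1 in the extra row, its 2 × 2 minors are sin(Nα) + sin((N + 2)α) = 2
    -- sin((N + 1)α) cos α and the same with N - 1; their product matches the row sums.
    have key := minorSum_mul_vandermonde_of_odd (Finset.Icc (1 : ℤ) N) hm f
      (Fin.cons (-2) fun i => 2 * cos (2 * α i))
      (Fin.cons 1 fun i => sin ((N + 2) * α i)) (Fin.cons (-1) fun i => sin (N * α i))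
      (Fin.cons 1 fun i => sin ((((N : ℝ) - 1) + 2) * α i))
      (Fin.cons (-1) fun i => sin (((N : ℝ) - 1) * α i)) hinj ?_ ?_
    · rw [pairAlternant_sin_of_odd hm hm2, pairAlternant_sin_of_odd hm hm2, mul_mul_mul_comm, hsign,
        one_mul, mul_mul_mul_comm, ← mul_pow, neg_one_mul, neg_neg, one_pow, one_mul,
        det_vandermonde_succ] at key
      simp only [Fin.cons_succ, Fin.cons_zero] at key
      -- The node -2 contributes (2cos α)² to the Vandermonde determinant, cancelling the factor
      -- 2cos α that each of the two alternants carries.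
      have hprod : ∏ j, (2 * cos (2 * α j) - -2) = (∏ i, 2 * cos (α i)) * ∏ i, 2 * cos (α i) := by
        rw [← Finset.prod_mul_distrib]
        refine Finset.prod_congr rfl fun i _ => ?_
        rw [cos_two_mul]
        ring
      have hne : ∏ i, 2 * cos (α i) ≠ 0 :=
        Finset.prod_ne_zero_iff.2 fun i _ => mul_ne_zero two_ne_zero (hcos i)
      rw [hprod] at key
      refine mul_left_cancel₀ (mul_ne_zero hne hne) ?_
      linear_combination key
    · intro j
      simp only [Fin.cons_succ, Fin.cons_zero, hf, ← Finset.mul_sum]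
      have h := sum_sin_mul_sin N (α j)
      have k : ∀ A : ℝ, sin ((A + 2) * α j) + sin (A * α j) =
          2 * sin ((A + 1) * α j) * cos (α j) := by
        intro A
        rw [show (A + 2) * α j = (A + 1) * α j + α j by ring,
          show A * α j = (A + 1) * α j - α j by ring, sin_add, sin_sub]
        ring
      have k1 := k N
      have k2 := k ((N : ℝ) - 1)
      rw [sub_add_cancel] at k2
      rw [show ∀ p q : ℝ, 1 * p - q * -1 = q + p by intros; ring,
        show ∀ p q : ℝ, 1 * p - q * -1 = q + p by intros; ring, k1, k2, mul_comm (sin (α j)), h,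
        cos_two_mul]
      ring
    · intro i j
      simpa only [Fin.cons_succ] using hform i j

open Polynomial in
/-- The monic polynomials `p` with `sin ((2 k + 1) φ) = sin φ * p (2 cos (2 φ))`. -/
noncomputable def oddSinPoly : ℕ → ℝ[X]
  | 0 => 1
  | 1 => X + 1
  | k + 2 => X * oddSinPoly (k + 1) - oddSinPoly k

open Polynomial in
theorem oddSinPoly_monic_natDegree : ∀ k, (oddSinPoly k).Monic ∧ (oddSinPoly k).natDegree = k
  | 0 => by simp [oddSinPoly]
  | 1 => by
    have : (X + 1 : ℝ[X]) = X + C 1 := by simp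
    rw [oddSinPoly, this]
    exact ⟨monic_X_add_C 1, natDegree_X_add_C 1⟩
  | k + 2 => by
    obtain ⟨h1, h2⟩ := oddSinPoly_monic_natDegree (k + 1)
    obtain ⟨h3, h4⟩ := oddSinPoly_monic_natDegree k
    have hm : (X * oddSinPoly (k + 1)).Monic := monic_X.mul h1
    have hd : (X * oddSinPoly (k + 1)).natDegree = k + 2 := by
      rw [monic_X.natDegree_mul h1, natDegree_X, h2]; ring
    have hlt : (oddSinPoly k).degree < (X * oddSinPoly (k + 1)).degree := by
      apply degree_lt_degree; omega
    exact ⟨hm.sub_of_left hlt, by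
      rw [oddSinPoly, natDegree_sub_eq_left_of_natDegree_lt (by omega), hd]⟩

theorem sin_mul_oddSinPoly_eval (φ : ℝ) : ∀ k : ℕ,
    sin φ * (oddSinPoly k).eval (2 * cos (2 * φ)) = sin ((2 * (k : ℝ) + 1) * φ)
  | 0 => by simp [oddSinPoly]
  | 1 => by
    simp only [oddSinPoly, Polynomial.eval_add, Polynomial.eval_X, Polynomial.eval_one]
    push_cast
    rw [show (2 * 1 + 1) * φ = 3 * φ by ring, sin_three_mul, cos_two_mul]
    have := sin_sq_add_cos_sq φ
    linear_combination (4 * sin φ) * this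
  | k + 2 => by
    have h1 := sin_mul_oddSinPoly_eval φ (k + 1)
    have h2 := sin_mul_oddSinPoly_eval φ k
    simp only [oddSinPoly, Polynomial.eval_sub, Polynomial.eval_mul, Polynomial.eval_X]
    push_cast at h1 ⊢
    rw [mul_sub, h2, mul_left_comm, h1,
      show (2 * ((k : ℝ) + 2) + 1) * φ = (2 * (k + 1) + 1) * φ + 2 * φ by ring, sin_add_two_eq]
    congr 2
    ring

/-- The denominator formula: a factorization of `det (sin ((2 j + 1) φ i))`. -/
theorem det_odd_sin {n : ℕ} (φ : Fin n → ℝ) :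
    (Matrix.of fun i j : Fin n => sin ((2 * (j : ℕ) + 1) * φ i)).det =
      (∏ i, sin (φ i)) * (Matrix.vandermonde fun i => 2 * cos (2 * φ i)).det := by
  rw [Matrix.det_eval_matrixOfPolynomials_eq_det_vandermonde _ (fun j : Fin n => oddSinPoly j)
    (fun j => (oddSinPoly_monic_natDegree j).2) (fun j => (oddSinPoly_monic_natDegree j).1),
    ← Matrix.det_mul_column]
  congr 1
  ext i j
  simp only [Matrix.of_apply]
  rw [sin_mul_oddSinPoly_eval]

end TrigonometricMinorSums

/-! ### Evaluation at equally spaced odd angles -/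

section SpecializedMinorSums

open Finset Real

/-- The determinant of the matrix with entries `sin ((2 i + 1) θ (y j))`. -/
noncomputable def oddSinDet {n : ℕ} (θ : ℝ) (y : Fin n → ℤ) : ℝ :=
  (Matrix.of fun i j : Fin n => sin ((2 * (i : ℕ) + 1) * θ * y j)).det

theorem prod_prod_Ioi_eq_range (n : ℕ) (F : ℕ → ℕ → ℝ) :
    ∏ i : Fin n, ∏ j ∈ Ioi i, F i j = ∏ l ∈ range n, ∏ j ∈ range l, F j l := by
  have h1 : ∀ i : Fin n, ∏ j ∈ Ioi i, F i j =
      ∏ j : Fin n, if (i : ℕ) < j then F i j else 1 := by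
    intro i
    rw [← Finset.prod_filter]
    congr 1
    ext j
    simp
  rw [Finset.prod_congr rfl fun i _ => h1 i, Finset.prod_comm,
    Finset.prod_congr rfl fun (j : Fin n) _ => Fin.prod_univ_eq_prod_range
      (fun i => if i < (j : ℕ) then F i j else 1) n,
    Fin.prod_univ_eq_prod_range (fun l => ∏ i ∈ range n, if i < l then F i l else 1) n]
  refine Finset.prod_congr rfl fun l hl => ?_
  rw [← Finset.prod_filter]
  congr 1
  ext j
  simp only [mem_filter, mem_range] at hl ⊢
  omega

/-- Both triangles come from the alternants with consecutive shifts. When n grows, the new factors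
of the triangles are exactly the new last column and last row of the rectangle. -/
theorem prod_triangle_eq_rectangle (G : ℕ → ℝ) (n : ℕ) :
    ∏ l ∈ range n, ∏ j ∈ range l, (G (j + l + 2) * G (j + l + 1)) =
      ∏ a ∈ range (n - 1), ∏ b ∈ range n, G (a + b + 2) := by
  induction n with
  | zero => simp
  | succ n ih =>
    rw [Finset.prod_range_succ, ih]
    cases n with
    | zero => simp
    | succ n =>
      simp only [Nat.add_sub_cancel]
      rw [Finset.prod_congr rfl fun a _ => Finset.prod_range_succ (fun b => G (a + b + 2)) (n + 1),
        Finset.prod_mul_distrib, Finset.prod_mul_distrib,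
        Finset.prod_range_succ (fun a => ∏ b ∈ range (n + 1), G (a + b + 2))]
      have : ∀ j ∈ range (n + 1), G (j + (n + 1) + 1) = G (n + j + 2) := fun j _ => by
        congr 1; omega
      rw [Finset.prod_congr rfl this]
      ring

theorem prod_Icc_two_mul (g : ℕ → ℝ) (n : ℕ) :
    ∏ h ∈ Icc 1 (2 * n), g h = ∏ j ∈ range n, (g (2 * j + 2) * g (2 * j + 1)) := by
  induction n with
  | zero => simp
  | succ n ih =>
    rw [Finset.prod_range_succ, ← ih, show 2 * (n + 1) = 2 * n + 1 + 1 by ring,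
      Finset.prod_Icc_succ_top (by omega), Finset.prod_Icc_succ_top (by omega)]
    ring

theorem prod_Icc_rect (G : ℕ → ℝ) (n : ℕ) :
    ∏ h ∈ Icc 1 (n - 1), ∏ t ∈ Icc 1 n, G (n + t - h) =
      ∏ a ∈ range (n - 1), ∏ b ∈ range n, G (a + b + 2) := by
  rw [← Finset.prod_range_reflect]
  have h1 : Icc 1 (n - 1) = (range (n - 1)).image (· + 1) := by
    ext k; simp only [mem_Icc, mem_image, mem_range]
    exact ⟨fun h => ⟨k - 1, by omega, by omega⟩, by rintro ⟨a, h, rfl⟩; omega⟩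
  have h2 : Icc 1 n = (range n).image (· + 1) := by
    ext k; simp only [mem_Icc, mem_image, mem_range]
    exact ⟨fun h => ⟨k - 1, by omega, by omega⟩, by rintro ⟨a, h, rfl⟩; omega⟩
  rw [h1, h2, Finset.prod_image (by intro a _ b _ h; simpa using h)]
  refine Finset.prod_congr rfl fun a ha => ?_
  rw [Finset.prod_image (by intro a _ b _ h; simpa using h)]
  refine Finset.prod_congr rfl fun b _ => ?_
  rw [mem_range] at ha
  congr 1
  omega

/-- The quotient `∏_{h=1}^{2n} sin ((c - n + h) θ / 2) / sin (h θ / 2)`. -/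
noncomputable def rowQuot (n : ℕ) (θ c : ℝ) : ℝ :=
  ∏ h ∈ Icc 1 (2 * n), sin ((c - n + (h : ℕ)) * (θ / 2)) / sin ((h : ℕ) * (θ / 2))

/-- The quotient `∏_{h=1}^{n-1} ∏_{t=1}^{n} sin ((c + t - h) θ) / sin ((n + t - h) θ)`. -/
noncomputable def rectQuot (n : ℕ) (θ c : ℝ) : ℝ :=
  ∏ h ∈ Icc 1 (n - 1), ∏ t ∈ Icc 1 n,
    sin ((c + (t : ℕ) - (h : ℕ)) * θ) / sin (((n : ℝ) + (t : ℕ) - (h : ℕ)) * θ)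

/-- The angles `(2 i + 1) θ / 2`. -/
noncomputable def oddAngle (n : ℕ) (θ : ℝ) (i : Fin n) : ℝ := (2 * ((i : ℕ) : ℝ) + 1) * (θ / 2)

/-- At odd multiples of θ/2 the roles of angle and frequency can be exchanged: the transpose is a
matrix of odd-frequency sines at the angles (M + 2j + 2)θ/2, to which `det_odd_sin` applies. -/
theorem sinAlternant_oddAngle (n : ℕ) (M θ : ℝ) :
    sinAlternant M (oddAngle n θ) =
      (∏ l ∈ range n, sin ((M + (2 * l + 2 : ℕ)) * (θ / 2))) *
      ∏ l ∈ range n, ∏ j ∈ range l,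
        (-4 * sin (((l : ℝ) - j) * θ) * sin ((M + (j + l + 2 : ℕ)) * θ)) := by
  have h := det_odd_sin fun j : Fin n => (M + (2 * ((j : ℕ) : ℝ) + 2)) * (θ / 2)
  rw [← Matrix.det_transpose] at h
  have h1 : sinAlternant M (oddAngle n θ) = (Matrix.of fun i j : Fin n =>
      sin ((2 * (j : ℕ) + 1) * ((M + (2 * ((i : ℕ) : ℝ) + 2)) * (θ / 2)))).transpose.det := by
    rw [sinAlternant]
    congr 1
    ext i j
    simp only [Matrix.of_apply, Matrix.transpose_apply, oddAngle]
    congr 1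
    ring
  rw [h1, h, Matrix.det_vandermonde,
    Fin.prod_univ_eq_prod_range (fun l => sin ((M + (2 * (l : ℝ) + 2)) * (θ / 2))) n,
    prod_prod_Ioi_eq_range n fun i j => 2 * cos (2 * ((M + (2 * (j : ℝ) + 2)) * (θ / 2))) -
      2 * cos (2 * ((M + (2 * (i : ℝ) + 2)) * (θ / 2)))]
  congr 1
  · refine Finset.prod_congr rfl fun l _ => ?_
    push_cast
    rfl
  · refine Finset.prod_congr rfl fun l _ => Finset.prod_congr rfl fun j _ => ?_
    rw [← mul_sub, cos_sub_cos]
    push_cast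
    rw [show (2 * ((M + (2 * (l : ℝ) + 2)) * (θ / 2)) + 2 * ((M + (2 * (j : ℝ) + 2)) * (θ / 2))) / 2
        = (M + (j + l + 2)) * θ by ring,
      show (2 * ((M + (2 * (l : ℝ) + 2)) * (θ / 2)) - 2 * ((M + (2 * (j : ℝ) + 2)) * (θ / 2))) / 2
        = (l - j) * θ by ring]
    ring

theorem sinAlternant_mul_sinAlternant (n : ℕ) (c θ : ℝ) :
    sinAlternant (c - n) (oddAngle n θ) * sinAlternant (c - n - 1) (oddAngle n θ) =
      (∏ l ∈ range n, ∏ j ∈ range l, (-4 * sin (((l : ℝ) - j) * θ)) ^ 2) *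
      ((∏ h ∈ Icc 1 (2 * n), sin ((c - n + (h : ℕ)) * (θ / 2))) *
        ∏ h ∈ Icc 1 (n - 1), ∏ t ∈ Icc 1 n, sin ((c + (t : ℕ) - (h : ℕ)) * θ)) := by
  have h1 : ∏ h ∈ Icc 1 (n - 1), ∏ t ∈ Icc 1 n, sin ((c + (t : ℕ) - (h : ℕ)) * θ) =
      ∏ h ∈ Icc 1 (n - 1), ∏ t ∈ Icc 1 n, sin ((c - n + (n + t - h : ℕ)) * θ) := by
    refine Finset.prod_congr rfl fun h hh => Finset.prod_congr rfl fun t ht => ?_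
    rw [mem_Icc] at hh
    rw [Nat.cast_sub (by omega)]
    push_cast
    congr 1
    ring
  rw [h1, prod_Icc_rect fun s => sin ((c - n + (s : ℕ)) * θ),
    ← prod_triangle_eq_rectangle fun s => sin ((c - n + (s : ℕ)) * θ),
    prod_Icc_two_mul fun h => sin ((c - n + (h : ℕ)) * (θ / 2)), sinAlternant_oddAngle,
    sinAlternant_oddAngle, mul_mul_mul_comm]
  have e1 : ∀ l : ℕ, c - n - 1 + ((2 * l + 2 : ℕ) : ℝ) = c - n + ((2 * l + 1 : ℕ) : ℝ) := by
    intro l; push_cast; ring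
  have e2 : ∀ j l : ℕ, c - n - 1 + ((j + l + 2 : ℕ) : ℝ) = c - n + ((j + l + 1 : ℕ) : ℝ) := by
    intro j l; push_cast; ring
  simp only [e1, e2, Finset.prod_mul_distrib, Finset.prod_pow]
  ring

theorem oddSinDet_eq_sinAlternant (n : ℕ) (θ : ℝ) :
    oddSinDet θ (fun j : Fin n => ((j : ℕ) : ℤ) + 1) = sinAlternant 0 (oddAngle n θ) := by
  rw [oddSinDet, sinAlternant]
  congr 1
  ext i j
  simp only [Matrix.of_apply, oddAngle]
  push_cast
  congr 1
  ring

/-- The evaluation of the sum of the determinants `oddSinDet` over all strictly increasing tuples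
between `1` and `N`. -/
theorem sum_oddSinDet (n N : ℕ) (θ : ℝ)
    (h1 : ∀ h : ℕ, 1 ≤ h → h ≤ 2 * n → sin (h * (θ / 2)) ≠ 0)
    (h2 : ∀ h : ℕ, 1 ≤ h → h + 1 ≤ 2 * n → sin (h * θ) ≠ 0) :
    ∑ y ∈ monoTuples n (Icc (1 : ℤ) N), oddSinDet θ y =
      oddSinDet θ (fun j : Fin n => ((j : ℕ) : ℤ) + 1) * (rowQuot n θ N * rectQuot n θ N) := by
  have hsum : ∑ y ∈ monoTuples n (Icc (1 : ℤ) N), oddSinDet θ y =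
      minorSum (Icc (1 : ℤ) N) fun i z => sin (2 * oddAngle n θ i * z) := by
    refine Finset.sum_congr rfl fun y _ => ?_
    rw [oddSinDet]
    congr 1
    ext i j
    simp only [Matrix.of_apply, oddAngle]
    congr 1
    ring
  have hinj : Function.Injective fun i => cos (2 * oddAngle n θ i) := by
    have key : ∀ i k : Fin n, (i : ℕ) < k →
        cos (2 * oddAngle n θ i) ≠ cos (2 * oddAngle n θ k) := by
      intro i k hik heq
      have hk := k.2
      have := sub_eq_zero.2 heq
      rw [cos_sub_cos] at this
      have e1 : (2 * oddAngle n θ i + 2 * oddAngle n θ k) / 2 = ((i + k + 1 : ℕ) : ℝ) * θ := by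
        simp only [oddAngle]; push_cast; ring
      have e2 : (2 * oddAngle n θ i - 2 * oddAngle n θ k) / 2 = -(((k - i : ℕ) : ℝ) * θ) := by
        rw [Nat.cast_sub hik.le]; simp only [oddAngle]; ring
      rw [e1, e2, sin_neg] at this
      have n1 := h2 (i + k + 1) (by omega) (by omega)
      have n2 := h2 (k - i) (by omega) (by omega)
      exact mul_ne_zero (mul_ne_zero (by norm_num) n1) (neg_ne_zero.2 n2) this
    intro i k heq
    rcases lt_trichotomy (i : ℕ) k with h | h | h
    · exact absurd heq (key i k h)
    · exact Fin.ext h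
    · exact absurd heq.symm (key k i h)
  have hcos : ∀ i, cos (oddAngle n θ i) ≠ 0 := by
    intro i h
    have hi := i.2
    refine h2 (2 * i + 1) (by omega) (by omega) ?_
    have : ((2 * (i : ℕ) + 1 : ℕ) : ℝ) * θ = 2 * oddAngle n θ i := by
      simp only [oddAngle]; push_cast; ring
    rw [this, sin_two_mul, h, mul_zero]
  have hF := minorSum_sin N (oddAngle n θ) hinj hcos
  rw [← hsum, sinAlternant_mul_sinAlternant] at hF
  -- The denominator in `minorSum_sin` is itself an alternant, the second one for N = n.
  have hD : (∏ i, sin (oddAngle n θ i)) *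
      (Matrix.vandermonde fun i => 2 * cos (2 * oddAngle n θ i)).det =
      sinAlternant (-1) (oddAngle n θ) := by
    rw [← det_odd_sin, sinAlternant]
    congr 1
    ext i j
    simp only [Matrix.of_apply]
    congr 1
    ring
  have hD0 : sinAlternant (-1) (oddAngle n θ) ≠ 0 := by
    rw [← hD]
    refine mul_ne_zero (Finset.prod_ne_zero_iff.2 fun i _ => ?_) ?_
    · have hi := i.2
      have := h1 (2 * i + 1) (by omega) (by omega)
      push_cast at this
      exact this
    · rw [Matrix.det_vandermonde_ne_zero_iff]
      exact fun a b h => hinj (mul_left_cancel₀ two_ne_zero h)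
  -- The case c = n has the same prefactor as c = N and contains the determinant at (1, …, n);
  -- dividing by it leaves the two quotients.
  have h0 := sinAlternant_mul_sinAlternant n n θ
  rw [sub_self, zero_sub, ← oddSinDet_eq_sinAlternant] at h0
  rw [hD] at hF
  have hR : ∏ h ∈ Icc 1 (2 * n), sin ((0 + (h : ℕ)) * (θ / 2)) ≠ 0 := by
    refine Finset.prod_ne_zero_iff.2 fun h hh => ?_
    rw [mem_Icc] at hh
    rw [zero_add]
    exact h1 h hh.1 hh.2
  have hQ : ∏ h ∈ Icc 1 (n - 1), ∏ t ∈ Icc 1 n, sin (((n : ℝ) + (t : ℕ) - (h : ℕ)) * θ) ≠ 0 := by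
    refine Finset.prod_ne_zero_iff.2 fun h hh => Finset.prod_ne_zero_iff.2 fun t ht => ?_
    rw [mem_Icc] at hh ht
    have := h2 (n + t - h) (by omega) (by omega)
    rw [Nat.cast_sub (by omega)] at this
    push_cast at this
    exact this
  refine mul_right_cancel₀ hD0 ?_
  rw [hF, mul_right_comm, h0]
  have aux : ∀ K A B A₀ B₀ : ℝ, A₀ ≠ 0 → B₀ ≠ 0 →
      K * (A * B) = K * (A₀ * B₀) * (A / A₀ * (B / B₀)) := by
    intros; field_simp
  simp only [rowQuot, rectQuot, Finset.prod_div_distrib, zero_add] at hR ⊢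
  exact aux _ _ _ _ _ hR hQ

end SpecializedMinorSums

/-! ### Perron–Frobenius asymptotics for connected bipartite graphs -/

section PerronAsymptotics

open Finset Filter Asymptotics Matrix

variable {Ω : Type*} [Fintype Ω]

/-- The absolute value of an eigenvalue of a nonnegative matrix with a positive eigenvector is at
most the corresponding eigenvalue. -/
theorem abs_eigenvalue_le_of_pos_eigenvector (A : Matrix Ω Ω ℝ) (hA : ∀ x y, 0 ≤ A x y)
    (v : Ω → ℝ) (hv : ∀ x, 0 < v x) (g : ℝ) (hg : ∀ x, ∑ y, A x y * v y = g * v x)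
    (u : Ω → ℝ) (l : ℝ) (hu : ∀ x, ∑ y, A x y * u y = l * u x) (hu0 : u ≠ 0) : |l| ≤ g := by
  obtain ⟨z, hz⟩ := Function.ne_iff.1 hu0
  -- The eigenvalue equation is compared at a point where |u|/v is largest.
  obtain ⟨x, -, hx⟩ := Finset.exists_max_image univ (fun x => |u x| / v x) ⟨z, mem_univ z⟩
  have hpos : 0 < |u x| := by
    have h1 := hx z (mem_univ z)
    have h2 : 0 < |u z| / v z := div_pos (abs_pos.2 hz) (hv z)
    have h3 := h2.trans_le h1
    by_contra hcon
    rw [le_antisymm (not_lt.1 hcon) (abs_nonneg _), zero_div] at h3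
    exact lt_irrefl _ h3
  refine le_of_mul_le_mul_right ?_ hpos
  rw [← abs_mul, ← hu x]
  calc |∑ y, A x y * u y| ≤ ∑ y, |A x y * u y| := Finset.abs_sum_le_sum_abs _ _
    _ ≤ ∑ y, |u x| / v x * (A x y * v y) := by
        refine Finset.sum_le_sum fun y _ => ?_
        rw [abs_mul, abs_of_nonneg (hA x y), mul_left_comm]
        refine mul_le_mul_of_nonneg_left ?_ (hA x y)
        exact (div_le_iff₀ (hv y)).1 (hx y (mem_univ y))
    _ = g * |u x| := by
        rw [← Finset.mul_sum, hg]
        field_simp [(hv x).ne']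

/-- Uniqueness of the Perron eigenvector of an irreducible matrix. -/
theorem eq_smul_of_pos_eigenvector (A : Matrix Ω Ω ℝ) (hA : ∀ x y, 0 ≤ A x y)
    (hconn : ∀ x y, Relation.ReflTransGen (fun a b => A a b ≠ 0) x y)
    (v : Ω → ℝ) (hv : ∀ x, 0 < v x) (g : ℝ) (hg : ∀ x, ∑ y, A x y * v y = g * v x)
    (u : Ω → ℝ) (hu : ∀ x, ∑ y, A x y * u y = g * u x) : ∃ c : ℝ, ∀ x, u x = c * v x := by
  rcases isEmpty_or_nonempty Ω with hE | ⟨⟨z⟩⟩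
  · exact ⟨0, fun x => hE.elim x⟩
  obtain ⟨x, -, hx⟩ := Finset.exists_max_image univ (fun x => u x / v x) ⟨z, mem_univ z⟩
  set c := u x / v x with hc
  have hle : ∀ y, u y ≤ c * v y := fun y => (div_le_iff₀ (hv y)).1 (hx y (mem_univ y))
  refine ⟨c, fun y => ?_⟩
  -- Maximum principle: c·v - u is nonnegative and vanishes at x; the eigenvalue equation carries
  -- each zero to all neighbours, hence along paths.
  induction hconn x y with
  | refl => rw [hc]; field_simp [(hv x).ne']
  | @tail a b _ hab ih =>
    have hsum : ∑ y, A a y * (c * v y - u y) = 0 := by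
      simp only [mul_sub, Finset.sum_sub_distrib, hu, mul_left_comm (A a _) c, ← Finset.mul_sum, hg]
      rw [ih]
      ring
    have := (Finset.sum_eq_zero_iff_of_nonneg fun y _ =>
      mul_nonneg (hA a y) (sub_nonneg.2 (hle y))).1 hsum b (mem_univ b)
    have h2 := (mul_eq_zero.1 this).resolve_left hab
    linarith

/-- The expansion of the powers of a real symmetric matrix in an eigenbasis. -/
theorem exists_eigen_expansion [DecidableEq Ω] (A : Matrix Ω Ω ℝ) (hA : A.IsHermitian) :
    ∃ (l : Ω → ℝ) (b : Ω → Ω → ℝ), (∀ j, b j ≠ 0) ∧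
      (∀ j x, ∑ y, A x y * b j y = l j * b j x) ∧
      ∀ (w : Ω → ℝ) (k : ℕ) (x : Ω),
        ((A ^ k) *ᵥ w) x = ∑ j, l j ^ k * ((∑ y, b j y * w y) * b j x) := by
  refine ⟨hA.eigenvalues, fun j => ⇑(hA.eigenvectorBasis j), fun j hj => ?_, fun j x => ?_, ?_⟩
  · have h1 := hA.eigenvectorBasis.orthonormal.ne_zero j
    exact h1 (by ext x; exact congrFun hj x)
  · exact congrFun (hA.mulVec_eigenvectorBasis j) x
  · intro w k x
    have hexp : w = ∑ j, (∑ y, hA.eigenvectorBasis j y * w y) • ⇑(hA.eigenvectorBasis j) := by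
      have h := hA.eigenvectorBasis.sum_repr' (WithLp.toLp 2 w)
      funext z
      have hz := congrArg (fun q : EuclideanSpace ℝ Ω => q z) h
      simp only [PiLp.inner_apply, WithLp.ofLp_sum, WithLp.ofLp_smul, Finset.sum_apply,
        Pi.smul_apply] at hz ⊢
      rw [← hz]
      refine Finset.sum_congr rfl fun j _ => ?_
      congr 1
      refine Finset.sum_congr rfl fun y _ => ?_
      simp [mul_comm]
    have hpow : ∀ j, (A ^ k) *ᵥ ⇑(hA.eigenvectorBasis j) =
        hA.eigenvalues j ^ k • ⇑(hA.eigenvectorBasis j) := by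
      intro j
      induction k with
      | zero => simp
      | succ k ih =>
        rw [pow_succ, ← Matrix.mulVec_mulVec, hA.mulVec_eigenvectorBasis, Matrix.mulVec_smul, ih,
          smul_smul, mul_comm, pow_succ]
    conv_lhs => rw [hexp]
    rw [Matrix.mulVec_sum, Finset.sum_apply]
    refine Finset.sum_congr rfl fun j _ => ?_
    rw [Matrix.mulVec_smul, hpow]
    simp only [Pi.smul_apply, smul_eq_mul]
    ring

/-- The asymptotics of the row sums of the powers of the adjacency matrix of a connected bipartite
graph. -/
theorem isLittleO_pow_mulVec_one [DecidableEq Ω] (A : Matrix Ω Ω ℝ) (hA : ∀ x y, 0 ≤ A x y)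
    (hsymm : ∀ x y, A x y = A y x)
    (hconn : ∀ x y, Relation.ReflTransGen (fun a b => A a b ≠ 0) x y)
    (ε : Ω → ℝ) (hε : ∀ x, ε x * ε x = 1) (hbip : ∀ x y, A x y ≠ 0 → ε y = -ε x)
    (v : Ω → ℝ) (hv : ∀ x, 0 < v x) (g : ℝ) (hg0 : 0 < g)
    (hg : ∀ x, ∑ y, A x y * v y = g * v x) (x : Ω) :
    (fun k : ℕ => ((A ^ k) *ᵥ (1 : Ω → ℝ)) x - g ^ k * (v x / (∑ y, v y ^ 2) *
      (∑ y, v y + (-1) ^ k * ε x * ∑ y, ε y * v y))) =o[atTop] fun k : ℕ => g ^ k := by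
  have hA' : A.IsHermitian := by
    ext i j
    simp [hsymm i j]
  obtain ⟨l, b, hb0, hb, hexp⟩ := exists_eigen_expansion A hA'
  -- Multiplication by ε exchanges the eigenvalues t and -t. In particular εv has eigenvalue -g ≠ g,
  -- so it is orthogonal to v.
  have hsign : ∀ (u : Ω → ℝ) (t : ℝ), (∀ x, ∑ y, A x y * u y = t * u x) →
      ∀ x, ∑ y, A x y * (ε y * u y) = -t * (ε x * u x) := by
    intro u t hu x
    have : ∀ y, A x y * (ε y * u y) = -ε x * (A x y * u y) := by
      intro y
      by_cases h : A x y = 0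
      · rw [h]; ring
      · rw [hbip x y h]; ring
    rw [Finset.sum_congr rfl fun y _ => this y, ← Finset.mul_sum, hu]
    ring
  have horth : ∑ y, v y * (ε y * v y) = 0 := by
    have h1 : ∑ x, (∑ y, A x y * v y) * (ε x * v x) = g * ∑ y, v y * (ε y * v y) := by
      rw [Finset.mul_sum]
      refine Finset.sum_congr rfl fun y _ => ?_
      rw [hg]; ring
    have h2 : ∑ x, (∑ y, A x y * v y) * (ε x * v x) = -g * ∑ y, v y * (ε y * v y) := by
      simp only [Finset.sum_mul]
      rw [Finset.sum_comm, Finset.mul_sum]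
      refine Finset.sum_congr rfl fun y _ => ?_
      have := hsign v g hg y
      calc ∑ x, A x y * v y * (ε x * v x) = v y * ∑ x, A y x * (ε x * v x) := by
            rw [Finset.mul_sum]
            refine Finset.sum_congr rfl fun x _ => ?_
            rw [hsymm y x]; ring
        _ = _ := by rw [this]; ring
    have h3 := h1.symm.trans h2
    have h4 : g * ∑ y, v y * (ε y * v y) = 0 := by linarith
    exact (mul_eq_zero.1 h4).resolve_left hg0.ne'
  set S := ∑ y, v y ^ 2 with hS
  have hS0 : S ≠ 0 := by
    refine (Finset.sum_pos (fun y _ => pow_pos (hv y) 2) ⟨x, mem_univ x⟩).ne'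
  set p := (∑ y, v y) / S with hp
  set q := (∑ y, ε y * v y) / S with hq
  -- The constant 1 minus its orthogonal projection to the span of v and εv; only this remainder has
  -- to be shown negligible.
  set w : Ω → ℝ := fun y => 1 - p * v y - q * (ε y * v y) with hw
  have hw1 : ∑ y, v y * w y = 0 := by
    have : ∀ y, v y * w y = v y - p * v y ^ 2 - q * (v y * (ε y * v y)) := fun y => by
      rw [hw]; ring
    rw [Finset.sum_congr rfl fun y _ => this y, Finset.sum_sub_distrib, Finset.sum_sub_distrib,
      ← Finset.mul_sum, ← Finset.mul_sum, horth, ← hS, hp]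
    field_simp
    ring
  have hw2 : ∑ y, ε y * v y * w y = 0 := by
    have : ∀ y, ε y * v y * w y = ε y * v y - p * (v y * (ε y * v y)) - q * v y ^ 2 := fun y => by
      rw [hw]
      linear_combination (-q * v y ^ 2) * hε y
    rw [Finset.sum_congr rfl fun y _ => this y, Finset.sum_sub_distrib, Finset.sum_sub_distrib,
      ← Finset.mul_sum, ← Finset.mul_sum, horth, ← hS, hq]
    field_simp
    ring
  have hpow : ∀ (u : Ω → ℝ) (t : ℝ), (∀ x, ∑ y, A x y * u y = t * u x) → ∀ k : ℕ,
      (A ^ k) *ᵥ u = t ^ k • u := by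
    intro u t hu k
    induction k with
    | zero => simp
    | succ k ih =>
      have : A *ᵥ u = t • u := funext fun x => hu x
      rw [pow_succ, ← Matrix.mulVec_mulVec, this, Matrix.mulVec_smul, ih, smul_smul, mul_comm,
        pow_succ]
  have hmain : ∀ k : ℕ, ((A ^ k) *ᵥ (1 : Ω → ℝ)) x - g ^ k * (v x / S *
      (∑ y, v y + (-1) ^ k * ε x * ∑ y, ε y * v y)) = ((A ^ k) *ᵥ w) x := by
    intro k
    have hone : (1 : Ω → ℝ) = p • v + q • (fun y => ε y * v y) + w := by
      funext y
      simp only [Pi.one_apply, Pi.add_apply, Pi.smul_apply, smul_eq_mul, hw]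
      ring
    rw [hone, Matrix.mulVec_add, Matrix.mulVec_add, Matrix.mulVec_smul, Matrix.mulVec_smul,
      hpow v g hg, hpow _ (-g) (hsign v g hg)]
    simp only [Pi.add_apply, Pi.smul_apply, smul_eq_mul, neg_pow g, hp, hq]
    ring
  simp_rw [hmain, hexp w]
  refine IsLittleO.fun_sum fun j _ => ?_
  have hle := abs_eigenvalue_le_of_pos_eigenvector A hA v hv g hg (b j) (l j) (hb j) (hb0 j)
  rcases hle.lt_or_eq with hlt | heq
  · have h1 : (fun k : ℕ => l j ^ k) =o[atTop] fun k : ℕ => g ^ k :=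
      isLittleO_pow_pow_of_abs_lt_left (by rwa [abs_of_pos hg0])
    have h2 := h1.const_mul_left ((∑ y, b j y * w y) * b j x)
    refine h2.congr_left fun k => ?_
    ring
  -- An eigenvector for g is a multiple of v, one for -g a multiple of εv; both are orthogonal to w.
  · have hzero : ∑ y, b j y * w y = 0 := by
      rcases (abs_eq hg0.le).1 heq with h | h
      · obtain ⟨c, hc⟩ := eq_smul_of_pos_eigenvector A hA hconn v hv g hg (b j)
          (by rw [← h]; exact hb j)
        simp only [hc, mul_assoc, ← Finset.mul_sum, hw1, mul_zero]
      · obtain ⟨c, hc⟩ := eq_smul_of_pos_eigenvector A hA hconn v hv g hg (fun y => ε y * b j y)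
          (by have := hsign (b j) (l j) (hb j); rwa [h, neg_neg] at this)
        have hbj : ∀ y, b j y * w y = c * (ε y * v y * w y) := by
          intro y
          linear_combination (ε y * w y) * hc y - (b j y * w y) * hε y
        simp only [hbj, ← Finset.mul_sum, hw2, mul_zero]
    simp only [hzero, zero_mul, mul_zero]
    exact isLittleO_zero _ _

end PerronAsymptotics

/-! ### The walk graph and its Perron eigenvector -/

section AlcoveWalks

open Finset Real Matrix

/-- The integer points of the alcove of type `B̃_n` with `2 m = T`. -/
noncomputable def latticeAlcove (n : ℕ) (T : ℤ) : Finset (Fin n → ℤ) :=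
  open Classical in
  (Fintype.piFinset fun _ => Icc 1 T).filter fun x => (∀ i j : Fin n, i < j → x j < x i) ∧
    ∀ i j : Fin n, (i : ℕ) = 0 → (j : ℕ) = 1 → x i + x j < T

/-- The box [1, T] only ensures finiteness: x_1 < T - x_2 < T bounds every coordinate, which is
where n ≥ 2 enters. -/
theorem mem_latticeAlcove {n : ℕ} (hn : 2 ≤ n) {T : ℤ} {x : Fin n → ℤ} :
    x ∈ latticeAlcove n T ↔ (∀ i j : Fin n, i < j → x j < x i) ∧ (∀ i : Fin n, 0 < x i) ∧
      ∀ i j : Fin n, (i : ℕ) = 0 → (j : ℕ) = 1 → x i + x j < T := by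
  simp only [latticeAlcove, mem_filter, Fintype.mem_piFinset, mem_Icc]
  constructor
  · rintro ⟨h1, h2, h3⟩
    exact ⟨h2, fun i => by have := (h1 i).1; omega, h3⟩
  · rintro ⟨h1, h2, h3⟩
    refine ⟨fun i => ⟨by have := h2 i; omega, ?_⟩, h1, h3⟩
    have h01 := h3 ⟨0, by omega⟩ ⟨1, by omega⟩ rfl rfl
    have hpos := h2 ⟨1, by omega⟩
    rcases Nat.eq_zero_or_pos (i : ℕ) with h | h
    · have : i = ⟨0, by omega⟩ := Fin.ext h
      rw [this]; omega
    · have := h1 ⟨0, by omega⟩ i h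
      omega

theorem add_lt_of_mem_latticeAlcove {n : ℕ} (hn : 2 ≤ n) {T : ℤ} {x : Fin n → ℤ}
    (hx : x ∈ latticeAlcove n T) {i j : Fin n} (hij : i < j) : x i + x j < T := by
  obtain ⟨h1, h2, h3⟩ := (mem_latticeAlcove hn).1 hx
  have h01 := h3 ⟨0, by omega⟩ ⟨1, by omega⟩ rfl rfl
  have anti : ∀ a b : Fin n, a ≤ b → x b ≤ x a := fun a b hab => by
    rcases hab.lt_or_eq with h | h
    · exact (h1 a b h).le
    · rw [h]
  have e1 := anti ⟨0, by omega⟩ i (Nat.zero_le _)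
  have e2 := anti ⟨1, by omega⟩ j (by have : (i : ℕ) < j := hij; show 1 ≤ (j : ℕ); omega)
  omega

theorem lt_of_mem_latticeAlcove {n : ℕ} (hn : 2 ≤ n) {T : ℤ} {x : Fin n → ℤ}
    (hx : x ∈ latticeAlcove n T) (i : Fin n) : x i < T := by
  have h2 := ((mem_latticeAlcove hn).1 hx).2.1
  obtain ⟨j, hj⟩ : ∃ j : Fin n, j ≠ i := by
    rcases Nat.eq_zero_or_pos (i : ℕ) with h | h
    · exact ⟨⟨1, by omega⟩, fun h' => by rw [← h'] at h; simp at h⟩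
    · exact ⟨⟨0, by omega⟩, fun h' => by rw [← h'] at h; simp at h⟩
  have hp := h2 j
  rcases lt_or_gt_of_ne hj with h | h
  · have := add_lt_of_mem_latticeAlcove hn hx h; omega
  · have := add_lt_of_mem_latticeAlcove hn hx h; omega

theorem mem_alcoveB_iff {n : ℕ} (hn : 2 ≤ n) {T : ℤ} {m : ℝ} (hT : 2 * m = T) {x : Fin n → ℤ} :
    (fun j => (x j : ℝ)) ∈ alcoveB n m ↔ x ∈ latticeAlcove n T := by
  rw [mem_latticeAlcove hn, alcoveB, Set.mem_ofPred_eq, hT]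
  beta_reduce
  norm_cast

theorem walkPosition_zero {n k : ℕ} (η : Fin n → ℤ) (s : Fin k → Fin n × ℤˣ) :
    walkPosition η s 0 = η := by
  simp [walkPosition]

theorem walkPosition_cons_succ {n k : ℕ} (η : Fin n → ℤ) (a : Fin n × ℤˣ)
    (s : Fin k → Fin n × ℤˣ) (i : ℕ) :
    walkPosition η (Fin.cons (α := fun _ => Fin n × ℤˣ) a s) (i + 1) =
      walkPosition (η + standardStep a) s i := by
  simp only [walkPosition, Finset.sum_filter, Fin.sum_univ_succ, Fin.val_zero, Fin.val_succ,
    Nat.add_lt_add_iff_right, if_true, Fin.cons_zero, Fin.cons_succ, Nat.zero_lt_succ]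
  rw [add_assoc]

open Classical in
theorem numWalksB_eq_sum (n : ℕ) (m : ℝ) (η : Fin n → ℤ) (k : ℕ) :
    (numWalksB n m η k : ℝ) = ∑ s : Fin k → Fin n × ℤˣ,
      if ∀ i ≤ k, (fun j => (walkPosition η s i j : ℝ)) ∈ alcoveB n m then 1 else 0 := by
  rw [numWalksB, Nat.card_eq_fintype_card, Fintype.card_subtype, Finset.sum_boole]

open Classical in
theorem numWalksB_zero {n : ℕ} {m : ℝ} {η : Fin n → ℤ}
    (hη : (fun j => (η j : ℝ)) ∈ alcoveB n m) : (numWalksB n m η 0 : ℝ) = 1 := by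
  rw [numWalksB_eq_sum]
  simp [walkPosition_zero, hη]

open Classical in
theorem numWalksB_succ {n : ℕ} {m : ℝ} {η : Fin n → ℤ}
    (hη : (fun j => (η j : ℝ)) ∈ alcoveB n m) (k : ℕ) :
    (numWalksB n m η (k + 1) : ℝ) = ∑ a : Fin n × ℤˣ, (numWalksB n m (η + standardStep a) k : ℝ) := by
  simp only [numWalksB_eq_sum]
  rw [← Fintype.sum_prod_type']
  symm
  refine Fintype.sum_equiv (Fin.consEquiv fun _ : Fin (k + 1) => Fin n × ℤˣ) _ _ ?_
  rintro ⟨a, s⟩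
  refine if_congr ?_ rfl rfl
  constructor
  · intro h i hi
    cases i with
    | zero => simpa [walkPosition_zero] using hη
    | succ i =>
      have := h i (by omega)
      rw [← walkPosition_cons_succ] at this
      exact this
  · intro h i hi
    have := h (i + 1) (by omega)
    rw [Fin.consEquiv] at this
    simp only [Equiv.coe_fn_mk] at this
    rw [walkPosition_cons_succ] at this
    exact this

open Classical in
theorem numWalksB_of_notMem {n : ℕ} {m : ℝ} {η : Fin n → ℤ}
    (hη : (fun j => (η j : ℝ)) ∉ alcoveB n m) (k : ℕ) : (numWalksB n m η k : ℝ) = 0 := by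
  rw [numWalksB_eq_sum]
  refine Finset.sum_eq_zero fun s _ => if_neg fun h => hη ?_
  have := h 0 (Nat.zero_le k)
  rwa [walkPosition_zero] at this

/-- The adjacency matrix of the integer points of the alcove. -/
noncomputable def stepMatrix (n : ℕ) (T : ℤ) : Matrix (latticeAlcove n T) (latticeAlcove n T) ℝ :=
  Matrix.of fun x y => ∑ s : Fin n × ℤˣ, if x.1 + standardStep s = y.1 then 1 else 0

theorem stepMatrix_nonneg (n : ℕ) (T : ℤ) (x y : latticeAlcove n T) : 0 ≤ stepMatrix n T x y :=
  Finset.sum_nonneg fun s _ => by split_ifs <;> norm_num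

theorem exists_step_of_stepMatrix_ne_zero {n : ℕ} {T : ℤ} {x y : latticeAlcove n T}
    (h : stepMatrix n T x y ≠ 0) : ∃ s, x.1 + standardStep s = y.1 := by
  obtain ⟨s, -, hs⟩ := Finset.exists_ne_zero_of_sum_ne_zero h
  exact ⟨s, by by_contra hcon; exact hs (if_neg hcon)⟩

theorem stepMatrix_ne_zero_of_step {n : ℕ} {T : ℤ} {x y : latticeAlcove n T} (s : Fin n × ℤˣ)
    (h : x.1 + standardStep s = y.1) : stepMatrix n T x y ≠ 0 := by
  refine (Finset.sum_pos' (fun s _ => by split_ifs <;> norm_num) ⟨s, mem_univ s, ?_⟩).ne'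
  rw [if_pos h]
  exact one_pos

theorem standardStep_neg {n : ℕ} (s : Fin n × ℤˣ) :
    standardStep (s.1, -s.2) = -standardStep s := by
  simp [standardStep, Pi.single_neg]

theorem stepMatrix_symm (n : ℕ) (T : ℤ) (x y : latticeAlcove n T) :
    stepMatrix n T x y = stepMatrix n T y x := by
  refine Fintype.sum_equiv (Equiv.prodCongr (Equiv.refl _) (Equiv.neg ℤˣ)) _ _ fun s => ?_
  refine if_congr ?_ rfl rfl
  change _ ↔ y.1 + standardStep (s.1, -s.2) = x.1
  rw [standardStep_neg]
  constructor
  · intro h; rw [← h]; abel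
  · intro h; rw [← h]; abel

/-- Applying the adjacency matrix to a function that vanishes at the boundary. -/
theorem sum_stepMatrix_mul {n : ℕ} {T : ℤ} (x : latticeAlcove n T) (f : (Fin n → ℤ) → ℝ)
    (hf : ∀ s, x.1 + standardStep s ∉ latticeAlcove n T → f (x.1 + standardStep s) = 0) :
    ∑ y : latticeAlcove n T, stepMatrix n T x y * f y.1 =
      ∑ s, f (x.1 + standardStep s) := by
  simp only [stepMatrix, Matrix.of_apply, Finset.sum_mul]
  rw [Finset.sum_comm]
  refine Finset.sum_congr rfl fun s _ => ?_
  by_cases h : x.1 + standardStep s ∈ latticeAlcove n T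
  · rw [Finset.sum_eq_single ⟨_, h⟩]
    · simp
    · intro y _ hy
      rw [if_neg, zero_mul]
      exact fun h' => hy (Subtype.ext h'.symm)
    · simp
  · rw [hf s h, Finset.sum_eq_zero]
    intro y _
    rw [if_neg, zero_mul]
    exact fun h' => h (h' ▸ y.2)

theorem numWalksB_eq_pow {n : ℕ} (hn : 2 ≤ n) {T : ℤ} {m : ℝ} (hT : 2 * m = T) (k : ℕ)
    (x : latticeAlcove n T) :
    (numWalksB n m x.1 k : ℝ) = ((stepMatrix n T ^ k) *ᵥ (1 : latticeAlcove n T → ℝ)) x := by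
  induction k generalizing x with
  | zero =>
    rw [numWalksB_zero ((mem_alcoveB_iff hn hT).2 x.2)]
    simp
  | succ k ih =>
    rw [numWalksB_succ ((mem_alcoveB_iff hn hT).2 x.2), pow_succ', ← Matrix.mulVec_mulVec,
      Matrix.mulVec, dotProduct]
    simp only [← ih]
    rw [sum_stepMatrix_mul x fun y => (numWalksB n m y k : ℝ)]
    intro s hs
    exact numWalksB_of_notMem (fun h => hs ((mem_alcoveB_iff hn hT).1 h)) k

/-- The smallest integer point `(n, n - 1, …, 1)`. -/
def alcoveBase (n : ℕ) (i : Fin n) : ℤ := (n : ℤ) - (i : ℕ)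

theorem le_of_mem_latticeAlcove {n : ℕ} (hn : 2 ≤ n) {T : ℤ} {x : Fin n → ℤ}
    (hx : x ∈ latticeAlcove n T) (i : Fin n) : alcoveBase n i ≤ x i := by
  obtain ⟨h1, h2, -⟩ := (mem_latticeAlcove hn).1 hx
  have key : ∀ d : ℕ, ∀ i : Fin n, (i : ℕ) + d + 1 = n → (d : ℤ) + 1 ≤ x i := by
    intro d
    induction d with
    | zero => intro i _; have := h2 i; push_cast; omega
    | succ d ih =>
      intro i hi
      have e1 := ih ⟨i + 1, by omega⟩ (by simp only; omega)
      have e2 := h1 i ⟨i + 1, by omega⟩ (Nat.lt_succ_self _)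
      push_cast
      omega
  have hi := i.2
  have := key (n - 1 - i) i (by omega)
  simp only [alcoveBase]
  omega

/-- Every point dominates (n, …, 1) coordinatewise. Lowering the last coordinate that exceeds its
base value stays in the alcove and decreases d by one. -/
theorem reflTransGen_alcoveBase {n : ℕ} (hn : 2 ≤ n) {T : ℤ} :
    ∀ (d : ℕ) (x : latticeAlcove n T), ∑ i, (x.1 i - alcoveBase n i) = d →
      ∃ y : latticeAlcove n T, y.1 = alcoveBase n ∧
        Relation.ReflTransGen (fun a b => stepMatrix n T a b ≠ 0) x y := by
  intro d
  induction d with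
  | zero =>
    intro x hx
    refine ⟨x, ?_, Relation.ReflTransGen.refl⟩
    have := (Finset.sum_eq_zero_iff_of_nonneg fun i _ =>
      sub_nonneg.2 (le_of_mem_latticeAlcove hn x.2 i)).1 (by simpa using hx)
    funext i
    exact sub_eq_zero.1 (this i (mem_univ i))
  | succ d ih =>
    intro x hx
    have hge := le_of_mem_latticeAlcove hn x.2
    have hne : (univ.filter fun i => alcoveBase n i < x.1 i).Nonempty := by
      by_contra hcon
      rw [Finset.not_nonempty_iff_eq_empty, Finset.filter_eq_empty_iff] at hcon
      rw [Finset.sum_eq_zero] at hx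
      · push_cast at hx; omega
      · intro i _
        have h1 := hcon (mem_univ i)
        have h2 := hge i
        omega
    set j := (univ.filter fun i => alcoveBase n i < x.1 i).max' hne with hj
    have hjlt : alcoveBase n j < x.1 j := (mem_filter.1 (Finset.max'_mem _ hne)).2
    have hjmax : ∀ i, j < i → x.1 i = alcoveBase n i := by
      intro i hi
      have h2 := hge i
      by_contra hcon
      have : i ≤ j := Finset.le_max' _ i (by simp only [mem_filter, mem_univ, true_and]; omega)
      exact absurd hi (not_lt.2 this)
    obtain ⟨h1, h2, h3⟩ := (mem_latticeAlcove hn).1 x.2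
    have hval : ∀ i, (x.1 + standardStep (j, (-1 : ℤˣ))) i = if i = j then x.1 i - 1 else x.1 i := by
      intro i
      simp only [Pi.add_apply, standardStep]
      by_cases h : i = j
      · subst h; simp; ring
      · simp [h]
    have hmem : x.1 + standardStep (j, (-1 : ℤˣ)) ∈ latticeAlcove n T := by
      rw [mem_latticeAlcove hn]
      refine ⟨fun a b hab => ?_, fun a => ?_, fun a b ha hb => ?_⟩
      · have e := h1 a b hab
        rw [hval, hval]
        split_ifs with hb ha ha
        · omega
        · omega
        · have e2 := hjmax b (ha ▸ hab)
          have e3 : (a : ℕ) < b := hab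
          rw [ha] at e3 ⊢
          simp only [alcoveBase] at e2 hjlt
          omega
        · exact e
      · rw [hval]
        have ha := a.2
        split_ifs with h
        · simp only [alcoveBase] at hjlt
          rw [← h] at hjlt
          omega
        · exact h2 a
      · have e := h3 a b ha hb
        rw [hval, hval]
        split_ifs <;> omega
    obtain ⟨y, hy1, hy2⟩ := ih ⟨_, hmem⟩ (by
      have : ∀ i, (x.1 + standardStep (j, (-1 : ℤˣ))) i - alcoveBase n i =
          (x.1 i - alcoveBase n i) - if i = j then 1 else 0 := by
        intro i
        rw [hval]
        split_ifs <;> ring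
      simp only [this, Finset.sum_sub_distrib, Finset.sum_ite_eq', mem_univ, if_true]
      rw [Finset.sum_sub_distrib] at hx
      push_cast at hx ⊢
      omega)
    refine ⟨y, hy1, Relation.ReflTransGen.head ?_ hy2⟩
    exact stepMatrix_ne_zero_of_step (j, -1) rfl

theorem stepMatrix_connected {n : ℕ} (hn : 2 ≤ n) {T : ℤ} (x y : latticeAlcove n T) :
    Relation.ReflTransGen (fun a b => stepMatrix n T a b ≠ 0) x y := by
  have key : ∀ x : latticeAlcove n T, ∃ z : latticeAlcove n T, z.1 = alcoveBase n ∧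
      Relation.ReflTransGen (fun a b => stepMatrix n T a b ≠ 0) x z := fun x =>
    reflTransGen_alcoveBase hn (∑ i, (x.1 i - alcoveBase n i)).toNat x
      (Int.toNat_of_nonneg (Finset.sum_nonneg fun i _ =>
        sub_nonneg.2 (le_of_mem_latticeAlcove hn x.2 i))).symm
  obtain ⟨z, hz, hxz⟩ := key x
  obtain ⟨z', hz', hyz⟩ := key y
  obtain rfl : z = z' := Subtype.ext (hz.trans hz'.symm)
  refine hxz.trans ?_
  have hsymm : Std.Symm fun a b : latticeAlcove n T => stepMatrix n T a b ≠ 0 :=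
    ⟨fun a b h => by rwa [stepMatrix_symm]⟩
  exact Relation.ReflTransGen.stdSymm.symm _ _ hyz

/-- The parity sign of an integer vector. -/
noncomputable def paritySign {n : ℕ} (x : Fin n → ℤ) : ℝ := (-1 : ℝ) ^ (∑ i, x i)

theorem paritySign_mul_self {n : ℕ} (x : Fin n → ℤ) : paritySign x * paritySign x = 1 := by
  rw [paritySign, ← mul_zpow]
  norm_num

theorem paritySign_step {n : ℕ} (x : Fin n → ℤ) (s : Fin n × ℤˣ) :
    paritySign (x + standardStep s) = -paritySign x := by
  have : ∑ i, standardStep s i = (s.2 : ℤ) := by simp [standardStep]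
  simp only [paritySign, Pi.add_apply, Finset.sum_add_distrib, this]
  rw [zpow_add₀ (by norm_num)]
  rcases Int.units_eq_one_or s.2 with h | h <;> rw [h] <;> norm_num

/-- The eigenvalue equation for `oddSinDet`. -/
theorem sum_oddSinDet_step {n : ℕ} (θ : ℝ) (x : Fin n → ℤ) :
    ∑ s : Fin n × ℤˣ, oddSinDet θ (x + standardStep s) =
      (∑ i : Fin n, 2 * cos ((2 * (i : ℕ) + 1) * θ)) * oddSinDet θ x := by
  simp only [oddSinDet, Matrix.det_apply', Matrix.of_apply]
  rw [Finset.sum_comm, Finset.mul_sum]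
  refine Finset.sum_congr rfl fun σ _ => ?_
  rw [← Finset.mul_sum, mul_left_comm]
  congr 1
  rw [Fintype.sum_prod_type, ← Equiv.sum_comp σ (fun i => 2 * cos ((2 * ((i : ℕ) : ℝ) + 1) * θ)),
    Finset.sum_mul]
  refine Finset.sum_congr rfl fun j _ => ?_
  have hunits : ∀ F : ℤˣ → ℝ, ∑ e, F e = F 1 + F (-1) := by
    intro F
    rw [show (univ : Finset ℤˣ) = {1, -1} from rfl, Finset.sum_pair (by decide)]
  have hstep : ∀ e : ℤˣ, ∏ i, sin ((2 * ((σ i : ℕ) : ℝ) + 1) * θ * ((x + standardStep (j, e)) i : ℤ))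
      = sin ((2 * ((σ j : ℕ) : ℝ) + 1) * θ * (x j + ((e : ℤ) : ℝ))) *
        ∏ i ∈ univ.erase j, sin ((2 * ((σ i : ℕ) : ℝ) + 1) * θ * x i) := by
    intro e
    rw [← Finset.mul_prod_erase univ _ (mem_univ j)]
    congr 1
    · simp [standardStep]
    · refine Finset.prod_congr rfl fun i hi => ?_
      simp [standardStep, Finset.ne_of_mem_erase hi]
  rw [hunits, hstep, hstep, ← Finset.mul_prod_erase univ _ (mem_univ j)]
  push_cast
  rw [mul_add, mul_add, mul_one, mul_neg_one, sin_add, sin_add, sin_neg, cos_neg]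
  ring

theorem sum_two_cos_odd (n : ℕ) (θ : ℝ) :
    (∑ i : Fin n, 2 * cos ((2 * (i : ℕ) + 1) * θ)) * sin θ = sin (2 * n * θ) := by
  rw [Fin.sum_univ_eq_sum_range (fun i : ℕ => 2 * cos ((2 * (i : ℝ) + 1) * θ)) n]
  induction n with
  | zero => simp
  | succ n ih =>
    rw [Finset.sum_range_succ, add_mul, ih]
    push_cast
    rw [show 2 * ((n : ℝ) + 1) * θ = (2 * n + 1) * θ + θ by ring,
      show 2 * (n : ℝ) * θ = (2 * n + 1) * θ - θ by ring, sin_add, sin_sub]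
    ring

/-- The transpose is the matrix of `det_odd_sin` at the angles θ x_i. For θ = π/T all factors are
visibly positive in the alcove. -/
theorem oddSinDet_eq_prod {n : ℕ} (θ : ℝ) (x : Fin n → ℤ) :
    oddSinDet θ x = (∏ i, sin (θ * x i)) * ∏ i : Fin n, ∏ j ∈ Ioi i,
      (4 * sin (θ * (x i - x j)) * sin (θ * (x i + x j))) := by
  have h := det_odd_sin fun i => θ * (x i : ℝ)
  rw [← Matrix.det_transpose, Matrix.det_vandermonde] at h
  have h1 : oddSinDet θ x = (Matrix.of fun i j : Fin n =>
      sin ((2 * ((j : ℕ) : ℝ) + 1) * (θ * x i))).transpose.det := by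
    rw [oddSinDet]
    congr 1
    ext i j
    simp only [Matrix.of_apply, Matrix.transpose_apply]
    congr 1
    ring
  rw [h1, h]
  congr 1
  refine Finset.prod_congr rfl fun i _ => Finset.prod_congr rfl fun j _ => ?_
  rw [← mul_sub, cos_sub_cos,
    show (2 * (θ * (x j : ℝ)) + 2 * (θ * x i)) / 2 = θ * (x i + x j) by ring,
    show (2 * (θ * (x j : ℝ)) - 2 * (θ * x i)) / 2 = -(θ * (x i - x j)) by ring, sin_neg]
  ring

theorem oddSinDet_pos {n : ℕ} (hn : 2 ≤ n) {T : ℤ} (hT : 0 < T) {x : Fin n → ℤ}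
    (hx : x ∈ latticeAlcove n T) : 0 < oddSinDet (π / T) x := by
  obtain ⟨h1, h2, -⟩ := (mem_latticeAlcove hn).1 hx
  have hT' : (0 : ℝ) < T := by exact_mod_cast hT
  have hsin : ∀ a : ℤ, 0 < a → a < T → 0 < sin (π / T * a) := by
    intro a ha haT
    have ha' : (0 : ℝ) < a := by exact_mod_cast ha
    have haT' : (a : ℝ) < T := by exact_mod_cast haT
    refine sin_pos_of_pos_of_lt_pi (by positivity) ?_
    rw [div_mul_eq_mul_div, div_lt_iff₀ hT']
    exact mul_lt_mul_of_pos_left haT' pi_pos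
  rw [oddSinDet_eq_prod]
  refine mul_pos (Finset.prod_pos fun i _ => hsin _ (h2 i) (lt_of_mem_latticeAlcove hn hx i)) ?_
  refine Finset.prod_pos fun i _ => Finset.prod_pos fun j hj => ?_
  have hij : i < j := Finset.mem_Ioi.1 hj
  have e1 := h1 i j hij
  have e2 := add_lt_of_mem_latticeAlcove hn hx hij
  have e3 := h2 j
  have e4 := h2 i
  have s1 := hsin (x i - x j) (by omega) (by omega)
  have s2 := hsin (x i + x j) (by omega) e2
  push_cast at s1 s2
  positivity

theorem oddSinDet_of_eq {n : ℕ} (θ : ℝ) {x : Fin n → ℤ} {i j : Fin n} (hij : i ≠ j)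
    (h : x i = x j) : oddSinDet θ x = 0 :=
  Matrix.det_zero_of_column_eq hij fun k => by simp [h]

/-- Oddness of the frequency is essential: the argument becomes π minus the old one, up to a
multiple of 2π. This gives both the vanishing on the wall x_i + x_j = T and the folding symmetry. -/
theorem sin_odd_mul_reflect {T : ℤ} (hT : 0 < T) (k : ℕ) (z : ℤ) :
    sin ((2 * (k : ℝ) + 1) * (π / T) * ((T - z : ℤ) : ℝ)) =
      sin ((2 * (k : ℝ) + 1) * (π / T) * z) := by
  have hT' : (T : ℝ) ≠ 0 := by exact_mod_cast hT.ne'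
  have : (2 * (k : ℝ) + 1) * (π / T) * ((T - z : ℤ) : ℝ) =
      (π - (2 * (k : ℝ) + 1) * (π / T) * z) + k * (2 * π) := by
    push_cast
    field_simp
    ring
  rw [this, sin_add_nat_mul_two_pi, sin_pi_sub]

theorem oddSinDet_of_add_eq {n : ℕ} {T : ℤ} (hT : 0 < T) {x : Fin n → ℤ} {i j : Fin n}
    (hij : i ≠ j) (h : x i + x j = T) : oddSinDet (π / T) x = 0 := by
  refine Matrix.det_zero_of_column_eq hij fun k => ?_
  simp only [Matrix.of_apply]
  rw [show x i = T - x j by omega, sin_odd_mul_reflect hT]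

/-- Coordinates are integers and a step changes one of them by one, so a strict inequality that
fails after the step has become an equality: two columns coincide or one column is zero. -/
theorem oddSinDet_boundary {n : ℕ} (hn : 2 ≤ n) {T : ℤ} (hT : 0 < T) {x : Fin n → ℤ}
    (hx : x ∈ latticeAlcove n T) (s : Fin n × ℤˣ)
    (hs : x + standardStep s ∉ latticeAlcove n T) :
    oddSinDet (π / T) (x + standardStep s) = 0 := by
  obtain ⟨h1, h2, h3⟩ := (mem_latticeAlcove hn).1 hx
  obtain ⟨a, e⟩ := s
  have hval : ∀ i, (x + standardStep (a, e)) i = if i = a then x i + (e : ℤ) else x i := by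
    intro i
    simp only [Pi.add_apply, standardStep]
    by_cases h : i = a
    · subst h; simp
    · simp [h]
  have he : (e : ℤ) = 1 ∨ (e : ℤ) = -1 := by
    rcases Int.units_eq_one_or e with h | h <;> simp [h]
  rw [mem_latticeAlcove hn] at hs
  by_cases c1 : ∀ i j : Fin n, i < j → (x + standardStep (a, e)) j < (x + standardStep (a, e)) i
  · by_cases c2 : ∀ i, 0 < (x + standardStep (a, e)) i
    · have c3 : ¬ ∀ i j : Fin n, (i : ℕ) = 0 → (j : ℕ) = 1 →
          (x + standardStep (a, e)) i + (x + standardStep (a, e)) j < T :=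
        fun h => hs ⟨c1, c2, h⟩
      push Not at c3
      obtain ⟨i, j, hi, hj, hij⟩ := c3
      have hne : i ≠ j := fun h => by rw [h] at hi; omega
      refine oddSinDet_of_add_eq hT hne ?_
      have e1 := h3 i j hi hj
      rw [hval, hval] at hij ⊢
      split_ifs at hij ⊢ with p q q
      · exact absurd (p.trans q.symm) hne
      all_goals omega
    · push Not at c2
      obtain ⟨i, hi⟩ := c2
      have e1 := h2 i
      refine Matrix.det_eq_zero_of_column_eq_zero i fun k => ?_
      have : (x + standardStep (a, e)) i = 0 := by
        rw [hval] at hi ⊢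
        split_ifs at hi ⊢ <;> omega
      rw [Matrix.of_apply, this]
      simp
  · push Not at c1
    obtain ⟨i, j, hij, hle⟩ := c1
    refine oddSinDet_of_eq _ hij.ne ?_
    have e1 := h1 i j hij
    rw [hval, hval] at hle ⊢
    split_ifs at hle ⊢ with p q q
    · exact absurd (q.trans p.symm) hij.ne'
    all_goals omega

end AlcoveWalks

/-! ### Norm of the eigenvector, folding of the alcove, parity twist -/

section AlcoveSums

open Finset Real Matrix Filter Asymptotics

/-- The asymptotic equivalence for the row sums of the powers of the adjacency matrix of a
connected bipartite graph. -/
theorem isEquivalent_pow_mulVec_one {Ω : Type*} [Fintype Ω] [DecidableEq Ω] (A : Matrix Ω Ω ℝ)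
    (hA : ∀ x y, 0 ≤ A x y) (hsymm : ∀ x y, A x y = A y x)
    (hconn : ∀ x y, Relation.ReflTransGen (fun a b => A a b ≠ 0) x y)
    (ε : Ω → ℝ) (hε : ∀ x, ε x * ε x = 1) (hbip : ∀ x y, A x y ≠ 0 → ε y = -ε x)
    (v : Ω → ℝ) (hv : ∀ x, 0 < v x) (g : ℝ) (hg : ∀ x, ∑ y, A x y * v y = g * v x) (x : Ω) :
    IsEquivalent atTop (fun k : ℕ => ((A ^ k) *ᵥ (1 : Ω → ℝ)) x)
      (fun k : ℕ => g ^ k * (v x / (∑ y, v y ^ 2) *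
      (∑ y, v y + (-1) ^ k * ε x * ∑ y, ε y * v y))) := by
  have hg0 : 0 ≤ g := by
    have h1 : 0 ≤ g * v x := by
      rw [← hg]
      exact Finset.sum_nonneg fun y _ => mul_nonneg (hA x y) (hv y).le
    exact nonneg_of_mul_nonneg_left h1 (hv x)
  rcases hg0.eq_or_lt with h0 | hpos
  -- Degenerate case g = 0: the matrix is zero, and both sides vanish for k ≥ 1.
  · have hzero : A = 0 := by
      ext z y
      have h1 : ∑ y, A z y * v y = 0 := by rw [hg, ← h0, zero_mul]
      have h2 := (Finset.sum_eq_zero_iff_of_nonneg fun y _ =>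
        mul_nonneg (hA z y) (hv y).le).1 h1 y (mem_univ y)
      exact (mul_eq_zero.1 h2).resolve_right (hv y).ne'
    refine Filter.EventuallyEq.isEquivalent ?_
    filter_upwards [eventually_ge_atTop 1] with k hk
    rw [← h0, hzero, zero_pow (by omega), zero_pow (by omega)]
    simp
  · refine IsLittleO.isEquivalent ?_
    have hlo := isLittleO_pow_mulVec_one A hA hsymm hconn ε hε hbip v hv g hpos hg x
    refine hlo.trans_isBigO ?_
    have hS : 0 < ∑ y, v y ^ 2 :=
      Finset.sum_pos (fun y _ => pow_pos (hv y) 2) ⟨x, mem_univ x⟩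
    have hεv : ∀ y, ε y = 1 ∨ ε y = -1 := fun y => mul_self_eq_one_iff.1 (hε y)
    -- The expression is twice the sum of v over one bipartition class. Neither class is empty: one
    -- contains x, the other a neighbour of x, which exists as g > 0.
    have hc : ∀ δ : ℝ, δ = 1 ∨ δ = -1 → 0 < ∑ y, v y + δ * ε x * ∑ y, ε y * v y := by
      intro δ hδ
      rw [Finset.mul_sum, ← Finset.sum_add_distrib]
      obtain ⟨z, hz⟩ : ∃ z, δ * ε x * ε z = 1 := by
        rcases hδ with h | h
        · exact ⟨x, by rw [h, one_mul, hε]⟩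
        · have h1 : ∑ y, A x y * v y ≠ 0 := by
            rw [hg]; exact (mul_pos hpos (hv x)).ne'
          obtain ⟨z, -, hz⟩ := Finset.exists_ne_zero_of_sum_ne_zero h1
          refine ⟨z, ?_⟩
          rw [hbip x z (left_ne_zero_of_mul hz), h]
          linear_combination hε x
      refine Finset.sum_pos' (fun y _ => ?_) ⟨z, mem_univ z, ?_⟩
      · have : -1 ≤ δ * ε x * ε y := by
          rcases hδ with h | h <;> rcases hεv x with h' | h' <;> rcases hεv y with h'' | h'' <;>
            rw [h, h', h''] <;> norm_num
        have h2 := mul_nonneg (by linarith : 0 ≤ 1 + δ * ε x * ε y) (hv y).le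
        linarith
      · rw [← mul_assoc, hz]
        have := hv z
        linarith
    set c : ℝ → ℝ := fun δ => v x / (∑ y, v y ^ 2) * (∑ y, v y + δ * ε x * ∑ y, ε y * v y) with hcdef
    have hcpos : ∀ δ : ℝ, δ = 1 ∨ δ = -1 → 0 < c δ := fun δ hδ =>
      mul_pos (div_pos (hv x) hS) (hc δ hδ)
    -- The leading coefficient depends only on the parity of k and takes the two positive values
    -- c(1) and c(-1).
    refine IsBigO.of_bound (1 / min (c 1) (c (-1))) (Eventually.of_forall fun k => ?_)
    have hmin : 0 < min (c 1) (c (-1)) :=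
      lt_min (hcpos 1 (Or.inl rfl)) (hcpos (-1) (Or.inr rfl))
    have hδ := neg_one_pow_eq_or ℝ k
    have hle : min (c 1) (c (-1)) ≤ c ((-1) ^ k) := by
      rcases hδ with h | h <;> rw [h]
      · exact min_le_left _ _
      · exact min_le_right _ _
    have hgk : 0 < g ^ k := pow_pos hpos k
    change ‖g ^ k‖ ≤ _ * ‖g ^ k * c ((-1) ^ k)‖
    rw [norm_of_nonneg hgk.le, norm_of_nonneg (mul_pos hgk (hcpos _ hδ)).le, one_div,
      inv_mul_eq_div, le_div_iff₀ hmin]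
    exact mul_le_mul_of_nonneg_left hle hgk.le

/-- The Cauchy–Binet formula for a Gram matrix. -/
theorem sum_det_sq_eq_det_gram {n : ℕ} (s : Finset ℤ) (f : Fin n → ℤ → ℝ) :
    ∑ y ∈ monoTuples n s, (Matrix.of fun i j => f i (y j)).det ^ 2 =
      (Matrix.of fun i j : Fin n => ∑ z ∈ s, f i z * f j z).det := by
  have h1 : (Matrix.of fun i j : Fin n => ∑ z ∈ s, f i z * f j z).det =
      ∑ p ∈ Fintype.piFinset fun _ : Fin n => s,
        (Matrix.of fun i j => f i (p j)).det * ∏ j, f j (p j) := by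
    rw [Matrix.det_apply']
    simp only [Matrix.of_apply, Finset.prod_univ_sum, Matrix.det_apply', Finset.sum_mul,
      Finset.mul_sum]
    rw [Finset.sum_comm]
    refine Finset.sum_congr rfl fun p _ => Finset.sum_congr rfl fun σ _ => ?_
    rw [Finset.prod_mul_distrib]
    ring
  have h2 : ∀ y : Fin n → ℤ, (Matrix.of fun i j => f i (y j)).det ^ 2 =
      ∑ σ : Equiv.Perm (Fin n), (Matrix.of fun i j => f i (y (σ j))).det * ∏ j, f j (y (σ j)) := by
    intro y
    have hperm : ∀ σ : Equiv.Perm (Fin n), (Matrix.of fun i j => f i (y (σ j))).det =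
        ((Equiv.Perm.sign σ : ℤ) : ℝ) * (Matrix.of fun i j => f i (y j)).det := by
      intro σ
      rw [← Matrix.det_permute']
      rfl
    have htr : (Matrix.of fun i j => f i (y j)).det =
        ∑ σ : Equiv.Perm (Fin n), ((Equiv.Perm.sign σ : ℤ) : ℝ) * ∏ j, f j (y (σ j)) := by
      rw [← Matrix.det_transpose, Matrix.det_apply']
      rfl
    simp only [hperm]
    rw [sq]
    conv_lhs => rw [htr, Finset.sum_mul]
    rw [← htr]
    refine Finset.sum_congr rfl fun σ _ => ?_
    ring
  rw [h1, Finset.sum_congr rfl fun y _ => h2 y, ← Finset.sum_product']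
  -- Every injective tuple is a strictly increasing one composed with a unique permutation; for
  -- other tuples the determinant is zero.
  refine Finset.sum_of_injOn (fun a => a.1 ∘ a.2) ?_ ?_ ?_ ?_
  · rintro ⟨Y, σ⟩ hY ⟨Y', σ'⟩ hY' h
    simp only [coe_product, Set.mem_prod, mem_coe, mem_monoTuples] at hY hY' h
    have hYY : Y = Y' := by
      rw [← StrictMono.range_inj hY.1.2 hY'.1.2, ← σ.surjective.range_comp Y,
        ← σ'.surjective.range_comp Y', h]
    subst hYY
    refine Prod.ext rfl (Equiv.ext fun j => ?_)
    exact hY.1.2.injective (congrFun h j)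
  · rintro ⟨Y, σ⟩ hY
    simp only [coe_product, Set.mem_prod, mem_coe, mem_monoTuples, Fintype.mem_piFinset] at hY ⊢
    exact fun i => hY.1.1 _
  · intro p hp hnot
    have hninj : ¬ Function.Injective p := by
      intro hinj
      refine hnot ⟨(p ∘ Tuple.sort p, (Tuple.sort p)⁻¹), ?_, ?_⟩
      · simp only [coe_product, Set.mem_prod, mem_coe, mem_monoTuples, mem_univ, and_true]
        rw [Fintype.mem_piFinset] at hp
        exact ⟨fun i => hp _, (Tuple.monotone_sort p).strictMono_of_injective
          (hinj.comp (Tuple.sort p).injective)⟩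
      · funext j
        simp
    rw [Function.Injective] at hninj
    push Not at hninj
    obtain ⟨i, j, hij, hne⟩ := hninj
    rw [Matrix.det_zero_of_column_eq hne, zero_mul]
    intro k
    simp [hij]
  · intro a _
    rfl

theorem sum_cos_two_mul (K : ℕ) (c : ℝ) :
    (∑ z ∈ Finset.Icc (1 : ℤ) K, cos (2 * c * z)) * (2 * sin c) = sin ((2 * K + 1) * c) - sin c := by
  induction K with
  | zero => simp
  | succ K ih =>
    rw [Icc_one_add_one, Finset.sum_insert (by simp), add_mul, ih]
    push_cast
    rw [show (2 * ((K : ℝ) + 1) + 1) * c = 2 * c * (K + 1) + c by ring,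
      show (2 * (K : ℝ) + 1) * c = 2 * c * (K + 1) - c by ring, sin_add, sin_sub]
    ring

theorem sum_cos_two_mul_of_eq {T : ℤ} (hT : 0 < T) {K : ℕ} {δ : ℤ} (hK : 2 * (K : ℤ) + 1 = T + δ)
    (hδ : δ = 0 ∨ δ = 1 ∨ δ = -1) (d : ℤ) (hd : sin (d * (π / T)) ≠ 0) :
    ∑ z ∈ Finset.Icc (1 : ℤ) K, cos (2 * (d * (π / T)) * z) = ((-1) ^ d * δ - 1) / 2 := by
  have h := sum_cos_two_mul K (d * (π / T))
  have hT' : (T : ℝ) ≠ 0 := by exact_mod_cast hT.ne'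
  have hK' : 2 * (K : ℝ) + 1 = T + δ := by exact_mod_cast hK
  have harg : (2 * (K : ℝ) + 1) * (d * (π / T)) = δ * (d * (π / T)) + d * π := by
    rw [hK']; field_simp; ring
  have hδs : sin (δ * (d * (π / T))) = δ * sin (d * (π / T)) := by
    rcases hδ with h | h | h <;> simp [h]
  rw [harg, sin_add_int_mul_pi, hδs] at h
  have h2 : (2 * sin (d * (π / T))) ≠ 0 := mul_ne_zero two_ne_zero hd
  refine mul_right_cancel₀ h2 ?_
  rw [h]
  ring

theorem sin_int_mul_pi_div_pos {T a : ℤ} (ha : 0 < a) (haT : a < T) : 0 < sin (a * (π / T)) := by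
  have hT' : (0 : ℝ) < T := by exact_mod_cast ha.trans haT
  have ha' : (0 : ℝ) < a := by exact_mod_cast ha
  have haT' : (a : ℝ) < T := by exact_mod_cast haT
  refine sin_pos_of_pos_of_lt_pi (by positivity) ?_
  rw [mul_div_assoc', div_lt_iff₀ hT', mul_comm]
  exact mul_lt_mul_of_pos_left haT' pi_pos

/-- Product-to-sum formulas leave two cosine sums of Dirichlet kernel type. The number δ measures
how far [1, K] is from half of a period; for δ = 0 the rows are orthogonal. -/
theorem gram_oddSin {n : ℕ} {T : ℤ} (hn : 2 * (n : ℤ) ≤ T) {K : ℕ} {δ : ℤ}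
    (hK : 2 * (K : ℤ) + 1 = T + δ) (hδ : δ = 0 ∨ δ = 1 ∨ δ = -1) (i j : Fin n) :
    ∑ z ∈ Finset.Icc (1 : ℤ) K, sin ((2 * (i : ℕ) + 1) * (π / T) * z) *
      sin ((2 * (j : ℕ) + 1) * (π / T) * z) =
    (T / 4) * (if i = j then 1 else 0) + (δ / 2) * ((-1) ^ (i : ℕ) * (-1) ^ (j : ℕ)) := by
  have hi := i.2
  have hj := j.2
  have hT : 0 < T := by omega
  have hprod : ∀ z : ℤ, sin ((2 * (i : ℕ) + 1) * (π / T) * z) *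
      sin ((2 * (j : ℕ) + 1) * (π / T) * z) =
      (cos (2 * ((((i : ℤ) - j : ℤ) : ℝ) * (π / T)) * z) -
        cos (2 * ((((i : ℤ) + j + 1 : ℤ) : ℝ) * (π / T)) * z)) / 2 := by
    intro z
    rw [cos_sub_cos]
    push_cast
    rw [show (2 * (((i : ℝ) - j) * (π / T)) * z + 2 * (((i : ℝ) + j + 1) * (π / T)) * z) / 2 =
        (2 * (i : ℕ) + 1) * (π / T) * z by ring,
      show (2 * (((i : ℝ) - j) * (π / T)) * z - 2 * (((i : ℝ) + j + 1) * (π / T)) * z) / 2 =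
        -((2 * (j : ℕ) + 1) * (π / T) * z) by ring, sin_neg]
    ring
  have hne2 : sin (((i : ℤ) + j + 1 : ℤ) * (π / T)) ≠ 0 :=
    (sin_int_mul_pi_div_pos (by omega) (by omega)).ne'
  rw [Finset.sum_congr rfl fun z _ => hprod z, ← Finset.sum_div, Finset.sum_sub_distrib,
    sum_cos_two_mul_of_eq hT hK hδ _ hne2]
  have hpow2 : (-1 : ℝ) ^ ((i : ℤ) + j + 1) = -((-1) ^ (i : ℕ) * (-1) ^ (j : ℕ)) := by
    rw [zpow_add₀ (by norm_num), zpow_add₀ (by norm_num)]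
    simp
  rw [hpow2]
  have hK' : 2 * (K : ℝ) + 1 = T + δ := by exact_mod_cast hK
  by_cases hij : i = j
  · subst hij
    have hs : (-1 : ℝ) ^ (i : ℕ) * (-1 : ℝ) ^ (i : ℕ) = 1 := by rw [← mul_pow]; simp
    have hc : ∑ z ∈ Finset.Icc (1 : ℤ) K, cos (2 * ((((i : ℤ) - i : ℤ) : ℝ) * (π / T)) * z) =
        K := by simp
    rw [hc, hs, if_pos rfl]
    linear_combination hK' / 4
  · have hne1 : sin (((i : ℤ) - j : ℤ) * (π / T)) ≠ 0 := by
      rcases lt_or_gt_of_ne (fun h => hij (Fin.ext h) : (i : ℕ) ≠ j) with h | h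
      · have := (sin_int_mul_pi_div_pos (T := T) (a := (j : ℤ) - i) (by omega) (by omega)).ne'
        rw [← neg_sub, Int.cast_neg, neg_mul, sin_neg]
        exact neg_ne_zero.2 this
      · exact (sin_int_mul_pi_div_pos (by omega) (by omega)).ne'
    have hpow1 : (-1 : ℝ) ^ ((i : ℤ) - j) = (-1) ^ (i : ℕ) * (-1) ^ (j : ℕ) := by
      rw [zpow_sub₀ (by norm_num), zpow_natCast, zpow_natCast, div_eq_mul_inv, ← inv_pow]
      norm_num
    rw [sum_cos_two_mul_of_eq hT hK hδ _ hne1, hpow1, if_neg hij]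
    ring

/-- The Gram matrix is a scalar matrix plus a rank-one matrix, so the matrix determinant lemma
applies. -/
theorem sum_oddSinDet_sq {n : ℕ} {T : ℤ} (hn1 : 0 < n) (hn : 2 * (n : ℤ) ≤ T) {K : ℕ} {δ : ℤ}
    (hK : 2 * (K : ℤ) + 1 = T + δ) (hδ : δ = 0 ∨ δ = 1 ∨ δ = -1) :
    ∑ y ∈ monoTuples n (Finset.Icc (1 : ℤ) K), oddSinDet (π / T) y ^ 2 =
      ((T : ℝ) / 4) ^ n * (1 + 2 * δ * n / T) := by
  have hT : (0 : ℝ) < T := by exact_mod_cast (by omega : 0 < T)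
  have h := sum_det_sq_eq_det_gram (Finset.Icc (1 : ℤ) K)
    fun (i : Fin n) z => sin ((2 * (i : ℕ) + 1) * (π / T) * z)
  have hgram : (Matrix.of fun i j : Fin n => ∑ z ∈ Finset.Icc (1 : ℤ) K,
      sin ((2 * (i : ℕ) + 1) * (π / T) * z) * sin ((2 * (j : ℕ) + 1) * (π / T) * z)) =
      ((T : ℝ) / 4) • (1 + replicateCol Unit (fun i : Fin n => (2 * δ / T : ℝ) * (-1) ^ (i : ℕ)) *
        replicateRow Unit (fun j : Fin n => (-1 : ℝ) ^ (j : ℕ))) := by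
    ext i j
    rw [Matrix.of_apply, gram_oddSin hn hK hδ]
    simp only [Matrix.smul_apply, Matrix.add_apply, Matrix.one_apply, Matrix.mul_apply,
      replicateCol_apply, replicateRow_apply, Finset.univ_unique, Finset.sum_singleton,
      smul_eq_mul]
    field_simp
    ring
  have hdot : (fun j : Fin n => (-1 : ℝ) ^ (j : ℕ)) ⬝ᵥ
      (fun i : Fin n => (2 * δ / T : ℝ) * (-1) ^ (i : ℕ)) = 2 * δ * n / T := by
    rw [dotProduct, Finset.sum_congr rfl (g := fun _ => (2 * δ / T : ℝ))]
    · simp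
      ring
    · intro i _
      have hs : (-1 : ℝ) ^ (i : ℕ) * (-1 : ℝ) ^ (i : ℕ) = 1 := by rw [← mul_pow]; simp
      linear_combination (2 * δ / T : ℝ) * hs
  rw [hgram, Matrix.det_smul, Matrix.det_one_add_replicateCol_mul_replicateRow, hdot,
    Fintype.card_fin] at h
  exact h

/-- The reflection `x_1 ↦ T - x_1`. -/
def reflectFirst {n : ℕ} (T : ℤ) (x : Fin n → ℤ) (i : Fin n) : ℤ :=
  if (i : ℕ) = 0 then T - x i else x i

theorem reflectFirst_reflectFirst {n : ℕ} (T : ℤ) (x : Fin n → ℤ) :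
    reflectFirst T (reflectFirst T x) = x := by
  funext i
  simp only [reflectFirst]
  split_ifs <;> ring

theorem comp_rev_mem_monoTuples {n K : ℕ} {x : Fin n → ℤ} :
    x ∘ Fin.rev ∈ monoTuples n (Finset.Icc (1 : ℤ) K) ↔
      (∀ i j : Fin n, i < j → x j < x i) ∧ (∀ i, 0 < x i) ∧ ∀ i : Fin n, (i : ℕ) = 0 → x i ≤ K := by
  rw [mem_monoTuples]
  simp only [Function.comp_apply, Finset.mem_Icc]
  constructor
  · rintro ⟨h1, h2⟩
    refine ⟨fun i j hij => ?_, fun i => ?_, fun i _ => ?_⟩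
    · have := h2 (Fin.rev_lt_rev.2 hij)
      simpa using this
    · have := (h1 i.rev).1
      rw [Fin.rev_rev] at this
      omega
    · have := (h1 i.rev).2
      rwa [Fin.rev_rev] at this
  · rintro ⟨h1, h2, h3⟩
    refine ⟨fun i => ⟨by have := h2 i.rev; omega, ?_⟩, fun i j hij => ?_⟩
    · have hi := i.2
      have h4 := h3 ⟨0, by omega⟩ rfl
      rcases Nat.eq_zero_or_pos (i.rev : ℕ) with h | h
      · exact h3 _ h
      · have := h1 ⟨0, by omega⟩ i.rev h
        omega
    · exact h1 _ _ (Fin.rev_lt_rev.2 hij)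

/-- Folding the alcove along `x_1 = T / 2`. -/
theorem sum_latticeAlcove {n : ℕ} (hn : 2 ≤ n) {T : ℤ} {K₁ K₂ : ℕ} (hK : (K₁ : ℤ) + K₂ + 1 = T)
    (h1 : K₂ ≤ K₁) (h2 : K₁ ≤ K₂ + 1) (h : (Fin n → ℤ) → ℝ) :
    ∑ x ∈ latticeAlcove n T, h x =
      ∑ y ∈ monoTuples n (Finset.Icc (1 : ℤ) K₁), h (y ∘ Fin.rev) +
      ∑ y ∈ monoTuples n (Finset.Icc (1 : ℤ) K₂), h (reflectFirst T (y ∘ Fin.rev)) := by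
  have hrev : ∀ y : Fin n → ℤ, (y ∘ Fin.rev) ∘ Fin.rev = y := fun y => by
    funext i; simp
  -- Where x_1 ≤ K₁, the wall x_1 + x_2 < T is automatic since K₁ ≤ K₂ + 1. Where x_1 > K₁,
  -- reflection gives T - x_1 ≤ K₂ and turns that wall into the order condition x_2 < T - x_1.
  rw [← Finset.sum_filter_add_sum_filter_not _ fun x => x ⟨0, by omega⟩ ≤ (K₁ : ℤ)]
  have h0 : ∀ i : Fin n, (i : ℕ) = 0 → i = ⟨0, by omega⟩ := fun i hi => Fin.ext hi
  congr 1
  · refine Finset.sum_nbij' (fun x => x ∘ Fin.rev) (fun y => y ∘ Fin.rev) ?_ ?_ ?_ ?_ ?_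
    · intro x hx
      rw [mem_filter, mem_latticeAlcove hn] at hx
      exact comp_rev_mem_monoTuples.2 ⟨hx.1.1, hx.1.2.1, fun i hi => h0 i hi ▸ hx.2⟩
    · intro y hy
      rw [← hrev y, comp_rev_mem_monoTuples] at hy
      rw [mem_filter, mem_latticeAlcove hn]
      refine ⟨⟨hy.1, hy.2.1, fun i j hi hj => ?_⟩, hy.2.2 _ rfl⟩
      have e1 := hy.2.2 i hi
      have e2 := hy.1 i j (by show (i : ℕ) < j; omega)
      omega
    · intro x _; exact hrev x
    · intro y _; exact hrev y
    · intro x _; rw [hrev]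
  · refine Finset.sum_nbij' (fun x => reflectFirst T x ∘ Fin.rev)
      (fun y => reflectFirst T (y ∘ Fin.rev)) ?_ ?_ ?_ ?_ ?_
    · intro x hx
      rw [mem_filter, mem_latticeAlcove hn] at hx
      obtain ⟨⟨a1, a2, a3⟩, a4⟩ := hx
      refine comp_rev_mem_monoTuples.2 ⟨fun i j hij => ?_, fun i => ?_, fun i hi => ?_⟩
      · have hij' : (i : ℕ) < j := hij
        simp only [reflectFirst]
        rw [if_neg (by omega : ¬ (j : ℕ) = 0)]
        split_ifs with hi
        · have e1 := a3 i ⟨1, by omega⟩ hi rfl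
          rcases Nat.lt_or_ge 1 (j : ℕ) with hj | hj
          · have := a1 ⟨1, by omega⟩ j hj
            omega
          · have hj1 : j = ⟨1, by omega⟩ := Fin.ext (by simp only; omega)
            rw [hj1]
            omega
        · exact a1 i j hij
      · simp only [reflectFirst]
        have e2 := a2 ⟨1, by omega⟩
        split_ifs with hi
        · have e1 := a3 i ⟨1, by omega⟩ hi rfl
          omega
        · exact a2 i
      · simp only [reflectFirst, hi, if_true]
        rw [h0 i hi]
        omega
    · intro y hy
      rw [← hrev y, comp_rev_mem_monoTuples] at hy
      obtain ⟨a1, a2, a3⟩ := hy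
      set x := y ∘ Fin.rev with hx
      rw [mem_filter, mem_latticeAlcove hn]
      have e0 := a3 ⟨0, by omega⟩ rfl
      refine ⟨⟨fun i j hij => ?_, fun i => ?_, fun i j hi hj => ?_⟩, ?_⟩
      · have hij' : (i : ℕ) < j := hij
        simp only [reflectFirst]
        rw [if_neg (by omega : ¬ (j : ℕ) = 0)]
        have e1 := a1 i j hij
        split_ifs with hi
        · have e2 := a3 i hi
          omega
        · exact e1
      · simp only [reflectFirst]
        split_ifs with hi
        · have e2 := a3 i hi
          omega
        · exact a2 i
      · have e1 := a1 i j (by show (i : ℕ) < j; omega)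
        simp only [reflectFirst, hi, hj, if_true]
        rw [if_neg one_ne_zero]
        omega
      · simp only [reflectFirst, if_true]
        omega
    · intro x _; simp only [hrev, reflectFirst_reflectFirst]
    · intro y _; simp only [reflectFirst_reflectFirst, hrev]
    · intro x _; simp only [hrev, reflectFirst_reflectFirst]

theorem oddSinDet_comp_rev {n : ℕ} (θ : ℝ) (y : Fin n → ℤ) :
    oddSinDet θ (y ∘ Fin.rev) =
      ((Equiv.Perm.sign (Fin.revPerm : Equiv.Perm (Fin n)) : ℤ) : ℝ) * oddSinDet θ y := by
  rw [oddSinDet, oddSinDet, ← Matrix.det_permute']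
  rfl

theorem oddSinDet_reflectFirst {n : ℕ} {T : ℤ} (hT : 0 < T) (x : Fin n → ℤ) :
    oddSinDet (π / T) (reflectFirst T x) = oddSinDet (π / T) x := by
  rw [oddSinDet, oddSinDet]
  congr 1
  ext i j
  simp only [Matrix.of_apply, reflectFirst]
  split_ifs
  · exact sin_odd_mul_reflect hT i (x j)
  · rfl

theorem paritySign_eq_prod {n : ℕ} (x : Fin n → ℤ) : paritySign x = ∏ i, (-1 : ℝ) ^ x i := by
  have : ∀ s : Finset (Fin n), (-1 : ℝ) ^ (∑ i ∈ s, x i) = ∏ i ∈ s, (-1 : ℝ) ^ x i := by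
    intro s
    induction s using Finset.induction_on with
    | empty => simp
    | insert a s ha ih => rw [Finset.sum_insert ha, Finset.prod_insert ha, zpow_add₀ (by norm_num), ih]
  exact this univ

theorem paritySign_comp_rev {n : ℕ} (y : Fin n → ℤ) : paritySign (y ∘ Fin.rev) = paritySign y := by
  rw [paritySign, paritySign]
  congr 1
  exact Equiv.sum_comp Fin.revPerm y

theorem paritySign_reflectFirst {n : ℕ} (hn : 0 < n) (T : ℤ) (x : Fin n → ℤ) :
    paritySign (reflectFirst T x) = (-1) ^ T * paritySign x := by
  obtain ⟨n, rfl⟩ : ∃ k, n = k + 1 := ⟨n - 1, by omega⟩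
  rw [paritySign_eq_prod, paritySign_eq_prod, Fin.prod_univ_succ, Fin.prod_univ_succ]
  simp only [reflectFirst, Fin.val_zero, if_true, Fin.val_succ, Nat.succ_ne_zero, if_false]
  rw [zpow_sub₀ (by norm_num), div_eq_mul_inv, ← _root_.inv_zpow, mul_assoc]
  norm_num

/-- All frequencies are odd, so adding π to θ multiplies column j by (-1)^{x_j}. Signed sums thereby
become unsigned sums at another angle. -/
theorem paritySign_mul_oddSinDet {n : ℕ} (θ : ℝ) (x : Fin n → ℤ) :
    paritySign x * oddSinDet θ x = oddSinDet (θ + π) x := by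
  rw [paritySign_eq_prod, oddSinDet, oddSinDet, ← Matrix.det_mul_row]
  congr 1
  ext i j
  simp only [Matrix.of_apply]
  have : (2 * ((i : ℕ) : ℝ) + 1) * (θ + π) * x j =
      (2 * ((i : ℕ) : ℝ) + 1) * θ * x j + ((2 * (i : ℕ) + 1 : ℤ) * x j : ℤ) * π := by
    push_cast; ring
  rw [this, sin_add_int_mul_pi, _root_.zpow_mul, zpow_add₀ (by norm_num), _root_.zpow_mul]
  norm_num

end AlcoveSums

/-! ### Closed forms of the sums and the final asymptotics -/

section FinalAssembly

open Finset Real Filter Asymptotics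

theorem prod_Icc_one_eq_prod_range (g : ℕ → ℝ) (n : ℕ) :
    ∏ h ∈ Icc 1 n, g h = ∏ j ∈ range n, g (j + 1) := by
  induction n with
  | zero => simp
  | succ n ih => rw [prod_Icc_succ_top (by omega), prod_range_succ, ih]

theorem prod_range_neg_one_pow_succ (n : ℕ) :
    ∏ j ∈ range n, (-1 : ℝ) ^ (j + 1) = (-1) ^ (n + 1).choose 2 := by
  induction n with
  | zero => simp
  | succ n ih =>
    rw [prod_range_succ, ih, ← pow_add, Nat.choose_succ_succ' (n + 1) 1, Nat.choose_one_right,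
      add_comm]

theorem rowProd_eq_rowQuot (n : ℕ) (m c : ℝ) : rowProd n m c = rowQuot n (π / (2 * m)) c := by
  rw [rowProd, rowQuot]
  refine prod_congr rfl fun h _ => ?_
  congr 2 <;> ring

theorem rectProd_eq_rectQuot (n : ℕ) (m c : ℝ) : rectProd n m c = rectQuot n (π / (2 * m)) c := by
  rw [rectProd, rectQuot]
  refine prod_congr rfl fun h _ => prod_congr rfl fun t _ => ?_
  congr 2 <;> ring

/-- Each factor acquires the sign (-1)^{N-n}, and the number n(n-1) of factors is even. -/
theorem rectQuot_add_pi (n N : ℕ) (θ : ℝ) : rectQuot n (θ + π) N = rectQuot n θ N := by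
  have key : ∀ h t : ℕ, sin (((N : ℝ) + t - h) * (θ + π)) / sin (((n : ℝ) + t - h) * (θ + π)) =
      (-1 : ℝ) ^ ((N : ℤ) - n) * (sin (((N : ℝ) + t - h) * θ) / sin (((n : ℝ) + t - h) * θ)) := by
    intro h t
    have e : ∀ a : ℕ, ((a : ℝ) + t - h) * (θ + π) =
        ((a : ℝ) + t - h) * θ + ((a + t - h : ℤ) : ℝ) * π := fun a => by push_cast; ring
    rw [e, e, sin_add_int_mul_pi, sin_add_int_mul_pi, mul_div_mul_comm, ← zpow_sub₀ (by norm_num)]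
    congr 2
    ring
  rw [rectQuot, rectQuot]
  simp_rw [key, prod_mul_distrib, prod_const, Nat.card_Icc, Nat.add_sub_cancel, ← pow_mul]
  obtain ⟨r, hr⟩ := Nat.even_mul_pred_self n
  have hsq : ((-1 : ℝ) ^ ((N : ℤ) - n)) ^ 2 = 1 := by rw [sq, ← mul_zpow]; norm_num
  rw [hr, ← two_mul, pow_mul, hsq, one_pow, one_mul]

theorem sin_int_mul_half_add_pi (θ : ℝ) (a : ℤ) :
    sin (2 * a * ((θ + π) / 2)) = (-1) ^ a * sin (2 * a * (θ / 2)) := by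
  rw [← sin_add_int_mul_pi]
  congr 1
  ring

theorem sin_odd_mul_half_add_pi (θ : ℝ) (a : ℤ) :
    sin ((2 * a + 1) * ((θ + π) / 2)) = (-1) ^ a * cos ((2 * a + 1) * (θ / 2)) := by
  rw [← cos_add_int_mul_pi, ← sin_add_pi_div_two]
  congr 1
  ring

/-- Factors are grouped in pairs 2j + 1, 2j + 2. Half the angle moves by π/2, so odd multiples turn
sine into cosine and even multiples only change sign; the signs of each pair cancel. -/
theorem rowQuot_add_pi_of_even {n N : ℕ} {m : ℝ} {e : ℤ} (he : (N : ℤ) - n = 2 * e) :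
    rowQuot n (π / (2 * m) + π) N = ∏ h ∈ Icc 1 n,
      cos (π * (N - n + 2 * h - 1) / (4 * m)) * sin (π * (N - n + 2 * h) / (4 * m)) /
        signedDenom m h := by
  have he' : (N : ℝ) - n = 2 * (e : ℝ) := by exact_mod_cast he
  rw [rowQuot, prod_Icc_two_mul, prod_Icc_one_eq_prod_range]
  refine prod_congr rfl fun j _ => ?_
  have s1 := sin_int_mul_half_add_pi (π / (2 * m)) (e + j + 1)
  have s2 := sin_odd_mul_half_add_pi (π / (2 * m)) (e + j)
  have s3 := sin_int_mul_half_add_pi (π / (2 * m)) (j + 1)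
  have s4 := sin_odd_mul_half_add_pi (π / (2 * m)) j
  rw [signedDenom, he']
  push_cast at s1 s2 s3 s4 ⊢
  rw [show 2 * (e : ℝ) + (2 * j + 2) = 2 * (e + j + 1) by ring,
    show 2 * (e : ℝ) + (2 * j + 1) = 2 * (e + j) + 1 by ring,
    show 2 * (j : ℝ) + 2 = 2 * (j + 1) by ring, s1, s2, s3, s4,
    show π * (2 * e + 2 * ((j : ℝ) + 1) - 1) / (4 * m) =
      (2 * (e + j) + 1) * (π / (2 * m) / 2) by ring,
    show π * (2 * e + 2 * ((j : ℝ) + 1)) / (4 * m) =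
      2 * (e + j + 1) * (π / (2 * m) / 2) by ring,
    show π * (2 * ((j : ℝ) + 1) - 1) / (4 * m) = (2 * j + 1) * (π / (2 * m) / 2) by ring,
    show π * ((j : ℝ) + 1) / (2 * m) = 2 * (j + 1) * (π / (2 * m) / 2) by ring]
  rw [mul_div_mul_comm, mul_div_mul_comm, ← zpow_sub₀ (by norm_num), ← zpow_sub₀ (by norm_num),
    show (e + j + 1 - (j + 1) : ℤ) = e by ring, show (e + j - j : ℤ) = e by ring]
  have h1 : (-1 : ℝ) ^ e * (-1) ^ e = 1 := by rw [← mul_zpow]; norm_num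
  rw [mul_mul_mul_comm, h1, one_mul, mul_comm, div_mul_div_comm]

/-- Now sine and cosine trade places in the numerator, and each of the n pairs keeps a sign -1; this
accounts for the change from binom(n+1, 2) to binom(n, 2). -/
theorem rowQuot_add_pi_of_odd {n N : ℕ} {m : ℝ} {e : ℤ} (he : (N : ℤ) - n = 2 * e - 1) :
    rowQuot n (π / (2 * m) + π) N = (-1) ^ n * ∏ h ∈ Icc 1 n,
      sin (π * (N - n + 2 * h - 1) / (4 * m)) * cos (π * (N - n + 2 * h) / (4 * m)) /
        signedDenom m h := by
  have he' : (N : ℝ) - n = 2 * (e : ℝ) - 1 := by exact_mod_cast he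
  rw [rowQuot, prod_Icc_two_mul, prod_Icc_one_eq_prod_range,
    show (-1 : ℝ) ^ n = ∏ j ∈ range n, (-1 : ℝ) by simp, ← prod_mul_distrib]
  refine prod_congr rfl fun j _ => ?_
  have s1 := sin_odd_mul_half_add_pi (π / (2 * m)) (e + j)
  have s2 := sin_int_mul_half_add_pi (π / (2 * m)) (e + j)
  have s3 := sin_int_mul_half_add_pi (π / (2 * m)) (j + 1)
  have s4 := sin_odd_mul_half_add_pi (π / (2 * m)) j
  rw [signedDenom, he']
  push_cast at s1 s2 s3 s4 ⊢
  rw [show 2 * (e : ℝ) - 1 + (2 * j + 2) = 2 * (e + j) + 1 by ring,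
    show 2 * (e : ℝ) - 1 + (2 * j + 1) = 2 * (e + j) by ring,
    show 2 * (j : ℝ) + 2 = 2 * (j + 1) by ring, s1, s2, s3, s4,
    show π * (2 * e - 1 + 2 * ((j : ℝ) + 1) - 1) / (4 * m) =
      2 * (e + j) * (π / (2 * m) / 2) by ring,
    show π * (2 * e - 1 + 2 * ((j : ℝ) + 1)) / (4 * m) =
      (2 * (e + j) + 1) * (π / (2 * m) / 2) by ring,
    show π * (2 * ((j : ℝ) + 1) - 1) / (4 * m) = (2 * j + 1) * (π / (2 * m) / 2) by ring,
    show π * ((j : ℝ) + 1) / (2 * m) = 2 * (j + 1) * (π / (2 * m) / 2) by ring]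
  rw [mul_div_mul_comm, mul_div_mul_comm, ← zpow_sub₀ (by norm_num), ← zpow_sub₀ (by norm_num),
    show (e + j - (j + 1) : ℤ) = e - 1 by ring, show (e + j - j : ℤ) = e by ring]
  have h1 : (-1 : ℝ) ^ (e - 1) * (-1) ^ e = -1 := by
    rw [zpow_sub_one₀ (by norm_num), mul_right_comm, ← mul_zpow]; norm_num
  rw [mul_mul_mul_comm, h1, mul_comm (_ / _) (_ / _), div_mul_div_comm]

theorem prod_Ioi_rev {n : ℕ} (F : Fin n → Fin n → ℝ) :
    ∏ i, ∏ j ∈ Ioi i, F (Fin.rev i) (Fin.rev j) = ∏ i, ∏ j ∈ Ioi i, F j i := by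
  have h : ∀ G : Fin n → Fin n → ℝ,
      ∏ i, ∏ j ∈ Ioi i, G i j = ∏ i, ∏ j, if i < j then G i j else 1 := by
    intro G
    refine prod_congr rfl fun i _ => ?_
    rw [← prod_filter]
    congr 1
    ext j
    simp
  rw [h, h, Finset.prod_comm, ← Equiv.prod_comp Fin.revPerm]
  refine prod_congr rfl fun i _ => ?_
  rw [← Equiv.prod_comp Fin.revPerm]
  simp

theorem prod_Ioi_const_sixteen (n : ℕ) :
    ∏ i : Fin n, ∏ _j ∈ Ioi i, (16 : ℝ) = 4 ^ (n * (n - 1)) := by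
  simp_rw [prod_const, Fin.card_Ioi]
  rw [prod_pow_eq_pow_sum, Fin.sum_univ_eq_sum_range (fun i => n - 1 - i) n,
    sum_range_reflect (fun i => i) n, ← sum_range_id_mul_two, mul_comm, pow_mul]
  norm_num

/-- Both determinants factor over pairs of indices, with a constant 4 per pair in each; this is the
origin of P_η. -/
theorem oddSinDet_mul_oddSinDet_rev (n : ℕ) (m : ℝ) (η : Fin n → ℤ) :
    oddSinDet (π / (2 * m)) η *
      oddSinDet (π / (2 * m)) ((fun j : Fin n => ((j : ℕ) : ℤ) + 1) ∘ Fin.rev) =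
      4 ^ (n * (n - 1)) * startProd n m η := by
  have h1 := prod_Ioi_rev fun i j : Fin n => 4 * sin (π / (2 * m) * (((i : ℕ) + 1 : ℝ) -
    ((j : ℕ) + 1 : ℝ))) * sin (π / (2 * m) * (((i : ℕ) + 1 : ℝ) + ((j : ℕ) + 1 : ℝ)))
  have h2 := Equiv.prod_comp Fin.revPerm fun i : Fin n => sin (π / (2 * m) * ((i : ℕ) + 1 : ℝ))
  rw [oddSinDet_eq_prod, oddSinDet_eq_prod, ← prod_Ioi_const_sixteen, startProd]
  simp only [Function.comp_apply, Int.cast_add, Int.cast_natCast, Int.cast_one] at h1 h2 ⊢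
  simp only [Fin.revPerm_apply] at h2
  rw [h1, h2, mul_mul_mul_comm, mul_comm,
    ← mul_assoc (∏ i : Fin n, ∏ _j ∈ Ioi i, (16 : ℝ))]
  congr 1
  · simp_rw [← prod_mul_distrib]
    refine prod_congr rfl fun i _ => prod_congr rfl fun j _ => ?_
    rw [show π * ((η i : ℝ) - η j) / (2 * m) = π / (2 * m) * (η i - η j) by ring,
      show π * ((η i : ℝ) + η j) / (2 * m) = π / (2 * m) * (η i + η j) by ring,
      show π * (((j : ℕ) + 1 : ℝ) - ((i : ℕ) + 1)) / (2 * m) =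
        π / (2 * m) * (((j : ℕ) + 1 : ℝ) - ((i : ℕ) + 1)) by ring,
      show π * (((j : ℕ) + 1 : ℝ) + ((i : ℕ) + 1)) / (2 * m) =
        π / (2 * m) * (((j : ℕ) + 1 : ℝ) + ((i : ℕ) + 1)) by ring]
    ring
  · rw [← prod_mul_distrib]
    refine prod_congr rfl fun i _ => ?_
    congr 2 <;> ring

theorem paritySign_natCast_add_one (n : ℕ) :
    paritySign (fun j : Fin n => ((j : ℕ) : ℤ) + 1) = (-1) ^ (n + 1).choose 2 := by
  rw [paritySign_eq_prod, ← prod_range_neg_one_pow_succ,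
    ← Fin.prod_univ_eq_prod_range (fun j => (-1 : ℝ) ^ (j + 1)) n]
  refine prod_congr rfl fun j _ => ?_
  rw [← zpow_natCast]
  push_cast
  rfl

theorem sum_oddSinDet_shift {n : ℕ} {T : ℤ} (hn : 2 * (n : ℤ) ≤ T) (N : ℕ) :
    ∑ y ∈ monoTuples n (Icc (1 : ℤ) N), oddSinDet (π / T) y =
      oddSinDet (π / T) (fun j : Fin n => ((j : ℕ) : ℤ) + 1) *
        (rowQuot n (π / T) N * rectQuot n (π / T) N) := by
  refine sum_oddSinDet n N _ (fun h h1 h2 => ?_) fun h h1 h2 => ?_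
  · have := sin_int_mul_pi_div_pos (T := 2 * T) (a := h) (by omega) (by omega)
    push_cast at this
    rw [show (h : ℝ) * (π / T / 2) = h * (π / (2 * T)) by ring]
    exact this.ne'
  · exact_mod_cast (sin_int_mul_pi_div_pos (T := T) (a := h) (by omega) (by omega)).ne'

theorem sum_oddSinDet_add_pi {n : ℕ} {T : ℤ} (hn : 2 * (n : ℤ) ≤ T) (N : ℕ) :
    ∑ y ∈ monoTuples n (Icc (1 : ℤ) N), oddSinDet (π / T + π) y =
      oddSinDet (π / T) (fun j : Fin n => ((j : ℕ) : ℤ) + 1) * ((-1) ^ (n + 1).choose 2 *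
        (rowQuot n (π / T + π) N * rectQuot n (π / T) N)) := by
  rw [sum_oddSinDet n N _ (fun h h1 h2 => ?_) fun h h1 h2 => ?_, rectQuot_add_pi,
    ← paritySign_mul_oddSinDet, paritySign_natCast_add_one]
  · ring
  · have hz : ∀ a : ℤ, (-1 : ℝ) ^ a ≠ 0 := fun a => zpow_ne_zero _ (by norm_num)
    have hT : (0 : ℝ) < T := by exact_mod_cast (by omega : 0 < T)
    rcases Nat.even_or_odd' h with ⟨a, rfl | rfl⟩
    · have := sin_int_mul_half_add_pi (π / T) a
      push_cast at this ⊢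
      rw [this]
      refine mul_ne_zero (pow_ne_zero _ (by norm_num)) ?_
      have := sin_int_mul_pi_div_pos (T := T) (a := a) (by omega) (by omega)
      push_cast at this
      rw [show 2 * (a : ℝ) * (π / T / 2) = a * (π / T) by ring]
      exact this.ne'
    · have := sin_odd_mul_half_add_pi (π / T) a
      push_cast at this ⊢
      rw [this]
      refine mul_ne_zero (pow_ne_zero _ (by norm_num)) (cos_pos_of_mem_Ioo ⟨?_, ?_⟩).ne'
      · exact lt_trans (by linarith [pi_pos]) (by positivity : 0 < (2 * (a : ℝ) + 1) * (π / T / 2))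
      · have h3 : (2 * (a : ℝ) + 1) < T := by exact_mod_cast (by omega : 2 * (a : ℤ) + 1 < T)
        rw [show (2 * (a : ℝ) + 1) * (π / T / 2) = (2 * (a : ℝ) + 1) * π / (2 * T) by ring,
          div_lt_div_iff₀ (by positivity) (by norm_num)]
        nlinarith [pi_pos]
  · have e : (h : ℝ) * (π / T + π) = h * (π / T) + (h : ℤ) * π := by push_cast; ring
    rw [e, sin_add_int_mul_pi]
    refine mul_ne_zero (zpow_ne_zero _ (by norm_num)) ?_
    exact_mod_cast (sin_int_mul_pi_div_pos (T := T) (a := h) (by omega) (by omega)).ne'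

/-- The dimension of the alcove bounds `T` from below as soon as the alcove has an integer point. -/
theorem two_mul_le_of_mem_latticeAlcove {n : ℕ} (hn : 2 ≤ n) {T : ℤ} {x : Fin n → ℤ}
    (hx : x ∈ latticeAlcove n T) : 2 * (n : ℤ) ≤ T := by
  have h0 := le_of_mem_latticeAlcove hn hx ⟨0, by omega⟩
  have h1 := le_of_mem_latticeAlcove hn hx ⟨1, by omega⟩
  have h2 := ((mem_latticeAlcove hn).1 hx).2.2 ⟨0, by omega⟩ ⟨1, by omega⟩ rfl rfl
  simp only [alcoveBase] at h0 h1
  push_cast at h0 h1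
  omega

theorem sum_oddSinDet_latticeAlcove {n : ℕ} (hn : 2 ≤ n) {T : ℤ} (hnT : 2 * (n : ℤ) ≤ T)
    {K₁ K₂ : ℕ} (hK : (K₁ : ℤ) + K₂ + 1 = T) (h1 : K₂ ≤ K₁) (h2 : K₁ ≤ K₂ + 1) :
    ∑ x ∈ latticeAlcove n T, oddSinDet (π / T) x =
      oddSinDet (π / T) ((fun j : Fin n => ((j : ℕ) : ℤ) + 1) ∘ Fin.rev) *
        (rowQuot n (π / T) K₁ * rectQuot n (π / T) K₁ +
          rowQuot n (π / T) K₂ * rectQuot n (π / T) K₂) := by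
  rw [sum_latticeAlcove hn hK h1 h2]
  simp_rw [oddSinDet_reflectFirst (by omega : 0 < T), oddSinDet_comp_rev, ← mul_sum,
    sum_oddSinDet_shift hnT]
  ring

theorem sum_paritySign_mul_oddSinDet_latticeAlcove {n : ℕ} (hn : 2 ≤ n) {T : ℤ}
    (hnT : 2 * (n : ℤ) ≤ T)
    {K₁ K₂ : ℕ} (hK : (K₁ : ℤ) + K₂ + 1 = T) (h1 : K₂ ≤ K₁) (h2 : K₁ ≤ K₂ + 1) :
    ∑ x ∈ latticeAlcove n T, paritySign x * oddSinDet (π / T) x =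
      oddSinDet (π / T) ((fun j : Fin n => ((j : ℕ) : ℤ) + 1) ∘ Fin.rev) *
        ((-1) ^ (n + 1).choose 2 * (rowQuot n (π / T + π) K₁ * rectQuot n (π / T) K₁ +
          (-1) ^ T * (rowQuot n (π / T + π) K₂ * rectQuot n (π / T) K₂))) := by
  rw [sum_latticeAlcove hn hK h1 h2]
  simp_rw [oddSinDet_reflectFirst (by omega : 0 < T), paritySign_reflectFirst (by omega : 0 < n),
    paritySign_comp_rev, oddSinDet_comp_rev, mul_assoc, mul_left_comm (paritySign _),
    paritySign_mul_oddSinDet, ← mul_sum, sum_oddSinDet_add_pi hnT]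
  ring

/-- The two halves have δ = K₁ - K₂ and δ = K₂ - K₁, so their rank-one corrections cancel. -/
theorem sum_oddSinDet_sq_latticeAlcove {n : ℕ} (hn : 2 ≤ n) {T : ℤ} (hnT : 2 * (n : ℤ) ≤ T)
    {K₁ K₂ : ℕ} (hK : (K₁ : ℤ) + K₂ + 1 = T) (h1 : K₂ ≤ K₁) (h2 : K₁ ≤ K₂ + 1) :
    ∑ x ∈ latticeAlcove n T, oddSinDet (π / T) x ^ 2 = 2 * ((T : ℝ) / 4) ^ n := by
  have hs : ((((Equiv.Perm.sign (Fin.revPerm : Equiv.Perm (Fin n)) : ℤˣ) : ℤ) : ℝ)) ^ 2 = 1 := by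
    rw [← Int.cast_pow, ← Units.val_pow_eq_pow_val, Int.units_sq]
    simp
  rw [sum_latticeAlcove hn hK h1 h2]
  simp_rw [oddSinDet_reflectFirst (by omega : 0 < T), oddSinDet_comp_rev, mul_pow, hs, one_mul]
  rw [sum_oddSinDet_sq (δ := (K₁ : ℤ) - K₂) (by omega) hnT (by omega) (by omega),
    sum_oddSinDet_sq (δ := (K₂ : ℤ) - K₁) (by omega) hnT (by omega) (by omega)]
  push_cast
  ring

/-- The asymptotic number of walks, for integers and half-integers `m` at the same time. -/
theorem isEquivalent_numWalksB {n : ℕ} (hn : 2 ≤ n) {T : ℤ} {m : ℝ} (hT : 2 * m = T)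
    {η : Fin n → ℤ} (hη : η ∈ latticeAlcove n T) {K₁ K₂ : ℕ} (hK : (K₁ : ℤ) + K₂ + 1 = T)
    (h1 : K₂ ≤ K₁) (h2 : K₁ ≤ K₂ + 1) :
    IsEquivalent atTop (fun k : ℕ => (numWalksB n m η k : ℝ)) fun k : ℕ =>
      4 ^ (n ^ 2) / (2 * (2 * m) ^ n) * growthRate n m ^ k * startProd n m η *
        (rowProd n m K₁ * rectProd n m K₁ + rowProd n m K₂ * rectProd n m K₂ +
          (-1) ^ k * paritySign η * ((-1) ^ (n + 1).choose 2 *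
            (rowQuot n (π / (2 * m) + π) K₁ * rectProd n m K₁ +
              (-1) ^ T * (rowQuot n (π / (2 * m) + π) K₂ * rectProd n m K₂)))) := by
  have hnT := two_mul_le_of_mem_latticeAlcove hn hη
  have hT0 : 0 < T := by omega
  have hTr : (0 : ℝ) < T := by exact_mod_cast hT0
  have key := isEquivalent_pow_mulVec_one (stepMatrix n T) (stepMatrix_nonneg n T)
    (stepMatrix_symm n T) (stepMatrix_connected hn) (fun x => paritySign x.1)
    (fun x => paritySign_mul_self x.1)
    (fun x y hxy => by
      obtain ⟨s, hs⟩ := exists_step_of_stepMatrix_ne_zero hxy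
      rw [← hs, paritySign_step])
    (fun x => oddSinDet (π / T) x.1) (fun x => oddSinDet_pos hn hT0 x.2)
    (∑ i : Fin n, 2 * cos ((2 * ((i : ℕ) : ℝ) + 1) * (π / T)))
    (fun x => by
      rw [sum_stepMatrix_mul x _ fun s hs => oddSinDet_boundary hn hT0 x.2 s hs,
        sum_oddSinDet_step])
    ⟨η, hη⟩
  have hg : ∑ i : Fin n, 2 * cos ((2 * ((i : ℕ) : ℝ) + 1) * (π / T)) = growthRate n m := by
    have hs := sin_int_mul_pi_div_pos (T := T) (a := 1) (by omega) (by omega)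
    rw [Int.cast_one, one_mul] at hs
    rw [growthRate, hT, eq_div_iff hs.ne', sum_two_cos_odd]
    congr 1
    rw [← hT]
    have : m ≠ 0 := by rintro rfl; linarith
    field_simp
  have e1 := sum_coe_sort (latticeAlcove n T) fun x => oddSinDet (π / T) x
  have e2 := sum_coe_sort (latticeAlcove n T) fun x => oddSinDet (π / T) x ^ 2
  have e3 := sum_coe_sort (latticeAlcove n T) fun x => paritySign x * oddSinDet (π / T) x
  rw [sum_oddSinDet_latticeAlcove hn hnT hK h1 h2] at e1
  rw [sum_oddSinDet_sq_latticeAlcove hn hnT hK h1 h2] at e2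
  rw [sum_paritySign_mul_oddSinDet_latticeAlcove hn hnT hK h1 h2] at e3
  simp only [e1, e2, e3, hg] at key
  simp_rw [← numWalksB_eq_pow hn hT] at key
  refine key.congr_right (Eventually.of_forall fun k => ?_)
  have hv := oddSinDet_mul_oddSinDet_rev n m η
  have h4 : (4 : ℝ) ^ (n ^ 2) = 4 ^ (n * (n - 1)) * 4 ^ n := by
    rw [← pow_add]
    congr 1
    obtain ⟨n, rfl⟩ : ∃ k, n = k + 1 := ⟨n - 1, by omega⟩
    simp only [Nat.add_sub_cancel]
    ring
  simp only [rowProd_eq_rowQuot, rectProd_eq_rectQuot]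
  rw [hT] at hv ⊢
  rw [h4, div_pow]
  -- The shifted angle is made opaque so that clearing denominators leaves it intact.
  generalize π / T + π = φ
  field_simp
  linear_combination (growthRate n m ^ k * (rowQuot n (π / T) K₁ * rectQuot n (π / T) K₁ +
    rowQuot n (π / T) K₂ * rectQuot n (π / T) K₂ + (-1) ^ k * paritySign η *
      ((-1) ^ (n + 1).choose 2 * (rowQuot n φ K₁ * rectQuot n (π / T) K₁ +
        (-1) ^ T * (rowQuot n φ K₂ * rectQuot n (π / T) K₂))))) * hv

theorem neg_one_zpow_add_add {n : ℕ} (η : Fin n → ℤ) (k c : ℕ) :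
    (-1 : ℝ) ^ ((∑ i, η i) + (k : ℤ) + (c : ℤ)) = (-1) ^ k * paritySign η * (-1) ^ c := by
  rw [zpow_add₀ (by norm_num), zpow_add₀ (by norm_num), zpow_natCast, zpow_natCast, paritySign]
  ring

theorem neg_one_pow_choose_succ (n : ℕ) :
    (-1 : ℝ) ^ (n + 1).choose 2 * (-1) ^ n = (-1) ^ n.choose 2 := by
  rw [Nat.choose_succ_succ' n 1, Nat.choose_one_right, pow_add, mul_right_comm, ← mul_pow]
  norm_num

end FinalAssembly

theorem mainTheorem10 (n : ℕ) (hn : 2 ≤ n) (m : ℝ) (hm : 0 < m)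
    (hm' : (∃ M : ℤ, m = M) ∨ IsHalfInteger m)
    (η : Fin n → ℤ) (hη : (fun j => (η j : ℝ)) ∈ alcoveB n m) :
    (∀ M : ℤ, m = M → M ≡ n [ZMOD 2] →
      Asymptotics.IsEquivalent Filter.atTop (fun k : ℕ => (numWalksB n m η k : ℝ))
        (fun k : ℕ =>
          4 ^ (n ^ 2) / (2 * (2 * m) ^ n) * growthRate n m ^ k * startProd n m η *
          (rowProd n m m * rectProd n m m
            + rowProd n m (m - 1) * rectProd n m (m - 1)
            + (-1 : ℝ) ^ ((∑ i, η i) + (k : ℤ) + ((n + 1).choose 2 : ℤ)) *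
              (∏ h ∈ Finset.Icc 1 n,
                Real.cos (Real.pi * (m - n + 2 * h - 1) / (4 * m)) *
                  Real.sin (Real.pi * (m - n + 2 * h) / (4 * m)) / signedDenom m h) *
              rectProd n m m
            + (-1 : ℝ) ^ ((∑ i, η i) + (k : ℤ) + (n.choose 2 : ℤ)) *
              (∏ h ∈ Finset.Icc 1 n,
                Real.sin (Real.pi * (m - n + 2 * h - 2) / (4 * m)) *
                  Real.cos (Real.pi * (m - n + 2 * h - 1) / (4 * m)) / signedDenom m h) *
              rectProd n m (m - 1)))) ∧
    (∀ M : ℤ, m = M → ¬ M ≡ n [ZMOD 2] →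
      Asymptotics.IsEquivalent Filter.atTop (fun k : ℕ => (numWalksB n m η k : ℝ))
        (fun k : ℕ =>
          4 ^ (n ^ 2) / (2 * (2 * m) ^ n) * growthRate n m ^ k * startProd n m η *
          (rowProd n m m * rectProd n m m
            + rowProd n m (m - 1) * rectProd n m (m - 1)
            + (-1 : ℝ) ^ ((∑ i, η i) + (k : ℤ) + (n.choose 2 : ℤ)) *
              (∏ h ∈ Finset.Icc 1 n,
                Real.sin (Real.pi * (m - n + 2 * h - 1) / (4 * m)) *
                  Real.cos (Real.pi * (m - n + 2 * h) / (4 * m)) / signedDenom m h) *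
              rectProd n m m
            + (-1 : ℝ) ^ ((∑ i, η i) + (k : ℤ) + ((n + 1).choose 2 : ℤ)) *
              (∏ h ∈ Finset.Icc 1 n,
                Real.cos (Real.pi * (m - n + 2 * h - 2) / (4 * m)) *
                  Real.sin (Real.pi * (m - n + 2 * h - 1) / (4 * m)) / signedDenom m h) *
              rectProd n m (m - 1)))) ∧
    (IsHalfInteger m →
      Asymptotics.IsEquivalent Filter.atTop (fun k : ℕ => (numWalksB n m η k : ℝ))
        (fun k : ℕ =>
          4 ^ (n ^ 2) / (2 * m) ^ n * growthRate n m ^ k * startProd n m η *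
          (rowProd n m (⌊m⌋ : ℝ) * rectProd n m (⌊m⌋ : ℝ)))) := by
  have hTex : ∃ T : ℤ, 2 * m = T := by
    rcases hm' with ⟨M, rfl⟩ | ⟨a, -, rfl⟩
    · exact ⟨2 * M, by push_cast; ring⟩
    · exact ⟨a, by ring⟩
  obtain ⟨T, hT⟩ := hTex
  have hη' : η ∈ latticeAlcove n T := (mem_alcoveB_iff hn hT).1 hη
  have hnT := two_mul_le_of_mem_latticeAlcove hn hη'
  have integral : ∀ M : ℤ, m = M → ∃ N : ℕ, T = 2 * (N + 1) ∧ M = N + 1 := by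
    intro M hM
    have hTM : T = 2 * M := by
      rw [hM] at hT
      exact_mod_cast hT.symm
    exact ⟨(M - 1).toNat, by omega, by omega⟩
  refine ⟨fun M hM hpar => ?_, fun M hM hpar => ?_, fun hhalf => ?_⟩
  · obtain ⟨N, hTN, rfl⟩ := integral M hM
    have hmN : m = (N : ℝ) + 1 := by rw [hM]; push_cast; rfl
    -- Here T = 2m is even, so the halves are K₁ = m and K₂ = m - 1. Exactly one of K₁ - n, K₂ - n
    -- is even, and the parity of m - n decides which.
    have key := isEquivalent_numWalksB hn hT hη' (K₁ := N + 1) (K₂ := N) (by push_cast; omega)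
      (by omega) (by omega)
    refine key.congr_right (Filter.Eventually.of_forall fun k => ?_)
    obtain ⟨e, he⟩ : ∃ e, ((N + 1 : ℕ) : ℤ) - n = 2 * e :=
      ⟨(((N + 1 : ℕ) : ℤ) - n) / 2, by rw [Int.ModEq] at hpar; push_cast; omega⟩
    have he' : (N : ℤ) - n = 2 * e - 1 := by push_cast at he; omega
    have hTs : (-1 : ℝ) ^ T = 1 := Even.neg_one_zpow ⟨N + 1, by omega⟩
    have r1 := rowQuot_add_pi_of_even (m := m) he
    have r2 := rowQuot_add_pi_of_odd (m := m) he'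
    have c1 : ((N + 1 : ℕ) : ℝ) = m := by rw [hmN]; push_cast; rfl
    have c2 : (N : ℝ) = m - 1 := by rw [hmN]; ring
    rw [c1] at r1
    rw [c2] at r2
    dsimp only
    rw [c1, c2, r1, r2, hTs, neg_one_zpow_add_add, neg_one_zpow_add_add,
      ← neg_one_pow_choose_succ n]
    have a1 : ∀ h : ℕ, m - n + 2 * h - 1 - 1 = m - n + 2 * h - 2 := fun h => by ring
    have a2 : ∀ h : ℕ, m - 1 - n + 2 * h = m - n + 2 * h - 1 := fun h => by ring
    simp only [a2, a1]
    ring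
  · obtain ⟨N, hTN, rfl⟩ := integral M hM
    have hmN : m = (N : ℝ) + 1 := by rw [hM]; push_cast; rfl
    have key := isEquivalent_numWalksB hn hT hη' (K₁ := N + 1) (K₂ := N) (by push_cast; omega)
      (by omega) (by omega)
    refine key.congr_right (Filter.Eventually.of_forall fun k => ?_)
    obtain ⟨e, he⟩ : ∃ e, (N : ℤ) - n = 2 * e :=
      ⟨((N : ℤ) - n) / 2, by rw [Int.ModEq] at hpar; omega⟩
    have he' : ((N + 1 : ℕ) : ℤ) - n = 2 * (e + 1) - 1 := by push_cast; omega
    have hTs : (-1 : ℝ) ^ T = 1 := Even.neg_one_zpow ⟨N + 1, by omega⟩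
    have r1 := rowQuot_add_pi_of_odd (m := m) he'
    have r2 := rowQuot_add_pi_of_even (m := m) he
    have c1 : ((N + 1 : ℕ) : ℝ) = m := by rw [hmN]; push_cast; rfl
    have c2 : (N : ℝ) = m - 1 := by rw [hmN]; ring
    rw [c1] at r1
    rw [c2] at r2
    dsimp only
    rw [c1, c2, r1, r2, hTs, neg_one_zpow_add_add, neg_one_zpow_add_add,
      ← neg_one_pow_choose_succ n]
    have a1 : ∀ h : ℕ, m - n + 2 * h - 1 - 1 = m - n + 2 * h - 2 := fun h => by ring
    have a2 : ∀ h : ℕ, m - 1 - n + 2 * h = m - n + 2 * h - 1 := fun h => by ring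
    simp only [a2, a1]
    ring
  · obtain ⟨a, ha, hma⟩ := hhalf
    have haT : a = T := by
      rw [hma] at hT
      have : (a : ℝ) = T := by linarith
      exact_mod_cast this
    subst haT
    obtain ⟨b, rfl⟩ := ha
    lift b to ℕ using by omega
    have hfl : ⌊m⌋ = (b : ℤ) := by
      rw [Int.floor_eq_iff, hma]
      push_cast
      constructor <;> linarith
    have key := isEquivalent_numWalksB hn hT hη' (K₁ := b) (K₂ := b) (by ring)
      le_rfl (by omega)
    refine key.congr_right (Filter.Eventually.of_forall fun k => ?_)
    -- For odd T both halves equal ⌊m⌋: the signed terms cancel, and the two equal unsigned terms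
    -- absorb the factor 1/2.
    have hTs : (-1 : ℝ) ^ (2 * (b : ℤ) + 1) = -1 := Odd.neg_one_zpow ⟨b, rfl⟩
    dsimp only
    rw [hTs, hfl, Int.cast_natCast]
    have : (2 * m) ^ n ≠ 0 := pow_ne_zero _ (by positivity)
    field_simp
    ring
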